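/- **Setting.** Let $(\Omega,\mathcal F,\mathbb P)$ be a complete probability space with a right-continuous filtration $(\mathcal F_t)_{t\ge 0}$ such that $\mathcal F_0$ contains all subsets of $\mathbb P$-null sets. Let $X$ be a real Banach space with separable dual $X^*$, let $U$ be a Hausdorff space whose Borel $\sigma$-algebra is standard (for example, $U$ homeomorphic to a Borel subset of the line), and let $\mathcal A$ be a ring of Borel subsets of $U$. Let $M=(M(t,A):t\ge 0,\ A\in\mathcal A)$ be a cylindrical orthogonal martingale-valued measure. That is, each $M(t,A):X^*\to L^0(\Omega,\mathcal F,\mathbb P)$ is linear and continuous for convergence in probability, and for all $x\in X^*$ and $A\in\mathcal A$: * $M(0,A)(x)=0$ a.s.; * $(M(t,A)(x))_{t\ge0}$ has a version that is a càdlàg mean-zero square integrable martingale; * for $t>0$, $N=M(t,\cdot)(x)$ is a $\sigma$-finite $L^2$-valued measure: $N(B)\in L^2$ for all $B\in\mathcal A$, $N$ is finitely additive, and there are Borel sets $U_n\uparrow U$ with $\mathcal B(U_n)\subseteq\mathcal A$, $\sup_{B\in\mathcal B(U_n)}\mathbb E|N(B)|^2<\infty$, $\mathbb E|N(B_j)|^2\to0$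 whenever $B_j\in\mathcal B(U_n)$ decrease to $\emptyset$, and $N(B\cap U_n)\to N(B)$ in $L^2$ for all $B\in\mathcal A$; * for disjoint $A,B\in\mathcal A$ and $t>0$, $\langle M(A)(x),M(B)(x)\rangle_t=0$ a.s., where $\langle\cdot,\cdot\rangle$ is the predictable quadratic covariation. For $x\in X^*$ let $\nu_x$ be the intensity measure of $M(\cdot)(x)$: the random predictable $\sigma$-finite measure on $\mathcal B(\mathbb R_+)\otimes\mathcal B(U)$, unique up to a.s. equality, with $\nu_x([0,t]\times A)=\langle M(A)(x)\rangle_t$ a.s. for all $t\ge0$, $A\in\mathcal A$. Here a random measure $\nu$ is *predictable* if $(\omega,t)\mapsto\nu(\omega)([0,t]\times A)$ is predictable for every $A\in\mathcal B(U)$. A *quadratic variation* of $M$ is a random measure $\eta$ on $\mathcal B(\mathbb R_+)\otimes\mathcal B(U)$ with $\eta([0,t]\times A)<\infty$ a.s. for each $t\ge0$, $A\in\mathcal A$, which is minimal, for the a.s. order, among the random measures $\zeta$ such that $\nu_x\le\zeta$ a.s. for every $x$ with $\|x\|=1$. The family $(\nu_x)$ has the *sequential boundedness property* if for every dense sequence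 $(x_n)$ in the unit sphere of $X^*$, every $x\in X^*$ with $\|x\|=1$ and every $t>0$, almost surely $$\nu_x((s,t]\times A)\le\sup_n\nu_{x_n}((s,t]\times A)\qquad\text{for all }0\le s<t,\ A\in\mathcal A.$$ Assume that $M$ has a quadratic variation and that $(\nu_x)$ has the sequential boundedness property; the quadratic variation is then a.s. unique and is denoted $[M]$. For $T>0$, the covariation operator measure $\Gamma_M$ is the random countably additive $\mathcal L(X^*,X^{**})$-valued measure on $\mathcal B([0,T])\otimes\mathcal B(U)$ such that for all $x,y\in X^*$, almost surely, $$\langle\Gamma_M(C)x,y\rangle=\tfrac14\bigl(\nu_{x+y}(C)-\nu_{x-y}(C)\bigr)\quad\text{for all }C\in\mathcal B([0,T])\otimes\mathcal B(U),$$ and such that for all $x,y\in X^*$, $0\le s\le t\le T$ and $A\in\mathcal A$, almost surely, $$\langle\Gamma_M((s,t]\times A)x,y\rangle=\langle M(A)(x),M(A)(y)\rangle_t-\langle M(A)(x),M(A)(y)\rangle_s .$$ **Theorem.** Let $T>0$ and assume that $\sup_{A\in\mathcal A}[M]([0,T]\times A)<\infty$ almost surely. Then $\Gamma_M$ exists,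 and there is a process $Q_M:\Omega\times[0,T]\times U\to\mathcal L(X^*,X^{**})$ such that for $\mathbb P$-a.e. $\omega$, for all $x,y\in X^*$, the function $\langle Q_M(\omega,\cdot,\cdot)x,y\rangle$ is $[M](\omega)$-integrable on $[0,T]\times U$ and $$\langle\Gamma_M(\omega)(C)x,y\rangle=\int_C\langle Q_M(\omega,r,u)x,y\rangle\,[M](\omega)(dr,du)\qquad\text{for all }C\in\mathcal B([0,T])\otimes\mathcal B(U).$$ Moreover: 1. for all $x,y\in X^*$ the map $(\omega,r,u)\mapsto\langle Q_M(\omega,r,u)x,y\rangle$ is $\mathcal P_T\otimes\mathcal B(U)$-measurable, where $\mathcal P_T$ is the trace on $\Omega\times[0,T]$ of the predictable $\sigma$-algebra; 2. for $\mathbb P$-a.e. $\omega$, for $[M](\omega)$-a.e. $(r,u)\in[0,T]\times U$, the operator $Q_M(\omega,r,u)$ is positive ($\langle Qx,x\rangle\ge0$ for all $x$) and symmetric ($\langle Qx,y\rangle=\langle Qy,x\rangle$ for all $x,y$); 3. for $\mathbb P$-a.e. $\omega$, $\|Q_M(\omega,r,u)\|_{\mathcal L(X^*,X^{**})}=1$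 for $[M](\omega)$-a.e. $(r,u)\in[0,T]\times U$. -/

import Mathlib

set_option maxSynthPendingDepth 3

open MeasureTheory Filter Topology Set
open scoped NNReal ENNReal

namespace CylMVM

section Processes

/-- Right-continuous paths with left limits. -/
def IsCadlag (f : ℝ≥0 → ℝ) : Prop :=
  ∀ t, ContinuousWithinAt f (Ici t) t ∧ ∃ l : ℝ, Tendsto f (𝓝[<] t) (𝓝 l)

/-- Real càdlàg mean-zero square integrable martingales on `[0, ∞)`. -/
structure IsSquareIntegrableMartingale {Ω : Type*} {mΩ : MeasurableSpace Ω}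
    (𝓕 : Filtration ℝ≥0 mΩ) (P : Measure Ω) (Y : ℝ≥0 → Ω → ℝ) : Prop where
  martingale : Martingale Y 𝓕 P
  memLp : ∀ t, MemLp (Y t) 2 P
  mean_zero : ∀ t, ∫ ω, Y t ω ∂P = 0
  cadlag : ∀ ω, IsCadlag (fun t => Y t ω)

/-- `V` is (a version of) the predictable quadratic covariation `⟨Y, Z⟩`: a predictable process
with right-continuous paths of finite variation, null at `0`, such that `Y Z - V` is a
martingale. -/
structure IsPredictableCovariation {Ω : Type*} {mΩ : MeasurableSpace Ω}
    (𝓕 : Filtration ℝ≥0 mΩ) (P : Measure Ω) (Y Z V : ℝ≥0 → Ω → ℝ) : Prop where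
  predictable : IsStronglyPredictable 𝓕 V
  zero : ∀ᵐ ω ∂P, V 0 ω = 0
  rightCont : ∀ᵐ ω ∂P, ∀ t, ContinuousWithinAt (fun s => V s ω) (Ici t) t
  finiteVariation : ∀ᵐ ω ∂P, LocallyBoundedVariationOn (fun s => V s ω) univ
  martingale : Martingale (fun t ω => Y t ω * Z t ω - V t ω) 𝓕 P

end Processes

section MartingaleValuedMeasures

/-- A `σ`-finite `L²(Ω, P)`-valued measure on the ring `𝒜`. -/
def IsSigmaFiniteL2Measure {Ω U : Type*} {mΩ : MeasurableSpace Ω} [MeasurableSpace U]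
    (P : Measure Ω) (𝒜 : Set (Set U)) (N : Set U → Ω →ₘ[P] ℝ) : Prop :=
  (∀ A ∈ 𝒜, MemLp (N A) 2 P) ∧
  (∀ A ∈ 𝒜, ∀ B ∈ 𝒜, Disjoint A B → N (A ∪ B) = N A + N B) ∧
  ∃ S : ℕ → Set U,
    Monotone S ∧ (⋃ n, S n) = univ ∧ (∀ n, MeasurableSet (S n)) ∧
    (∀ n B, MeasurableSet B → B ⊆ S n → B ∈ 𝒜) ∧
    (∀ n, ∃ c : ℝ, ∀ B, MeasurableSet B → B ⊆ S n → ∫ ω, (N B ω) ^ 2 ∂P ≤ c) ∧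
    (∀ n (E : ℕ → Set U), (∀ j, MeasurableSet (E j) ∧ E j ⊆ S n) → Antitone E →
      (⋂ j, E j) = ∅ → Tendsto (fun j => ∫ ω, (N (E j) ω) ^ 2 ∂P) atTop (𝓝 0)) ∧
    (∀ A ∈ 𝒜, Tendsto (fun n => ∫ ω, (N A ω - N (A ∩ S n) ω) ^ 2 ∂P) atTop (𝓝 0))

/-- The real process `t ↦ M(t, A)(x)`. -/
noncomputable def proc {Ω U X : Type*} {mΩ : MeasurableSpace Ω} [NormedAddCommGroup X] [NormedSpace ℝ X]
    {P : Measure Ω} (M : ℝ≥0 → Set U → StrongDual ℝ X →ₗ[ℝ] (Ω →ₘ[P] ℝ))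
    (A : Set U) (x : StrongDual ℝ X) : ℝ≥0 → Ω → ℝ :=
  fun t ω => M t A x ω

/-- Cylindrical orthogonal martingale-valued measures. A linear map into `Ω →ₘ[P] ℝ` (random
variables up to almost sure equality) satisfying `continuous` is a cylindrical random variable;
the values `M t A` for `A ∉ 𝒜` are irrelevant. -/
structure IsCylindricalOrthogonalMVM {Ω U X : Type*} {mΩ : MeasurableSpace Ω}
    [MeasurableSpace U] [NormedAddCommGroup X] [NormedSpace ℝ X]
    (𝓕 : Filtration ℝ≥0 mΩ) (P : Measure Ω) (𝒜 : Set (Set U))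
    (M : ℝ≥0 → Set U → StrongDual ℝ X →ₗ[ℝ] (Ω →ₘ[P] ℝ)) : Prop where
  continuous : ∀ t, ∀ A ∈ 𝒜, ∀ x₀ : StrongDual ℝ X,
    TendstoInMeasure P (fun x ω => M t A x ω) (𝓝 x₀) (fun ω => M t A x₀ ω)
  zero : ∀ A ∈ 𝒜, ∀ x, M 0 A x = 0
  martingale : ∀ A ∈ 𝒜, ∀ x, ∃ Y : ℝ≥0 → Ω → ℝ,
    IsSquareIntegrableMartingale 𝓕 P Y ∧ ∀ t, Y t =ᵐ[P] proc M A x t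
  measure : ∀ t > 0, ∀ x, IsSigmaFiniteL2Measure P 𝒜 (fun A => M t A x)
  orthogonal : ∀ x, ∀ A ∈ 𝒜, ∀ B ∈ 𝒜, Disjoint A B → ∃ V : ℝ≥0 → Ω → ℝ,
    IsPredictableCovariation 𝓕 P (proc M A x) (proc M B x) V ∧ ∀ t > 0, ∀ᵐ ω ∂P, V t ω = 0

end MartingaleValuedMeasures

section QuadraticVariation

/-- `ν` is (a version of) the intensity measure `ν_x` of the real martingale-valued measure
`M(·)(x)`: the predictable `σ`-finite random measure on `[0, ∞) × U` with
`ν([0, t] × A) = ⟨M(A)(x)⟩_t` almost surely. -/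
structure IsIntensityMeasure {Ω U X : Type*} {mΩ : MeasurableSpace Ω}
    [MeasurableSpace U] [NormedAddCommGroup X] [NormedSpace ℝ X]
    (𝓕 : Filtration ℝ≥0 mΩ) (P : Measure Ω) (𝒜 : Set (Set U))
    (M : ℝ≥0 → Set U → StrongDual ℝ X →ₗ[ℝ] (Ω →ₘ[P] ℝ)) (x : StrongDual ℝ X)
    (ν : Ω → Measure (ℝ≥0 × U)) : Prop where
  measurable : Measurable ν
  sigmaFinite : ∀ᵐ ω ∂P, SigmaFinite (ν ω)
  predictable : ∀ A, MeasurableSet A →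
    Measurable[𝓕.predictable] fun p : ℝ≥0 × Ω => ν p.2 (Icc 0 p.1 ×ˢ A)
  bracket : ∀ A ∈ 𝒜, ∃ V : ℝ≥0 → Ω → ℝ,
    IsPredictableCovariation 𝓕 P (proc M A x) (proc M A x) V ∧
    ∀ t, ∀ᵐ ω ∂P, ν ω (Icc 0 t ×ˢ A) < ∞ ∧ (ν ω (Icc 0 t ×ˢ A)).toReal = V t ω

/-- The random measure `ζ` satisfies `ν_x ≤ ζ` almost surely, for every `x` in the unit sphere. -/
def Dominates {Ω U X : Type*} {mΩ : MeasurableSpace Ω}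
    [MeasurableSpace U] [NormedAddCommGroup X] [NormedSpace ℝ X]
    (𝓕 : Filtration ℝ≥0 mΩ) (P : Measure Ω) (𝒜 : Set (Set U))
    (M : ℝ≥0 → Set U → StrongDual ℝ X →ₗ[ℝ] (Ω →ₘ[P] ℝ))
    (ζ : Ω → Measure (ℝ≥0 × U)) : Prop :=
  Measurable ζ ∧ ∀ x : StrongDual ℝ X, ‖x‖ = 1 →
    ∃ ν, IsIntensityMeasure 𝓕 P 𝒜 M x ν ∧ ∀ᵐ ω ∂P, ν ω ≤ ζ ω

/-- `η` is a quadratic variation of `M`: almost surely finite on each `[0, t] × A`, and minimal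
among the random measures dominating all `ν_x`, `‖x‖ = 1`. -/
structure IsQuadraticVariation {Ω U X : Type*} {mΩ : MeasurableSpace Ω}
    [MeasurableSpace U] [NormedAddCommGroup X] [NormedSpace ℝ X]
    (𝓕 : Filtration ℝ≥0 mΩ) (P : Measure Ω) (𝒜 : Set (Set U))
    (M : ℝ≥0 → Set U → StrongDual ℝ X →ₗ[ℝ] (Ω →ₘ[P] ℝ))
    (η : Ω → Measure (ℝ≥0 × U)) : Prop where
  finite : ∀ t, ∀ A ∈ 𝒜, ∀ᵐ ω ∂P, η ω (Icc 0 t ×ˢ A) < ∞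
  dominates : Dominates 𝓕 P 𝒜 M η
  minimal : ∀ ζ, Dominates 𝓕 P 𝒜 M ζ → (∀ᵐ ω ∂P, ζ ω ≤ η ω) → ∀ᵐ ω ∂P, η ω ≤ ζ ω

/-- The sequential boundedness property of the family of intensity measures. -/
def SequentialBoundedness {Ω U X : Type*} {mΩ : MeasurableSpace Ω}
    [MeasurableSpace U] [NormedAddCommGroup X] [NormedSpace ℝ X]
    (𝓕 : Filtration ℝ≥0 mΩ) (P : Measure Ω) (𝒜 : Set (Set U))
    (M : ℝ≥0 → Set U → StrongDual ℝ X →ₗ[ℝ] (Ω →ₘ[P] ℝ)) : Prop :=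
  ∀ ν : StrongDual ℝ X → Ω → Measure (ℝ≥0 × U),
    (∀ x, IsIntensityMeasure 𝓕 P 𝒜 M x (ν x)) →
    ∀ xs : ℕ → StrongDual ℝ X, (∀ n, ‖xs n‖ = 1) →
      (∀ x : StrongDual ℝ X, ‖x‖ = 1 → x ∈ closure (range xs)) →
    ∀ x : StrongDual ℝ X, ‖x‖ = 1 → ∀ t > 0, ∀ᵐ ω ∂P, ∀ s < t, ∀ A ∈ 𝒜,
      ν x ω (Ioc s t ×ˢ A) ≤ ⨆ n, ν (xs n) ω (Ioc s t ×ˢ A)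

end QuadraticVariation

section CovariationOperator

/-- The inclusion of `[0, T] × U` in `[0, ∞) × U`. -/
def incl {U : Type*} (T : ℝ≥0) (p : Icc (0 : ℝ≥0) T × U) : ℝ≥0 × U := (p.1, p.2)

/-- A measure on `[0, ∞) × U`, restricted to a measure on `[0, T] × U`. -/
noncomputable def restrictTime {U : Type*} [MeasurableSpace U] (T : ℝ≥0)
    (μ : Measure (ℝ≥0 × U)) : Measure (Icc (0 : ℝ≥0) T × U) :=
  μ.comap (incl T)

/-- The trace on `Ω × [0, T]` of the predictable `σ`-algebra. -/
@[reducible] def predictableUpTo {Ω : Type*} {mΩ : MeasurableSpace Ω} (𝓕 : Filtration ℝ≥0 mΩ)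
    (T : ℝ≥0) : MeasurableSpace (Ω × Icc (0 : ℝ≥0) T) :=
  𝓕.predictable.comap fun p => ((p.2 : ℝ≥0), p.1)

/-- `Γ` is (a version of) the covariation operator measure `Γ_M`: a random `L(X*, X**)`-valued
countably additive measure on `[0, T] × U`, given by polarization of the intensity measures, and
equal to the increments of `⟨M(A)(x), M(A)(y)⟩` on the rectangles `(s, t] × A`. -/
structure IsCovariationOperatorMeasure {Ω U X : Type*} {mΩ : MeasurableSpace Ω}
    [MeasurableSpace U] [NormedAddCommGroup X] [NormedSpace ℝ X]
    (𝓕 : Filtration ℝ≥0 mΩ) (P : Measure Ω) (𝒜 : Set (Set U))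
    (M : ℝ≥0 → Set U → StrongDual ℝ X →ₗ[ℝ] (Ω →ₘ[P] ℝ)) (T : ℝ≥0)
    (Γ : Ω → VectorMeasure (Icc (0 : ℝ≥0) T × U)
      (StrongDual ℝ X →L[ℝ] StrongDual ℝ (StrongDual ℝ X))) : Prop where
  measurable : ∀ C, MeasurableSet C → ∀ x y, Measurable fun ω => Γ ω C x y
  polarization : ∀ x y, ∃ ν₁ ν₂,
    IsIntensityMeasure 𝓕 P 𝒜 M (x + y) ν₁ ∧ IsIntensityMeasure 𝓕 P 𝒜 M (x - y) ν₂ ∧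
    ∀ᵐ ω ∂P, ∀ C, MeasurableSet C →
      restrictTime T (ν₁ ω) C < ∞ ∧ restrictTime T (ν₂ ω) C < ∞ ∧
      Γ ω C x y =
        ((restrictTime T (ν₁ ω) C).toReal - (restrictTime T (ν₂ ω) C).toReal) / 4
  covariation : ∀ x y, ∀ A ∈ 𝒜, ∃ V : ℝ≥0 → Ω → ℝ,
    IsPredictableCovariation 𝓕 P (proc M A x) (proc M A y) V ∧
    ∀ s t, s ≤ t → t ≤ T → ∀ᵐ ω ∂P, Γ ω (incl T ⁻¹' (Ioc s t ×ˢ A)) x y = V t ω - V s ω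

end CovariationOperator

end CylMVM

/-! Write $\nu_x$ for the intensity measures and $\eta=[M]$. The bound on $[M]$ makes $\eta$ almost
surely finite on $[0,T]\times U$, so there $x\mapsto\nu_x$ is a family of finite random measures
with $\nu_x\le\|x\|^2\eta$. The operator $Q_M$ is the Radon–Nikodym derivative of this quadratic
family. The difficulties are that $\nu_x$ is only defined up to a null set depending on $x$, that
$\eta$ is not assumed predictable while $Q_M$ must be, and that the norm has to be exactly $1$.

Uniqueness. The mean of $\nu_x$ on a predictable rectangle is an increment of second moments of
$M(A)(x)$, and these means determine a predictable random measure (`IsPredictableRM.ae_eq`). To see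
this, let $p,q$ be two such measures on the half line with the same mean on predictable sets. The
functions $p[0,t]$ and $q[0,t]$ are themselves predictable, so $\mathbb E\iint_{s\le
t}d(p-q)(s)\,d(p-q)(t)=0$ after truncation. Pathwise this double integral is at least half the
square of the difference of masses (`sq_sub_add_lintegral_Iic_le`), so the masses agree. Linearity
of $M(A)$ and uniqueness then give $\nu_{x+y}+\nu_{x-y}=2\nu_x+2\nu_y$ almost surely.

Density. Fix a countable dense subgroup $E$ of $X^*$ and a finite predictable random measure $L$
dominating all $\nu_x$, $x\in E$. Radon–Nikodym for the mean measures on the predictable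
$\sigma$-algebra, combined with uniqueness, gives predictable densities $f_x=d\nu_x/dL$
(`exists_predictable_density`). Put $g=\sup_{x\in E}f_x/\|x\|^2$. The measure $gL$ lies below $\eta$
and dominates every $\nu_x$ with $\|x\|=1$, so minimality forces $\eta=gL$. Hence
$d\nu_x/d\eta=f_x/g$ on $E$. At almost every point this is a nonnegative quadratic form bounded by
$\|x\|^2$; it extends by continuity to a bilinear form $Q$ on $X^*$
(`exists_bilin_of_parallelogram`), and $\|Q\|=1$ because $g$ is a supremum
(`exists_normalized_bilin`).

Conclusion. Continuity of $x\mapsto\nu_x$ extends the density formula from $E$ to each $x$.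
Integrating $Q$ against $\eta$ yields $\Gamma_M$. Any other version of $\Gamma_M$ agrees with this
integral by polarization on a countable dense set of pairs, hence on all pairs by continuity. -/

namespace CylMVM

open ProbabilityTheory

/-! ### Kernels. -/

section Kernels

/-- A kernel all of whose measures are finite is s-finite. -/
theorem isSFiniteKernel_of_isFiniteMeasure {α β : Type*} {mα : MeasurableSpace α}
    {mβ : MeasurableSpace β} (κ : Kernel α β) (h : ∀ a, κ a univ < ∞) : IsSFiniteKernel κ := by
  classical
  have hs : ∀ n : ℕ, MeasurableSet {a | (n : ℝ≥0∞) ≤ κ a univ ∧ κ a univ < n + 1} := fun n =>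
    (measurableSet_le measurable_const (κ.measurable_coe MeasurableSet.univ)).inter
      (measurableSet_lt (κ.measurable_coe MeasurableSet.univ) measurable_const)
  refine ⟨⟨fun n => Kernel.piecewise (hs n) κ 0, fun n => ⟨⟨n + 1, by simp, fun a => ?_⟩⟩, ?_⟩⟩
  · rw [Kernel.piecewise_apply]
    split_ifs with ha
    · exact ha.2.le
    · simp
  · ext a s hs'
    rw [Kernel.sum_apply' _ _ hs', tsum_eq_single ⌊(κ a univ).toNNReal⌋₊]
    · rw [Kernel.piecewise_apply, if_pos]
      have h1 := Nat.floor_le (zero_le (a := (κ a univ).toNNReal))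
      have h2 := Nat.lt_floor_add_one (κ a univ).toNNReal
      have h3 := ENNReal.coe_toNNReal (h a).ne
      constructor
      · rw [← h3]; exact_mod_cast h1
      · conv_lhs => rw [← h3]
        exact_mod_cast h2
    · intro n hn
      rw [Kernel.piecewise_apply, if_neg]
      · simp
      · rintro ⟨h1, h2⟩
        apply hn
        symm
        rw [Nat.floor_eq_iff zero_le]
        have h3 := ENNReal.coe_toNNReal (h a).ne
        rw [← h3] at h1 h2
        exact ⟨by exact_mod_cast h1, by exact_mod_cast h2⟩

end Kernels

/-! ### The pathwise inequality for two finite measures on the half line. -/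

section Pathwise

variable {p q : Measure ℝ≥0} [IsFiniteMeasure p] [IsFiniteMeasure q]

/-- By Fubini, the two integrals are the masses under $p\otimes q$ of the closed half squares on
either side of the diagonal; they cover everything and overlap in the diagonal. -/
theorem lintegral_Iic_add_lintegral_Iic (p q : Measure ℝ≥0) [IsFiniteMeasure p]
    [IsFiniteMeasure q] :
    ∫⁻ t, p (Iic t) ∂q + ∫⁻ t, q (Iic t) ∂p = p univ * q univ + ∫⁻ t, p {t} ∂q := by
  have hS : MeasurableSet {z : ℝ≥0 × ℝ≥0 | z.2 ≤ z.1} :=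
    measurableSet_le measurable_snd measurable_fst
  have h1 : ∫⁻ t, q (Iic t) ∂p = ∫⁻ s, p (Ici s) ∂q := by
    have e1 := Measure.prod_apply (μ := p) (ν := q) hS
    have e2 := Measure.prod_apply_symm (μ := p) (ν := q) hS
    exact e1.symm.trans e2
  have hm : Measurable fun t => p (Iic t) :=
    Monotone.measurable fun a b hab => measure_mono (Iic_subset_Iic.2 hab)
  have hD : MeasurableSet {z : ℝ≥0 × ℝ≥0 | z.2 = z.1} :=
    measurableSet_eq_fun measurable_snd measurable_fst
  have hd : Measurable fun t => p {t} := measurable_measure_prodMk_left (ν := p) hD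
  rw [h1, ← lintegral_add_left hm, ← lintegral_const, ← lintegral_add_left measurable_const]
  refine lintegral_congr fun t => ?_
  rw [← measure_union_add_inter _ measurableSet_Ici, Iic_union_Ici, Iic_inter_Ici, Icc_self]

theorem lintegral_singleton_eq (p q ρ : Measure ℝ≥0) {f g : ℝ≥0 → ℝ≥0∞}
    (hg : Measurable g) [IsFiniteMeasure p] [IsFiniteMeasure ρ]
    (hp : p = ρ.withDensity f) (hq : q = ρ.withDensity g) :
    ∫⁻ t, p {t} ∂q = ∫⁻ t, f t * g t * ρ {t} ∂ρ := by
  have hD : MeasurableSet {z : ℝ≥0 × ℝ≥0 | z.2 = z.1} :=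
    measurableSet_eq_fun measurable_snd measurable_fst
  have hd : Measurable fun t => p {t} := measurable_measure_prodMk_left (ν := p) hD
  rw [hq, lintegral_withDensity_eq_lintegral_mul _ hg hd]
  refine lintegral_congr fun t => ?_
  rw [Pi.mul_apply, hp, withDensity_apply _ (measurableSet_singleton t), lintegral_singleton]
  ring

theorem ENNReal_two_mul_le_add_sq (a b : ℝ≥0∞) : a * b + a * b ≤ a * a + b * b := by
  rcases eq_or_ne a ∞ with rfl | ha
  · simp
  rcases eq_or_ne b ∞ with rfl | hb
  · simp
  lift a to ℝ≥0 using ha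
  lift b to ℝ≥0 using hb
  have : a * b + a * b ≤ a * a + b * b := by
    rw [← NNReal.coe_le_coe]; push_cast; nlinarith [sq_nonneg ((a : ℝ) - b)]
  exact_mod_cast this

/-- This is $\sum_t(p\{t\}-q\{t\})^2\ge0$. Densities with respect to $p+q$ reduce it to $2fg\le
f^2+g^2$ without enumerating atoms. -/
theorem lintegral_singleton_add_le (p q : Measure ℝ≥0) [IsFiniteMeasure p] [IsFiniteMeasure q] :
    ∫⁻ t, p {t} ∂q + ∫⁻ t, p {t} ∂q ≤ ∫⁻ t, p {t} ∂p + ∫⁻ t, q {t} ∂q := by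
  set ρ := p + q
  have hp : p = ρ.withDensity (p.rnDeriv ρ) :=
    (Measure.withDensity_rnDeriv_eq _ _ (Measure.AbsolutelyContinuous.rfl.add_right _)).symm
  have hq : q = ρ.withDensity (q.rnDeriv ρ) :=
    (Measure.withDensity_rnDeriv_eq _ _ (by
      have := Measure.le_add_left (le_refl q) (ν' := p)
      exact this.absolutelyContinuous)).symm
  have hf := Measure.measurable_rnDeriv p ρ
  have hg := Measure.measurable_rnDeriv q ρ
  have hD : MeasurableSet {z : ℝ≥0 × ℝ≥0 | z.2 = z.1} :=
    measurableSet_eq_fun measurable_snd measurable_fst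
  have hd : Measurable fun t => ρ {t} := measurable_measure_prodMk_left (ν := ρ) hD
  have h1 : Measurable fun t => p.rnDeriv ρ t * q.rnDeriv ρ t * ρ {t} := (hf.mul hg).mul hd
  have h2 : Measurable fun t => p.rnDeriv ρ t * p.rnDeriv ρ t * ρ {t} := (hf.mul hf).mul hd
  rw [lintegral_singleton_eq p q ρ hg hp hq, lintegral_singleton_eq p p ρ hf hp hp,
    lintegral_singleton_eq q q ρ hg hq hq, ← lintegral_add_left h1,
    ← lintegral_add_left h2]
  refine lintegral_mono fun t => ?_
  simpa only [add_mul] using mul_le_mul_left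
    (ENNReal_two_mul_le_add_sq (p.rnDeriv ρ t) (q.rnDeriv ρ t)) (ρ {t})

/-- For finite measures `p`, `q` on the half line, `∬_{s ≤ t} d(p - q)(s) d(p - q)(t)` is at least
half of the square of the total mass of `p - q`. -/
theorem sq_sub_add_lintegral_Iic_le (p q : Measure ℝ≥0) [IsFiniteMeasure p] [IsFiniteMeasure q] :
    ENNReal.ofReal (((p univ).toReal - (q univ).toReal) ^ 2) +
      2 * (∫⁻ t, p (Iic t) ∂q + ∫⁻ t, q (Iic t) ∂p) ≤
      2 * (∫⁻ t, p (Iic t) ∂p + ∫⁻ t, q (Iic t) ∂q) := by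
  have h11 := lintegral_Iic_add_lintegral_Iic p p
  have h22 := lintegral_Iic_add_lintegral_Iic q q
  have hd := lintegral_singleton_add_le p q
  -- The identity $(a-b)^2+2ab=a^2+b^2$, arranged so that nothing is subtracted in `ℝ≥0∞`.
  have e : ENNReal.ofReal (((p univ).toReal - (q univ).toReal) ^ 2) + 2 * (p univ * q univ) =
      p univ * p univ + q univ * q univ := by
    have ha := measure_ne_top p univ
    have hb := measure_ne_top q univ
    generalize p univ = a at *
    generalize q univ = b at *
    rw [← ENNReal.toReal_eq_toReal_iff' (by finiteness) (by finiteness),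
      ENNReal.toReal_add (by finiteness) (by finiteness),
      ENNReal.toReal_add (by finiteness) (by finiteness),
      ENNReal.toReal_ofReal (sq_nonneg _)]
    simp only [ENNReal.toReal_mul, ENNReal.toReal_ofNat]
    ring
  calc _ = p univ * p univ + q univ * q univ + (∫⁻ t, p {t} ∂q + ∫⁻ t, p {t} ∂q) := by
        rw [lintegral_Iic_add_lintegral_Iic p q, ← e]; ring
    _ ≤ p univ * p univ + q univ * q univ + (∫⁻ t, p {t} ∂p + ∫⁻ t, q {t} ∂q) := by gcongr
    _ = (p univ * p univ + ∫⁻ t, p {t} ∂p) + (q univ * q univ + ∫⁻ t, q {t} ∂q) := by ring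
    _ = _ := by rw [← h11, ← h22]; ring

end Pathwise

end CylMVM

namespace CylMVM

open ProbabilityTheory

/-! ### The predictable σ-algebra as a measurable space of its own. -/

section PredictableSpace

/-- The set `[0, ∞) × Ω`, to be endowed with the predictable `σ`-algebra. -/
structure Pred {Ω : Type*} {mΩ : MeasurableSpace Ω} (𝓕 : Filtration ℝ≥0 mΩ) where
  /-- The time coordinate. -/
  time : ℝ≥0
  /-- The sample point. -/
  point : Ω

variable {Ω : Type*} {mΩ : MeasurableSpace Ω} {𝓕 : Filtration ℝ≥0 mΩ}

/-- The rectangles generating the predictable `σ`-algebra. -/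
def predRect (𝓕 : Filtration ℝ≥0 mΩ) : Set (Set (Pred 𝓕)) :=
  {s | ∃ A, MeasurableSet[𝓕 0] A ∧ s = {z | z.time = 0 ∧ z.point ∈ A}} ∪
    {s | ∃ i A, MeasurableSet[𝓕 i] A ∧ s = {z | i < z.time ∧ z.point ∈ A}}

/-- A separate structure keeps this instance from clashing with the product σ-algebra on `ℝ≥0 × Ω`.
-/
instance (𝓕 : Filtration ℝ≥0 mΩ) : MeasurableSpace (Pred 𝓕) :=
  MeasurableSpace.generateFrom (predRect 𝓕)

theorem measurableSet_predRect_zero {A : Set Ω} (hA : MeasurableSet[𝓕 0] A) :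
    MeasurableSet {z : Pred 𝓕 | z.time = 0 ∧ z.point ∈ A} :=
  MeasurableSpace.measurableSet_generateFrom (Or.inl ⟨A, hA, rfl⟩)

theorem measurableSet_predRect_Ioi (i : ℝ≥0) {A : Set Ω} (hA : MeasurableSet[𝓕 i] A) :
    MeasurableSet {z : Pred 𝓕 | i < z.time ∧ z.point ∈ A} :=
  MeasurableSpace.measurableSet_generateFrom (Or.inr ⟨i, A, hA, rfl⟩)

/-- A rectangle at time $0$ never meets one with positive times, so the mixed cases are vacuous; two
rectangles of the second kind start together at the later of their times. -/
theorem isPiSystem_predRect : IsPiSystem (predRect 𝓕) := by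
  rintro _ (⟨A, hA, rfl⟩ | ⟨i, A, hA, rfl⟩) _ (⟨B, hB, rfl⟩ | ⟨j, B, hB, rfl⟩) ⟨z, h1, h2⟩
  · exact Or.inl ⟨A ∩ B, hA.inter hB, by ext; simp; tauto⟩
  · simp [h1.1] at h2
  · simp [h2.1] at h1
  · refine Or.inr ⟨max i j, A ∩ B, ?_, by ext; simp; tauto⟩
    exact (𝓕.mono (le_max_left _ _) _ hA).inter (𝓕.mono (le_max_right _ _) _ hB)

theorem measurable_pred_of_predRect {α : Type*} [MeasurableSpace α] {f : α → Pred 𝓕}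
    (h0 : ∀ A, MeasurableSet[𝓕 0] A → MeasurableSet {a | (f a).time = 0 ∧ (f a).point ∈ A})
    (h : ∀ i A, MeasurableSet[𝓕 i] A → MeasurableSet {a | i < (f a).time ∧ (f a).point ∈ A}) :
    Measurable f := by
  refine measurable_generateFrom ?_
  rintro _ (⟨A, hA, rfl⟩ | ⟨i, A, hA, rfl⟩)
  · exact h0 A hA
  · exact h i A hA

theorem measurable_pred_mk : Measurable fun z : ℝ≥0 × Ω => (⟨z.1, z.2⟩ : Pred 𝓕) :=
  measurable_pred_of_predRect (fun _ hA => (measurableSet_singleton _).prod (𝓕.le _ _ hA))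
    fun _ _ hA => measurableSet_Ioi.prod (𝓕.le _ _ hA)

theorem measurable_pred_mk_swap : Measurable fun z : Ω × ℝ≥0 => (⟨z.2, z.1⟩ : Pred 𝓕) :=
  measurable_pred_mk.comp measurable_swap

theorem measurable_pred_mk_predictable :
    Measurable[𝓕.predictable] fun z : ℝ≥0 × Ω => (⟨z.1, z.2⟩ : Pred 𝓕) :=
  @measurable_pred_of_predRect _ _ _ _ 𝓕.predictable _
    (fun _ hA => measurableSet_predictable_singleton_bot_prod hA)
    fun _ _ hA => measurableSet_predictable_Ioi_prod hA

theorem measurable_pred_toProd :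
    @Measurable (Pred 𝓕) (ℝ≥0 × Ω) _ 𝓕.predictable fun z => (z.time, z.point) := by
  refine measurable_generateFrom ?_
  rintro _ (⟨A, hA, rfl⟩ | ⟨i, A, hA, rfl⟩)
  · exact measurableSet_predRect_zero hA
  · exact measurableSet_predRect_Ioi i hA

theorem measurableSet_pred_point {F : Set Ω} (hF : MeasurableSet[𝓕 0] F) :
    MeasurableSet {z : Pred 𝓕 | z.point ∈ F} := by
  have : {z : Pred 𝓕 | z.point ∈ F} =
      {z | z.time = 0 ∧ z.point ∈ F} ∪ {z | 0 < z.time ∧ z.point ∈ F} := by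
    ext z
    rcases eq_or_ne z.time 0 with h | h
    · simp [h]
    · simp [h, pos_iff_ne_zero]
  rw [this]
  exact (measurableSet_predRect_zero hF).union (measurableSet_predRect_Ioi 0 hF)

theorem measurable_pred_time : Measurable fun z : Pred 𝓕 => z.time := by
  refine measurable_of_Ioi fun t => ?_
  convert measurableSet_predRect_Ioi (𝓕 := 𝓕) t (A := univ) MeasurableSet.univ using 1
  ext z
  simp

/-- The stopping map is measurable for the predictable `σ`-algebra. -/
theorem measurable_pred_stop :
    Measurable fun z : Pred 𝓕 × ℝ≥0 => (⟨min z.1.time z.2, z.1.point⟩ : Pred 𝓕) := by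
  refine measurable_pred_of_predRect (fun A hA => ?_) fun i A hA => ?_
  · have h1 : MeasurableSet {z : Pred 𝓕 × ℝ≥0 | z.1.point ∈ A} :=
      measurable_fst (measurableSet_pred_point hA)
    have h2 : MeasurableSet {z : Pred 𝓕 × ℝ≥0 | min z.1.time z.2 = 0} :=
      measurableSet_eq_fun ((measurable_pred_time.comp measurable_fst).min measurable_snd)
        measurable_const
    exact h2.inter h1
  · have h1 : MeasurableSet {z : Pred 𝓕 × ℝ≥0 | i < z.1.time ∧ z.1.point ∈ A} :=
      measurable_fst (measurableSet_predRect_Ioi i hA)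
    have h2 : MeasurableSet {z : Pred 𝓕 × ℝ≥0 | i < z.2} :=
      measurableSet_lt measurable_const measurable_snd
    convert h1.inter h2 using 1
    ext z
    simp only [lt_min_iff, mem_ofPred_eq, mem_inter_iff]
    tauto

theorem measurable_pred_stop_const (T : ℝ≥0) :
    Measurable fun z : Pred 𝓕 => (⟨min z.time T, z.point⟩ : Pred 𝓕) :=
  measurable_pred_stop.comp (measurable_id.prodMk measurable_const)

end PredictableSpace

/-! ### Uniqueness of predictable random measures on the half line. -/

section Uniqueness

/-- The set $S$ is closed downwards, so restricting $p$ and $q$ to $S$ does not change $p[0,t]$ and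
$q[0,t]$ for $t\in S$, and the unlocalized inequality applies to the restrictions. -/
theorem sq_sub_localized_le (p q : Measure ℝ≥0) [IsFiniteMeasure p] [IsFiniteMeasure q]
    (n : ℝ≥0∞) {S : Set ℝ≥0} (hS : S = {t | p (Iic t) + q (Iic t) ≤ n}) :
    ENNReal.ofReal (((p S).toReal - (q S).toReal) ^ 2) +
      2 * (∫⁻ t, S.indicator (fun t => p (Iic t)) t ∂q +
        ∫⁻ t, S.indicator (fun t => q (Iic t)) t ∂p) ≤
      2 * (∫⁻ t, S.indicator (fun t => p (Iic t)) t ∂p +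
        ∫⁻ t, S.indicator (fun t => q (Iic t)) t ∂q) := by
  have hm : ∀ r : Measure ℝ≥0, Measurable fun t => r (Iic t) := fun r =>
    Monotone.measurable fun a b hab => measure_mono (Iic_subset_Iic.2 hab)
  have hSm : MeasurableSet S := by
    rw [hS]; exact measurableSet_le ((hm p).add (hm q)) measurable_const
  have hsub : ∀ t ∈ S, Iic t ⊆ S := by
    intro t ht s hs
    rw [hS] at ht ⊢
    exact le_trans (add_le_add (measure_mono (Iic_subset_Iic.2 hs))
      (measure_mono (Iic_subset_Iic.2 hs))) ht
  have key : ∀ r r' : Measure ℝ≥0, ∫⁻ t, S.indicator (fun t => r (Iic t)) t ∂r' =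
      ∫⁻ t, (r.restrict S) (Iic t) ∂(r'.restrict S) := by
    intro r r'
    rw [lintegral_indicator hSm]
    refine setLIntegral_congr_fun hSm fun t ht => ?_
    simp only [Measure.restrict_apply measurableSet_Iic, inter_eq_left.2 (hsub t ht)]
  rw [key, key, key, key]
  have := sq_sub_add_lintegral_Iic_le (p.restrict S) (q.restrict S)
  simpa only [Measure.restrict_apply_univ] using this

variable {Ω : Type*} {mΩ : MeasurableSpace Ω} {𝓕 : Filtration ℝ≥0 mΩ} {P : Measure Ω}

/-- Integrate the inequality: the expectations of $a+b$ and $c+d$ coincide and are finite, so they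
cancel and leave $\mathbb E\,\delta\le0$. -/
theorem ae_eq_zero_of_add_two_mul_le {α : Type*} {mα : MeasurableSpace α} {P : Measure α}
    {δ a b c d : α → ℝ≥0∞} (hδ : Measurable δ) (ha : Measurable a) (hb : Measurable b)
    (hc : Measurable c) (hd : Measurable d)
    (h : ∀ ω, δ ω + 2 * (c ω + d ω) ≤ 2 * (a ω + b ω))
    (hac : ∫⁻ ω, a ω ∂P = ∫⁻ ω, c ω ∂P) (hbd : ∫⁻ ω, b ω ∂P = ∫⁻ ω, d ω ∂P)
    (hc' : ∫⁻ ω, c ω ∂P ≠ ∞) (hd' : ∫⁻ ω, d ω ∂P ≠ ∞) : ∀ᵐ ω ∂P, δ ω = 0 := by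
  have hint := lintegral_mono (μ := P) h
  rw [lintegral_add_left hδ, lintegral_const_mul 2 (by fun_prop), lintegral_const_mul 2 (by fun_prop),
    lintegral_add_left ha, lintegral_add_left hc, hac, hbd] at hint
  have hzero : ∫⁻ ω, δ ω ∂P = 0 := by
    have hne : 2 * (∫⁻ ω, c ω ∂P + ∫⁻ ω, d ω ∂P) ≠ ∞ :=
      ENNReal.mul_ne_top (by simp) (ENNReal.add_ne_top.2 ⟨hc', hd'⟩)
    rw [← nonpos_iff_eq_zero]
    refine ENNReal.le_of_add_le_add_right hne ?_
    rwa [zero_add]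
  exact (lintegral_eq_zero_iff hδ).1 hzero

/-- Two predictable integrable random measures on the half line which integrate every nonnegative
predictable process to the same expectation have almost surely the same mass. -/
theorem ae_mass_eq_of_lintegral_eq (m₁ m₂ : Kernel Ω ℝ≥0)
    (h₁ : ∀ ω, m₁ ω univ < ∞) (h₂ : ∀ ω, m₂ ω univ < ∞)
    (hp₁ : Measurable fun z : Pred 𝓕 => m₁ z.point (Iic z.time))
    (hp₂ : Measurable fun z : Pred 𝓕 => m₂ z.point (Iic z.time))
    (hi₁ : ∫⁻ ω, m₁ ω univ ∂P ≠ ∞) (hi₂ : ∫⁻ ω, m₂ ω univ ∂P ≠ ∞)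
    (hH : ∀ H : Pred 𝓕 → ℝ≥0∞, Measurable H →
      ∫⁻ ω, ∫⁻ t, H ⟨t, ω⟩ ∂(m₁ ω) ∂P = ∫⁻ ω, ∫⁻ t, H ⟨t, ω⟩ ∂(m₂ ω) ∂P) :
    ∀ᵐ ω ∂P, m₁ ω univ = m₂ ω univ := by
  have i₁ : ∀ ω, IsFiniteMeasure (m₁ ω) := fun ω => ⟨h₁ ω⟩
  have i₂ : ∀ ω, IsFiniteMeasure (m₂ ω) := fun ω => ⟨h₂ ω⟩
  have s₁ := isSFiniteKernel_of_isFiniteMeasure m₁ h₁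
  have s₂ := isSFiniteKernel_of_isFiniteMeasure m₂ h₂
  have key : ∀ n : ℕ, ∀ᵐ ω ∂P, m₁ ω {t | m₁ ω (Iic t) + m₂ ω (Iic t) ≤ n} =
      m₂ ω {t | m₁ ω (Iic t) + m₂ ω (Iic t) ≤ n} := by
    intro n
    -- Truncation to a predictable set of times makes both test processes bounded by $n$, hence
    -- their expected integrals finite.
    set S : Set (Pred 𝓕) := {z | m₁ z.point (Iic z.time) + m₂ z.point (Iic z.time) ≤ n} with hSdef
    have hS : MeasurableSet S := measurableSet_le (hp₁.add hp₂) measurable_const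
    set H₁ : Pred 𝓕 → ℝ≥0∞ := S.indicator fun z => m₁ z.point (Iic z.time)
    set H₂ : Pred 𝓕 → ℝ≥0∞ := S.indicator fun z => m₂ z.point (Iic z.time)
    have hH₁ : Measurable H₁ := hp₁.indicator hS
    have hH₂ : Measurable H₂ := hp₂.indicator hS
    have hmeas : ∀ (m : Kernel Ω ℝ≥0) [IsSFiniteKernel m] (H : Pred 𝓕 → ℝ≥0∞), Measurable H →
        Measurable fun ω => ∫⁻ t, H ⟨t, ω⟩ ∂(m ω) := by
      intro m _ H hH
      exact Measurable.lintegral_kernel_prod_right (κ := m) (f := fun ω t => H ⟨t, ω⟩)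
        (hH.comp measurable_pred_mk_swap)
    have hbd₁ : ∀ z, H₁ z ≤ n := by
      intro z
      by_cases hz : z ∈ S
      · rw [show H₁ z = _ from indicator_of_mem hz _]; exact le_trans le_self_add hz
      · rw [show H₁ z = _ from indicator_of_notMem hz _]; exact zero_le
    have hbd₂ : ∀ z, H₂ z ≤ n := by
      intro z
      by_cases hz : z ∈ S
      · rw [show H₂ z = _ from indicator_of_mem hz _]; exact le_trans le_add_self hz
      · rw [show H₂ z = _ from indicator_of_notMem hz _]; exact zero_le
    have hfin : ∀ (m : Kernel Ω ℝ≥0), ∫⁻ ω, m ω univ ∂P ≠ ∞ → ∀ H : Pred 𝓕 → ℝ≥0∞,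
        (∀ z, H z ≤ n) → ∫⁻ ω, ∫⁻ t, H ⟨t, ω⟩ ∂(m ω) ∂P ≠ ∞ := by
      intro m hm H hH
      refine ne_top_of_le_ne_top (ENNReal.mul_ne_top (ENNReal.natCast_ne_top n) hm) ?_
      rw [← lintegral_const_mul _ (m.measurable_coe MeasurableSet.univ)]
      refine lintegral_mono fun ω => ?_
      rw [← lintegral_const]
      exact lintegral_mono fun t => hH _
    set δ : Ω → ℝ≥0∞ := fun ω =>
      ENNReal.ofReal (((m₁ ω {t | ⟨t, ω⟩ ∈ S}).toReal - (m₂ ω {t | ⟨t, ω⟩ ∈ S}).toReal) ^ 2)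
      with hδ
    have hδm : Measurable δ := by
      have : ∀ (m : Kernel Ω ℝ≥0) [IsSFiniteKernel m], Measurable fun ω =>
          m ω {t | ⟨t, ω⟩ ∈ S} := by
        intro m _
        exact Kernel.measurable_kernel_prodMk_left (κ := m)
          (t := {z : Ω × ℝ≥0 | (⟨z.2, z.1⟩ : Pred 𝓕) ∈ S})
          (measurable_pred_mk_swap hS)
      exact ((((this m₁).ennreal_toReal).sub ((this m₂).ennreal_toReal)).pow_const 2).ennreal_ofReal
    have hpt : ∀ ω, δ ω + 2 * (∫⁻ t, H₁ ⟨t, ω⟩ ∂(m₂ ω) + ∫⁻ t, H₂ ⟨t, ω⟩ ∂(m₁ ω)) ≤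
        2 * (∫⁻ t, H₁ ⟨t, ω⟩ ∂(m₁ ω) + ∫⁻ t, H₂ ⟨t, ω⟩ ∂(m₂ ω)) := by
      intro ω
      have e₁ : ∀ t, H₁ ⟨t, ω⟩ =
          ({t | ⟨t, ω⟩ ∈ S} : Set ℝ≥0).indicator (fun t => m₁ ω (Iic t)) t := fun _ => rfl
      have e₂ : ∀ t, H₂ ⟨t, ω⟩ =
          ({t | ⟨t, ω⟩ ∈ S} : Set ℝ≥0).indicator (fun t => m₂ ω (Iic t)) t := fun _ => rfl
      simp only [e₁, e₂]
      exact sq_sub_localized_le (m₁ ω) (m₂ ω) n rfl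
    -- Each predictable test process is integrated against both measures: `H₁` matches $a$ with $c$
    -- and `H₂` matches $b$ with $d$.
    have hzero := ae_eq_zero_of_add_two_mul_le hδm (hmeas m₁ H₁ hH₁) (hmeas m₂ H₂ hH₂)
      (hmeas m₂ H₁ hH₁) (hmeas m₁ H₂ hH₂) hpt (hH H₁ hH₁) (hH H₂ hH₂).symm
      (hfin m₂ hi₂ H₁ hbd₁) (hfin m₁ hi₁ H₂ hbd₂)
    filter_upwards [hzero] with ω hω
    have h0 : ((m₁ ω {t | ⟨t, ω⟩ ∈ S}).toReal - (m₂ ω {t | ⟨t, ω⟩ ∈ S}).toReal) ^ 2 ≤ 0 :=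
      ENNReal.ofReal_eq_zero.1 hω
    have h0' := sub_eq_zero.1 (pow_eq_zero_iff (two_ne_zero) |>.1 (le_antisymm h0 (sq_nonneg _)))
    exact (ENNReal.toReal_eq_toReal_iff' (measure_ne_top _ _) (measure_ne_top _ _)).1 h0'
  filter_upwards [ae_all_iff.2 key] with ω hω
  -- For fixed $\omega$ both masses are finite, so for large $n$ the truncation removes nothing.
  obtain ⟨n, hn⟩ := ENNReal.exists_nat_gt (r := m₁ ω univ + m₂ ω univ)
    (ENNReal.add_ne_top.2 ⟨(h₁ ω).ne, (h₂ ω).ne⟩)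
  have : {t | m₁ ω (Iic t) + m₂ ω (Iic t) ≤ n} = univ := by
    refine eq_univ_of_forall fun t => ?_
    exact le_trans (add_le_add (measure_mono (subset_univ _)) (measure_mono (subset_univ _))) hn.le
  simpa only [this] using hω n

end Uniqueness

end CylMVM

namespace CylMVM

open ProbabilityTheory

/-! ### Countable families of boxes that determine a measure. -/

section MeasureExt

/-- Countably many half lines suffice; this lets almost sure identities be collected outside one
null set. -/
theorem borel_nnreal_eq_generateFrom_Iic_denseSeq :
    (inferInstance : MeasurableSpace ℝ≥0) =
      MeasurableSpace.generateFrom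
        (range fun n => Iic (TopologicalSpace.denseSeq ℝ≥0 n)) := by
  refine le_antisymm ?_ (MeasurableSpace.generateFrom_le ?_)
  · rw [BorelSpace.measurable_eq (α := ℝ≥0), borel_eq_generateFrom_Iic]
    refine MeasurableSpace.generateFrom_le ?_
    rintro _ ⟨t, rfl⟩
    have : Iic t = ⋂ n, ⋂ (_ : t < TopologicalSpace.denseSeq ℝ≥0 n),
        Iic (TopologicalSpace.denseSeq ℝ≥0 n) := by
      ext s
      simp only [mem_Iic, mem_iInter]
      refine ⟨fun h n hn => h.trans hn.le, fun h => ?_⟩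
      by_contra! hts
      obtain ⟨_, ⟨n, rfl⟩, h1, h2⟩ :=
        (TopologicalSpace.denseRange_denseSeq ℝ≥0).exists_between hts
      exact absurd (h n h1) (not_le.2 h2)
    rw [this]
    exact MeasurableSet.iInter fun n => MeasurableSet.iInter fun _ =>
      MeasurableSpace.measurableSet_generateFrom ⟨n, rfl⟩
  · rintro _ ⟨n, rfl⟩
    exact measurableSet_Iic

theorem exists_lt_denseSeq (t : ℝ≥0) : ∃ n, t < TopologicalSpace.denseSeq ℝ≥0 n := by
  obtain ⟨_, ⟨n, rfl⟩, h1, -⟩ :=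
    (TopologicalSpace.denseRange_denseSeq ℝ≥0).exists_between (lt_add_one t)
  exact ⟨n, h1⟩

variable {U : Type*} [MeasurableSpace U]

/-- A countable algebra of sets generating a countably generated `σ`-algebra. -/
def countableAlgebra (U : Type*) [MeasurableSpace U] [MeasurableSpace.CountablyGenerated U] :
    Set (Set U) :=
  generateSetAlgebra (MeasurableSpace.countableGeneratingSet U)

variable [MeasurableSpace.CountablyGenerated U]

theorem countable_countableAlgebra : (countableAlgebra U).Countable :=
  countable_generateSetAlgebra (MeasurableSpace.countable_countableGeneratingSet)

theorem generateFrom_countableAlgebra :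
    MeasurableSpace.generateFrom (countableAlgebra U) = ‹MeasurableSpace U› := by
  rw [countableAlgebra, generateFrom_generateSetAlgebra_eq,
    MeasurableSpace.generateFrom_countableGeneratingSet]

theorem measurableSet_of_mem_countableAlgebra {B : Set U} (hB : B ∈ countableAlgebra U) :
    MeasurableSet B := by
  rw [← generateFrom_countableAlgebra (U := U)]
  exact MeasurableSpace.measurableSet_generateFrom hB

/-- A π-system argument on each strip $\mathbb R_+\times S_k$, where the boxes have finite measure.
Only countably many equalities are tested, as needed for almost sure conclusions. -/
theorem ext_of_Iic_prod {S : ℕ → Set U} (hS : ⋃ k, S k = univ)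
    {μ ν : Measure (ℝ≥0 × U)}
    (hfin : ∀ n k, μ (Iic (TopologicalSpace.denseSeq ℝ≥0 n) ×ˢ S k) < ∞)
    (h : ∀ n k, ∀ B ∈ countableAlgebra U, μ (Iic (TopologicalSpace.denseSeq ℝ≥0 n) ×ˢ (B ∩ S k)) =
      ν (Iic (TopologicalSpace.denseSeq ℝ≥0 n) ×ˢ (B ∩ S k))) : μ = ν := by
  have hun : ⋃ k, (univ ×ˢ S k : Set (ℝ≥0 × U)) = univ := by
    rw [← prod_iUnion, hS, univ_prod_univ]
  rw [← Measure.restrict_univ (μ := μ), ← Measure.restrict_univ (μ := ν), ← hun,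
    Measure.restrict_iUnion_congr]
  intro k
  have huniv : (univ : Set U) ∈ countableAlgebra U :=
    isSetAlgebra_generateSetAlgebra.univ_mem
  have hval : ∀ (ρ : Measure (ℝ≥0 × U)) (n : ℕ), ∀ B ∈ countableAlgebra U,
      ρ.restrict (univ ×ˢ S k) (Iic (TopologicalSpace.denseSeq ℝ≥0 n) ×ˢ B) =
        ρ (Iic (TopologicalSpace.denseSeq ℝ≥0 n) ×ˢ (B ∩ S k)) := by
    intro ρ n B hB
    rw [Measure.restrict_apply
      (measurableSet_Iic.prod (measurableSet_of_mem_countableAlgebra hB)), prod_inter_prod,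
      inter_univ]
  choose N hN using fun n : ℕ => exists_lt_denseSeq n
  refine Measure.ext_of_generateFrom_of_iUnion
    (image2 (· ×ˢ ·) (range fun n => Iic (TopologicalSpace.denseSeq ℝ≥0 n)) (countableAlgebra U))
    (fun n => Iic (TopologicalSpace.denseSeq ℝ≥0 (N n)) ×ˢ univ) ?_ ?_ ?_ ?_ ?_ ?_
  · refine (generateFrom_eq_prod borel_nnreal_eq_generateFrom_Iic_denseSeq.symm
      generateFrom_countableAlgebra ⟨fun n => Iic (TopologicalSpace.denseSeq ℝ≥0 (N n)),
        fun n => ⟨_, rfl⟩, ?_⟩ ⟨fun _ => univ, fun _ => huniv, iUnion_const _⟩).symm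
    refine eq_univ_of_forall fun t => ?_
    obtain ⟨n, hn⟩ := exists_nat_ge t
    exact mem_iUnion.2 ⟨n, hn.trans (hN n).le⟩
  · refine IsPiSystem.prod ?_ isSetAlgebra_generateSetAlgebra.isSetRing.isSetSemiring.isPiSystem
    rintro _ ⟨m, rfl⟩ _ ⟨n, rfl⟩ -
    rcases le_total (TopologicalSpace.denseSeq ℝ≥0 m) (TopologicalSpace.denseSeq ℝ≥0 n) with h | h
    · exact ⟨m, (inter_eq_left.2 (Iic_subset_Iic.2 h)).symm⟩
    · exact ⟨n, (inter_eq_right.2 (Iic_subset_Iic.2 h)).symm⟩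
  · refine eq_univ_of_forall fun t => ?_
    obtain ⟨n, hn⟩ := exists_nat_ge t.1
    exact mem_iUnion.2 ⟨n, hn.trans (hN n).le, trivial⟩
  · exact fun n => ⟨_, ⟨_, rfl⟩, _, huniv, rfl⟩
  · intro n
    rw [hval _ _ _ huniv, univ_inter]
    exact (hfin _ _).ne
  · rintro _ ⟨_, ⟨n, rfl⟩, B, hB, rfl⟩
    rw [hval _ _ _ hB, hval _ _ _ hB, h n k B hB]

end MeasureExt

/-! ### Uniqueness from the means on predictable rectangles. -/

section Uniqueness

variable {Ω : Type*} {mΩ : MeasurableSpace Ω} {𝓕 : Filtration ℝ≥0 mΩ} {P : Measure Ω}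

/-- The images of $P\otimes m_1$ and $P\otimes m_2$ on the predictable σ-algebra agree on a
generating π-system and in total mass, so every nonnegative predictable process has the same mean
integral against both. -/
theorem ae_mass_eq_of_predRect [SFinite P] (m₁ m₂ : Kernel Ω ℝ≥0)
    (h₁ : ∀ ω, m₁ ω univ < ∞) (h₂ : ∀ ω, m₂ ω univ < ∞)
    (hp₁ : Measurable fun z : Pred 𝓕 => m₁ z.point (Iic z.time))
    (hp₂ : Measurable fun z : Pred 𝓕 => m₂ z.point (Iic z.time))
    (hi₁ : ∫⁻ ω, m₁ ω univ ∂P ≠ ∞) (hi₂ : ∫⁻ ω, m₂ ω univ ∂P ≠ ∞)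
    (h0 : ∀ F, MeasurableSet[𝓕 0] F → ∫⁻ ω in F, m₁ ω {0} ∂P = ∫⁻ ω in F, m₂ ω {0} ∂P)
    (h : ∀ i F, MeasurableSet[𝓕 i] F →
      ∫⁻ ω in F, m₁ ω (Ioi i) ∂P = ∫⁻ ω in F, m₂ ω (Ioi i) ∂P) :
    ∀ᵐ ω ∂P, m₁ ω univ = m₂ ω univ := by
  have s₁ := isSFiniteKernel_of_isFiniteMeasure m₁ h₁
  have s₂ := isSFiniteKernel_of_isFiniteMeasure m₂ h₂
  have hmk := measurable_pred_mk_swap (𝓕 := 𝓕)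
  have e0 : ∀ A : Set Ω, (fun z : Ω × ℝ≥0 => (⟨z.2, z.1⟩ : Pred 𝓕)) ⁻¹'
      {z | z.time = 0 ∧ z.point ∈ A} = A ×ˢ {0} := by
    intro A; ext z; simp [and_comm]
  have ei : ∀ (i : ℝ≥0) (A : Set Ω), (fun z : Ω × ℝ≥0 => (⟨z.2, z.1⟩ : Pred 𝓕)) ⁻¹'
      {z | i < z.time ∧ z.point ∈ A} = A ×ˢ Ioi i := by
    intro i A; ext z; simp [and_comm]
  have e : ∀ (m : Kernel Ω ℝ≥0) [IsSFiniteKernel m] (C : Set (Pred 𝓕)), MeasurableSet C →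
      ((P ⊗ₘ m).map (fun z => (⟨z.2, z.1⟩ : Pred 𝓕))) C =
        (P ⊗ₘ m) ((fun z => (⟨z.2, z.1⟩ : Pred 𝓕)) ⁻¹' C) := fun m _ C hC =>
    Measure.map_apply hmk hC
  have hrect : ∀ C ∈ predRect 𝓕, ((P ⊗ₘ m₁).map (fun z => (⟨z.2, z.1⟩ : Pred 𝓕))) C =
      ((P ⊗ₘ m₂).map (fun z => (⟨z.2, z.1⟩ : Pred 𝓕))) C := by
    rintro _ (⟨A, hA, rfl⟩ | ⟨i, A, hA, rfl⟩)
    · rw [e _ _ (measurableSet_predRect_zero hA), e _ _ (measurableSet_predRect_zero hA), e0,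
        Measure.compProd_apply_prod (𝓕.le _ _ hA) (measurableSet_singleton _),
        Measure.compProd_apply_prod (𝓕.le _ _ hA) (measurableSet_singleton _), h0 A hA]
    · rw [e _ _ (measurableSet_predRect_Ioi i hA), e _ _ (measurableSet_predRect_Ioi i hA), ei,
        Measure.compProd_apply_prod (𝓕.le _ _ hA) measurableSet_Ioi,
        Measure.compProd_apply_prod (𝓕.le _ _ hA) measurableSet_Ioi, h i A hA]
  have hun : ∀ (m : Kernel Ω ℝ≥0) [IsSFiniteKernel m],
      ((P ⊗ₘ m).map (fun z => (⟨z.2, z.1⟩ : Pred 𝓕))) univ = ∫⁻ ω, m ω univ ∂P := by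
    intro m _
    rw [e _ _ MeasurableSet.univ, preimage_univ, ← univ_prod_univ,
      Measure.compProd_apply_prod MeasurableSet.univ MeasurableSet.univ, setLIntegral_univ]
  have hsplit : ∀ m : Kernel Ω ℝ≥0, ∫⁻ ω, m ω univ ∂P =
      ∫⁻ ω in univ, m ω {0} ∂P + ∫⁻ ω in univ, m ω (Ioi 0) ∂P := by
    intro m
    rw [setLIntegral_univ, setLIntegral_univ,
      ← lintegral_add_left (m.measurable_coe (measurableSet_singleton _))]
    refine lintegral_congr fun ω => ?_
    rw [← measure_union (by simp) measurableSet_Ioi]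
    congr 1
    ext t
    simp
  have hμ : (P ⊗ₘ m₁).map (fun z => (⟨z.2, z.1⟩ : Pred 𝓕)) =
      (P ⊗ₘ m₂).map (fun z => (⟨z.2, z.1⟩ : Pred 𝓕)) := by
    have : IsFiniteMeasure ((P ⊗ₘ m₁).map (fun z => (⟨z.2, z.1⟩ : Pred 𝓕))) :=
      ⟨by rw [hun]; exact hi₁.lt_top⟩
    refine ext_of_generate_finite (predRect 𝓕) rfl isPiSystem_predRect hrect ?_
    rw [hun, hun, hsplit, hsplit, h0 _ MeasurableSet.univ, h 0 _ MeasurableSet.univ]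
  refine ae_mass_eq_of_lintegral_eq m₁ m₂ h₁ h₂ hp₁ hp₂ hi₁ hi₂ fun H hH => ?_
  have he : ∀ (m : Kernel Ω ℝ≥0) [IsSFiniteKernel m],
      ∫⁻ z, H z ∂((P ⊗ₘ m).map (fun z => (⟨z.2, z.1⟩ : Pred 𝓕))) =
        ∫⁻ ω, ∫⁻ t, H ⟨t, ω⟩ ∂(m ω) ∂P := fun m _ =>
    (lintegral_map hH hmk).trans (Measure.lintegral_compProd (hH.comp hmk))
  rw [← he, ← he, hμ]

/-- Reduction to finite measures: stop at $T$ and set the kernels to zero on the null event where a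
mass is infinite. -/
theorem ae_Iic_eq_of_lintegral_eq [SFinite P] (h𝓕 : ∀ s : Set Ω, P s = 0 → MeasurableSet[𝓕 0] s)
    (m₁ m₂ : Kernel Ω ℝ≥0)
    (hp₁ : Measurable fun z : Pred 𝓕 => m₁ z.point (Iic z.time))
    (hp₂ : Measurable fun z : Pred 𝓕 => m₂ z.point (Iic z.time))
    (hi₁ : ∀ T, ∫⁻ ω, m₁ ω (Iic T) ∂P ≠ ∞) (hi₂ : ∀ T, ∫⁻ ω, m₂ ω (Iic T) ∂P ≠ ∞)
    (h0 : ∀ F, MeasurableSet[𝓕 0] F → ∫⁻ ω in F, m₁ ω {0} ∂P = ∫⁻ ω in F, m₂ ω {0} ∂P)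
    (h : ∀ i j F, i ≤ j → MeasurableSet[𝓕 i] F →
      ∫⁻ ω in F, m₁ ω (Ioc i j) ∂P = ∫⁻ ω in F, m₂ ω (Ioc i j) ∂P) (T : ℝ≥0) :
    ∀ᵐ ω ∂P, m₁ ω (Iic T) = m₂ ω (Iic T) := by
  classical
  have a₁ := ae_lt_top (m₁.measurable_coe measurableSet_Iic) (hi₁ T)
  have a₂ := ae_lt_top (m₂.measurable_coe measurableSet_Iic) (hi₂ T)
  set G : Set Ω := {ω | m₁ ω (Iic T) < ∞ ∧ m₂ ω (Iic T) < ∞}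
  have hGae : ∀ᵐ ω ∂P, ω ∈ G := by filter_upwards [a₁, a₂] with ω h1 h2 using ⟨h1, h2⟩
  -- The exceptional event is null, hence known at time $0$; this is why discarding it preserves
  -- predictability.
  have hG0 : MeasurableSet[𝓕 0] G := by
    have := (h𝓕 Gᶜ (mem_ae_iff.1 hGae)).compl
    rwa [compl_compl] at this
  have hG : MeasurableSet G := 𝓕.le _ _ hG0
  let r : Kernel Ω ℝ≥0 → Kernel Ω ℝ≥0 := fun m =>
    Kernel.piecewise hG (m.restrict (measurableSet_Iic (a := T))) 0
  have hr : ∀ m, ∀ᵐ ω ∂P, r m ω = (m ω).restrict (Iic T) := by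
    intro m
    filter_upwards [hGae] with ω hω
    simp only [r, Kernel.piecewise_apply, if_pos hω, Kernel.restrict_apply]
  have hfin : ∀ m : Kernel Ω ℝ≥0, (∀ ω ∈ G, m ω (Iic T) < ∞) → ∀ ω, r m ω univ < ∞ := by
    intro m hm ω
    by_cases hω : ω ∈ G
    · simpa only [r, Kernel.piecewise_apply, if_pos hω, Kernel.restrict_apply,
        Measure.restrict_apply_univ] using hm ω hω
    · simp [r, Kernel.piecewise_apply, if_neg hω]
  have hpred : ∀ m : Kernel Ω ℝ≥0, (Measurable fun z : Pred 𝓕 => m z.point (Iic z.time)) →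
      Measurable fun z : Pred 𝓕 => r m z.point (Iic z.time) := by
    intro m hm
    have := ((hm.comp (measurable_pred_stop_const T)).indicator (measurableSet_pred_point hG0))
    convert this using 2 with z
    by_cases hω : z.point ∈ G
    · rw [indicator_of_mem (show z ∈ {z : Pred 𝓕 | z.point ∈ G} from hω)]
      simp only [r, Kernel.piecewise_apply, if_pos hω, Kernel.restrict_apply, Function.comp_apply]
      rw [Measure.restrict_apply measurableSet_Iic, Iic_inter_Iic]
    · rw [indicator_of_notMem (show z ∉ {z : Pred 𝓕 | z.point ∈ G} from hω)]
      simp [r, Kernel.piecewise_apply, if_neg hω]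
  have hset : ∀ (m : Kernel Ω ℝ≥0) (F : Set Ω) (C : Set ℝ≥0), MeasurableSet C →
      ∫⁻ ω in F, r m ω C ∂P = ∫⁻ ω in F, m ω (C ∩ Iic T) ∂P := by
    intro m F C hC
    refine lintegral_congr_ae (ae_restrict_of_ae ?_)
    filter_upwards [hr m] with ω hω
    rw [hω, Measure.restrict_apply hC]
  have hmass : ∀ (m : Kernel Ω ℝ≥0), ∫⁻ ω, r m ω univ ∂P = ∫⁻ ω, m ω (Iic T) ∂P := by
    intro m
    have := hset m univ univ MeasurableSet.univ
    rwa [setLIntegral_univ, setLIntegral_univ, univ_inter] at this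
  have := ae_mass_eq_of_predRect (P := P) (𝓕 := 𝓕) (r m₁) (r m₂) (hfin _ fun ω hω => hω.1)
    (hfin _ fun ω hω => hω.2)
    (hpred _ hp₁) (hpred _ hp₂) (by rw [hmass]; exact hi₁ T) (by rw [hmass]; exact hi₂ T) ?_ ?_
  · filter_upwards [this, hr m₁, hr m₂] with ω h1 h2 h3
    rwa [h2, h3, Measure.restrict_apply_univ, Measure.restrict_apply_univ] at h1
  · intro F hF
    rw [hset _ _ _ (measurableSet_singleton _), hset _ _ _ (measurableSet_singleton _),
      inter_eq_left.2 (singleton_subset_iff.2 (mem_Iic.2 zero_le)), h0 F hF]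
  · intro i F hF
    rw [hset _ _ _ measurableSet_Ioi, hset _ _ _ measurableSet_Ioi, Ioi_inter_Iic]
    rcases le_total i T with hi | hi
    · exact h i T F hi hF
    · simp [Ioc_eq_empty_of_le hi]

variable {U : Type*} [MeasurableSpace U]

/-- Random measures on `[0, ∞) × U` with predictable distribution functions, integrable on
`[0, T] × S k` for all `T` and `k`. -/
structure IsPredictableRM (𝓕 : Filtration ℝ≥0 mΩ) (P : Measure Ω) (S : ℕ → Set U)
    (κ : Kernel Ω (ℝ≥0 × U)) : Prop where
  predictable : ∀ A, MeasurableSet A →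
    Measurable fun z : Pred 𝓕 => κ z.point (Iic z.time ×ˢ A)
  mean : ∀ T k, ∫⁻ ω, κ ω (Iic T ×ˢ S k) ∂P ≠ ∞

/-- A predictable random measure is determined by its mean on the predictable rectangles. -/
theorem IsPredictableRM.ae_eq [SFinite P] [MeasurableSpace.CountablyGenerated U]
    (h𝓕 : ∀ s : Set Ω, P s = 0 → MeasurableSet[𝓕 0] s) {S : ℕ → Set U}
    (hS : ⋃ k, S k = univ) (hSm : ∀ k, MeasurableSet (S k)) {κ₁ κ₂ : Kernel Ω (ℝ≥0 × U)}
    (h₁ : IsPredictableRM 𝓕 P S κ₁) (h₂ : IsPredictableRM 𝓕 P S κ₂)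
    (h0 : ∀ k A, A ⊆ S k → MeasurableSet A → ∀ F, MeasurableSet[𝓕 0] F →
      ∫⁻ ω in F, κ₁ ω ({0} ×ˢ A) ∂P = ∫⁻ ω in F, κ₂ ω ({0} ×ˢ A) ∂P)
    (h : ∀ k A, A ⊆ S k → MeasurableSet A → ∀ i j F, i ≤ j → MeasurableSet[𝓕 i] F →
      ∫⁻ ω in F, κ₁ ω (Ioc i j ×ˢ A) ∂P = ∫⁻ ω in F, κ₂ ω (Ioc i j ×ˢ A) ∂P) :
    ∀ᵐ ω ∂P, κ₁ ω = κ₂ ω := by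
  -- For fixed $B\cap S_k$, projecting to the time axis reduces the claim to measures on the half
  -- line.
  have key : ∀ n k, ∀ B ∈ countableAlgebra U, ∀ᵐ ω ∂P,
      κ₁ ω (Iic (TopologicalSpace.denseSeq ℝ≥0 n) ×ˢ (B ∩ S k)) =
        κ₂ ω (Iic (TopologicalSpace.denseSeq ℝ≥0 n) ×ˢ (B ∩ S k)) := by
    intro n k B hB
    have hA : MeasurableSet (B ∩ S k) :=
      (measurableSet_of_mem_countableAlgebra hB).inter (hSm k)
    have hu : MeasurableSet (univ ×ˢ (B ∩ S k) : Set (ℝ≥0 × U)) := MeasurableSet.univ.prod hA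
    have hval : ∀ (κ : Kernel Ω (ℝ≥0 × U)) ω (C : Set ℝ≥0), MeasurableSet C →
        ((κ.restrict hu).map Prod.fst) ω C = κ ω (C ×ˢ (B ∩ S k)) := by
      intro κ ω C hC
      rw [Kernel.map_apply' _ measurable_fst _ hC, Kernel.restrict_apply' _ _ _
        (measurable_fst hC)]
      congr 1
      ext z
      simp
    have := ae_Iic_eq_of_lintegral_eq (P := P) (𝓕 := 𝓕) h𝓕 ((κ₁.restrict hu).map Prod.fst)
      ((κ₂.restrict hu).map Prod.fst) ?_ ?_ ?_ ?_ ?_ ?_ (TopologicalSpace.denseSeq ℝ≥0 n)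
    · simpa only [hval _ _ _ measurableSet_Iic] using this
    · simpa only [hval _ _ _ measurableSet_Iic] using h₁.predictable _ hA
    · simpa only [hval _ _ _ measurableSet_Iic] using h₂.predictable _ hA
    · intro T
      simp only [hval _ _ _ measurableSet_Iic]
      exact ne_top_of_le_ne_top (h₁.mean T k) (lintegral_mono fun ω =>
        measure_mono (prod_mono subset_rfl inter_subset_right))
    · intro T
      simp only [hval _ _ _ measurableSet_Iic]
      exact ne_top_of_le_ne_top (h₂.mean T k) (lintegral_mono fun ω =>
        measure_mono (prod_mono subset_rfl inter_subset_right))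
    · intro F hF
      simpa only [hval _ _ _ (measurableSet_singleton _)] using
        h0 k _ inter_subset_right hA F hF
    · intro i j F hij hF
      simpa only [hval _ _ _ measurableSet_Ioc] using
        h k _ inter_subset_right hA i j F hij hF
  have hfin : ∀ n k, ∀ᵐ ω ∂P, κ₁ ω (Iic (TopologicalSpace.denseSeq ℝ≥0 n) ×ˢ S k) < ∞ :=
    fun n k => ae_lt_top (κ₁.measurable_coe (measurableSet_Iic.prod (hSm k))) (h₁.mean _ k)
  have key' : ∀ᵐ ω ∂P, ∀ n k, ∀ B ∈ countableAlgebra U,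
      κ₁ ω (Iic (TopologicalSpace.denseSeq ℝ≥0 n) ×ˢ (B ∩ S k)) =
        κ₂ ω (Iic (TopologicalSpace.denseSeq ℝ≥0 n) ×ˢ (B ∩ S k)) :=
    ae_all_iff.2 fun n => ae_all_iff.2 fun k =>
      (ae_ball_iff countable_countableAlgebra).2 fun B hB => key n k B hB
  filter_upwards [key', ae_all_iff.2 fun n => ae_all_iff.2 (hfin n)] with ω h1 h2
  exact ext_of_Iic_prod hS h2 h1

end Uniqueness

end CylMVM

namespace CylMVM

open ProbabilityTheory

/-! ### Null sets, finite variation and right continuity. -/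

section Generalities

variable {Ω : Type*} {mΩ : MeasurableSpace Ω} {𝓕 : Filtration ℝ≥0 mΩ} {P : Measure Ω}

/-- All null sets belong to $\mathcal F_0\subseteq\mathcal F_t$, so any version of an $\mathcal
F_t$-measurable function is again $\mathcal F_t$-measurable. This permits arbitrary representatives
of the classes $M(t,A)(x)$. -/
theorem stronglyMeasurable_congr_ae (h𝓕 : ∀ s : Set Ω, P s = 0 → MeasurableSet[𝓕 0] s)
    {t : ℝ≥0} {f g : Ω → ℝ} (hg : StronglyMeasurable[𝓕 t] g) (hfg : f =ᵐ[P] g) :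
    StronglyMeasurable[𝓕 t] f := by
  have hnull : ∀ s : Set Ω, P s = 0 → MeasurableSet[𝓕 t] s := fun s hs =>
    𝓕.mono zero_le _ (h𝓕 s hs)
  refine Measurable.stronglyMeasurable fun B hB => ?_
  have hN : P {ω | ¬ f ω = g ω} = 0 := hfg
  have : f ⁻¹' B = (g ⁻¹' B \ {ω | ¬ f ω = g ω}) ∪ (f ⁻¹' B ∩ {ω | ¬ f ω = g ω}) := by
    ext ω
    by_cases h : f ω = g ω <;> simp [h]
  rw [this]
  exact ((hg.measurable hB).diff (hnull _ hN)).union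
    (hnull _ (measure_mono_null inter_subset_right hN))

theorem martingale_congr_ae {f g : ℝ≥0 → Ω → ℝ} (hf : Martingale f 𝓕 P)
    (h : ∀ t, f t =ᵐ[P] g t) (hg : StronglyAdapted 𝓕 g) : Martingale g 𝓕 P :=
  ⟨hg, fun i j hij => (condExp_congr_ae (h j).symm).trans ((hf.2 i j hij).trans (h i))⟩

theorem locallyBoundedVariationOn_of_edist_le {f g : ℝ≥0 → ℝ} {s : Set ℝ≥0}
    (h : ∀ x y, edist (f x) (f y) ≤ edist (g x) (g y)) (hg : LocallyBoundedVariationOn g s) :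
    LocallyBoundedVariationOn f s := by
  intro a b ha hb
  refine ne_top_of_le_ne_top (hg a b ha hb) ?_
  exact iSup_mono fun p => Finset.sum_le_sum fun i _ => h _ _

/-- The increments of $(p-q)/4$ are dominated by those of the monotone function $p+q$. -/
theorem locallyBoundedVariationOn_sub_of_monotone {p q : ℝ≥0 → ℝ} (hp : Monotone p)
    (hq : Monotone q) : LocallyBoundedVariationOn (fun t => (p t - q t) / 4) univ := by
  refine locallyBoundedVariationOn_of_edist_le (g := fun t => p t + q t) ?_
    ((hp.add hq).monotoneOn univ).locallyBoundedVariationOn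
  have key : ∀ x y : ℝ≥0, x ≤ y →
      |(p x - q x) / 4 - (p y - q y) / 4| ≤ |p x + q x - (p y + q y)| := by
    intro x y hxy
    have h1 := hp hxy
    have h2 := hq hxy
    rw [abs_le, abs_of_nonpos (by linarith)]
    constructor <;> linarith
  intro x y
  rw [edist_dist, edist_dist, Real.dist_eq, Real.dist_eq]
  refine ENNReal.ofReal_le_ofReal ?_
  rcases le_total x y with hxy | hxy
  · exact key x y hxy
  · rw [abs_sub_comm, abs_sub_comm (p x + q x)]
    exact key y x hxy

theorem continuousWithinAt_toReal_measure_Iic {U : Type*} [MeasurableSpace U] {A : Set U}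
    (hA : MeasurableSet A) {μ : Measure (ℝ≥0 × U)} (h : ∀ t, μ (Iic t ×ˢ A) < ∞) (t : ℝ≥0) :
    ContinuousWithinAt (fun s => (μ (Iic s ×ˢ A)).toReal) (Ici t) t := by
  rw [← continuousWithinAt_Ioi_iff_Ici]
  have := tendsto_measure_biInter_gt (μ := μ) (s := fun s => Iic s ×ˢ A) (a := t)
    (fun r _ => (measurableSet_Iic.prod hA).nullMeasurableSet)
    (fun i j _ hij => prod_mono (Iic_subset_Iic.2 hij) subset_rfl)
    ⟨t + 1, lt_add_one t, (h _).ne⟩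
  have hI : ⋂ r, ⋂ (_ : r > t), (Iic r ×ˢ A : Set (ℝ≥0 × U)) = Iic t ×ˢ A := by
    ext z
    simp only [mem_iInter, mem_prod, mem_Iic]
    refine ⟨fun hz => ⟨le_of_forall_gt_imp_ge_of_dense fun r hr => (hz r hr).1,
      (hz (t + 1) (lt_add_one t)).2⟩, fun hz r hr => ⟨hz.1.trans (le_of_lt hr), hz.2⟩⟩
  rw [hI] at this
  exact (ENNReal.tendsto_toReal (h t).ne).comp this

theorem monotone_toReal_measure_Iic {U : Type*} [MeasurableSpace U] {A : Set U}
    {μ : Measure (ℝ≥0 × U)} (h : ∀ t, μ (Iic t ×ˢ A) < ∞) :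
    Monotone fun s => (μ (Iic s ×ˢ A)).toReal := fun _ _ hst =>
  ENNReal.toReal_mono (h _).ne (measure_mono (prod_mono (Iic_subset_Iic.2 hst) subset_rfl))

end Generalities

/-! ### Intensity measures: uniqueness, parallelogram identity, scaling and polarization. -/

section Intensity

variable {Ω U X : Type*} {mΩ : MeasurableSpace Ω} {𝓕 : Filtration ℝ≥0 mΩ} {P : Measure Ω}
  [MeasurableSpace U] [NormedAddCommGroup X] [NormedSpace ℝ X] {𝒜 : Set (Set U)}
  {M : ℝ≥0 → Set U → StrongDual ℝ X →ₗ[ℝ] (Ω →ₘ[P] ℝ)}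

theorem Icc_zero_eq_Iic (t : ℝ≥0) : Icc 0 t = Iic t := by ext; simp

theorem IsCylindricalOrthogonalMVM.stronglyMeasurable_proc
    (h𝓕 : ∀ s : Set Ω, P s = 0 → MeasurableSet[𝓕 0] s)
    (hM : IsCylindricalOrthogonalMVM 𝓕 P 𝒜 M) {A : Set U} (hA : A ∈ 𝒜) (x : StrongDual ℝ X)
    (t : ℝ≥0) : StronglyMeasurable[𝓕 t] (proc M A x t) := by
  obtain ⟨Y, hY, hYM⟩ := hM.martingale A hA x
  exact stronglyMeasurable_congr_ae h𝓕 (hY.martingale.1 t) (hYM t).symm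

theorem IsCylindricalOrthogonalMVM.memLp_proc
    (hM : IsCylindricalOrthogonalMVM 𝓕 P 𝒜 M) {A : Set U} (hA : A ∈ 𝒜) (x : StrongDual ℝ X)
    (t : ℝ≥0) : MemLp (proc M A x t) 2 P := by
  obtain ⟨Y, hY, hYM⟩ := hM.martingale A hA x
  exact (hY.memLp t).ae_eq (hYM t)

omit [MeasurableSpace U] in
theorem proc_add (A : Set U) (x y : StrongDual ℝ X) (t : ℝ≥0) :
    proc M A (x + y) t =ᵐ[P] fun ω => proc M A x t ω + proc M A y t ω := by
  have h := AEEqFun.coeFn_add (M t A x) (M t A y)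
  rw [← map_add] at h
  exact h

omit [MeasurableSpace U] in
theorem proc_sub (A : Set U) (x y : StrongDual ℝ X) (t : ℝ≥0) :
    proc M A (x - y) t =ᵐ[P] fun ω => proc M A x t ω - proc M A y t ω := by
  have h := AEEqFun.coeFn_sub (M t A x) (M t A y)
  rw [← map_sub] at h
  exact h

omit [MeasurableSpace U] in
theorem proc_smul (A : Set U) (c : ℝ) (x : StrongDual ℝ X) (t : ℝ≥0) :
    proc M A (c • x) t =ᵐ[P] fun ω => c * proc M A x t ω := by
  have h := AEEqFun.coeFn_smul c (M t A x)
  rw [← map_smul] at h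
  exact h

theorem IsIntensityMeasure.measurable_Iic {x : StrongDual ℝ X} {ν : Ω → Measure (ℝ≥0 × U)}
    (hν : IsIntensityMeasure 𝓕 P 𝒜 M x ν) {A : Set U} (hA : MeasurableSet A) :
    Measurable[𝓕.predictable] fun p : ℝ≥0 × Ω => ν p.2 (Iic p.1 ×ˢ A) := by
  simpa only [Icc_zero_eq_Iic] using hν.predictable A hA

theorem IsIntensityMeasure.isStronglyPredictable {x : StrongDual ℝ X}
    {ν : Ω → Measure (ℝ≥0 × U)} (hν : IsIntensityMeasure 𝓕 P 𝒜 M x ν) {A : Set U}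
    (hA : MeasurableSet A) :
    IsStronglyPredictable 𝓕 fun t ω => (ν ω (Iic t ×ˢ A)).toReal := by
  have h : Measurable[𝓕.predictable]
      (Function.uncurry fun t ω => (ν ω (Iic t ×ˢ A)).toReal) :=
    (hν.measurable_Iic hA).ennreal_toReal
  exact h.stronglyMeasurable

theorem IsIntensityMeasure.lt_top {x : StrongDual ℝ X} {ν : Ω → Measure (ℝ≥0 × U)}
    (hν : IsIntensityMeasure 𝓕 P 𝒜 M x ν) {A : Set U} (hA : A ∈ 𝒜) :
    ∀ᵐ ω ∂P, ∀ t, ν ω (Iic t ×ˢ A) < ∞ := by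
  obtain ⟨V, -, h⟩ := hν.bracket A hA
  filter_upwards [ae_all_iff.2 fun n : ℕ => h n] with ω hω t
  obtain ⟨n, hn⟩ := exists_nat_ge t
  refine lt_of_le_of_lt (measure_mono ?_) (hω n).1
  rw [Icc_zero_eq_Iic]
  exact prod_mono (Iic_subset_Iic.2 hn) subset_rfl

/-- At each time the compensator in the definition equals the mass of $\nu$ almost surely, so it can
be replaced by that mass. -/
theorem IsIntensityMeasure.martingale (h𝓕 : ∀ s : Set Ω, P s = 0 → MeasurableSet[𝓕 0] s)
    (hM : IsCylindricalOrthogonalMVM 𝓕 P 𝒜 M)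
    {x : StrongDual ℝ X} {ν : Ω → Measure (ℝ≥0 × U)}
    (hν : IsIntensityMeasure 𝓕 P 𝒜 M x ν) {A : Set U} (hA : A ∈ 𝒜) (hAm : MeasurableSet A) :
    Martingale (fun t ω => proc M A x t ω * proc M A x t ω - (ν ω (Iic t ×ˢ A)).toReal) 𝓕 P := by
  obtain ⟨V, hV, h⟩ := hν.bracket A hA
  refine martingale_congr_ae hV.martingale (fun t => ?_) fun t => ?_
  · filter_upwards [h t] with ω hω
    rw [← hω.2, Icc_zero_eq_Iic]
  · have := hM.stronglyMeasurable_proc h𝓕 hA x t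
    exact (this.mul this).sub ((hν.isStronglyPredictable hAm).stronglyAdapted t)

theorem IsIntensityMeasure.zero_eq {x : StrongDual ℝ X} {ν : Ω → Measure (ℝ≥0 × U)}
    (hν : IsIntensityMeasure 𝓕 P 𝒜 M x ν) {A : Set U} (hA : A ∈ 𝒜) :
    ∀ᵐ ω ∂P, ν ω ({0} ×ˢ A) = 0 := by
  obtain ⟨V, hV, h⟩ := hν.bracket A hA
  filter_upwards [h 0, hV.zero] with ω h1 h2
  rw [h2, Icc_self, ENNReal.toReal_eq_zero_iff] at h1
  exact h1.2.resolve_right h1.1.ne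

theorem IsIntensityMeasure.integrable [IsFiniteMeasure P]
    (h𝓕 : ∀ s : Set Ω, P s = 0 → MeasurableSet[𝓕 0] s)
    (hM : IsCylindricalOrthogonalMVM 𝓕 P 𝒜 M)
    {x : StrongDual ℝ X} {ν : Ω → Measure (ℝ≥0 × U)}
    (hν : IsIntensityMeasure 𝓕 P 𝒜 M x ν) {A : Set U} (hA : A ∈ 𝒜) (hAm : MeasurableSet A)
    (t : ℝ≥0) : Integrable (fun ω => (ν ω (Iic t ×ˢ A)).toReal) P := by
  have h1 := (hν.martingale h𝓕 hM hA hAm).integrable t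
  have h2 : Integrable (fun ω => proc M A x t ω * proc M A x t ω) P := by
    simpa only [sq] using (hM.memLp_proc hA x t).integrable_sq
  exact (h2.sub h1).congr (ae_of_all _ fun ω => sub_sub_cancel _ _)

/-- The increment over `(s, t]` of the second moment of `M(·, A)(x)` on the event `F`. -/
noncomputable def secondMoment (M : ℝ≥0 → Set U → StrongDual ℝ X →ₗ[ℝ] (Ω →ₘ[P] ℝ)) (A : Set U)
    (x : StrongDual ℝ X) (s t : ℝ≥0) (F : Set Ω) : ℝ :=
  ∫ ω in F, proc M A x t ω ^ 2 ∂P - ∫ ω in F, proc M A x s ω ^ 2 ∂P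

theorem IsIntensityMeasure.secondMoment_eq [IsFiniteMeasure P]
    (h𝓕 : ∀ s : Set Ω, P s = 0 → MeasurableSet[𝓕 0] s)
    (hM : IsCylindricalOrthogonalMVM 𝓕 P 𝒜 M)
    {x : StrongDual ℝ X} {ν : Ω → Measure (ℝ≥0 × U)}
    (hν : IsIntensityMeasure 𝓕 P 𝒜 M x ν) {A : Set U} (hA : A ∈ 𝒜) (hAm : MeasurableSet A)
    {s t : ℝ≥0} (hst : s ≤ t) {F : Set Ω} (hF : MeasurableSet[𝓕 s] F) :
    secondMoment M A x s t F =
      ∫ ω in F, ((ν ω (Iic t ×ˢ A)).toReal - (ν ω (Iic s ×ˢ A)).toReal) ∂P := by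
  have h := (hν.martingale h𝓕 hM hA hAm).setIntegral_eq hst hF
  have hi : ∀ r, IntegrableOn (fun ω => (ν ω (Iic r ×ˢ A)).toReal) F P := fun r =>
    (hν.integrable h𝓕 hM hA hAm r).integrableOn
  have hj : ∀ r, IntegrableOn (fun ω => proc M A x r ω * proc M A x r ω) F P := fun r => by
    simpa only [sq] using (hM.memLp_proc hA x r).integrable_sq.integrableOn
  rw [integral_sub (hj s) (hi s), integral_sub (hj t) (hi t)] at h
  rw [integral_sub (hi t) (hi s), secondMoment]
  simp only [sq]
  linarith

theorem IsIntensityMeasure.secondMoment_nonneg [IsFiniteMeasure P]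
    (h𝓕 : ∀ s : Set Ω, P s = 0 → MeasurableSet[𝓕 0] s)
    (hM : IsCylindricalOrthogonalMVM 𝓕 P 𝒜 M)
    {x : StrongDual ℝ X} {ν : Ω → Measure (ℝ≥0 × U)}
    (hν : IsIntensityMeasure 𝓕 P 𝒜 M x ν) {A : Set U} (hA : A ∈ 𝒜) (hAm : MeasurableSet A)
    {s t : ℝ≥0} (hst : s ≤ t) {F : Set Ω} (hF : MeasurableSet[𝓕 s] F) :
    0 ≤ secondMoment M A x s t F := by
  rw [hν.secondMoment_eq h𝓕 hM hA hAm hst hF]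
  refine integral_nonneg_of_ae (ae_restrict_of_ae ?_)
  filter_upwards [hν.lt_top hA] with ω hω
  exact sub_nonneg.2 (monotone_toReal_measure_Iic hω hst)

theorem measure_Ioc_prod_eq {A : Set U} {μ : Measure (ℝ≥0 × U)} (hAm : MeasurableSet A)
    (h : ∀ t, μ (Iic t ×ˢ A) < ∞) {s t : ℝ≥0} (hst : s ≤ t) :
    μ (Ioc s t ×ˢ A) =
      ENNReal.ofReal ((μ (Iic t ×ˢ A)).toReal - (μ (Iic s ×ˢ A)).toReal) := by
  have e : (Ioc s t ×ˢ A : Set (ℝ≥0 × U)) = Iic t ×ˢ A \ Iic s ×ˢ A := by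
    ext z; simp only [mem_prod, mem_Ioc, Set.mem_sdiff, mem_Iic]; constructor
    · rintro ⟨⟨h1, h2⟩, h3⟩; exact ⟨⟨h2, h3⟩, fun h => absurd h.1 (not_le.2 h1)⟩
    · rintro ⟨⟨h1, h2⟩, h3⟩; exact ⟨⟨not_le.1 fun h => h3 ⟨h, h2⟩, h1⟩, h2⟩
  rw [e, measure_sdiff (prod_mono (Iic_subset_Iic.2 hst) subset_rfl)
    (measurableSet_Iic.prod hAm).nullMeasurableSet (h s).ne,
    ENNReal.ofReal_sub _ ENNReal.toReal_nonneg, ENNReal.ofReal_toReal (h t).ne,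
    ENNReal.ofReal_toReal (h s).ne]

/-- The right side depends on $M$ alone and not on $\nu$; this is what makes the uniqueness
principle applicable. -/
theorem IsIntensityMeasure.setLIntegral_Ioc [IsFiniteMeasure P]
    (h𝓕 : ∀ s : Set Ω, P s = 0 → MeasurableSet[𝓕 0] s)
    (hM : IsCylindricalOrthogonalMVM 𝓕 P 𝒜 M)
    {x : StrongDual ℝ X} {ν : Ω → Measure (ℝ≥0 × U)}
    (hν : IsIntensityMeasure 𝓕 P 𝒜 M x ν) {A : Set U} (hA : A ∈ 𝒜) (hAm : MeasurableSet A)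
    {s t : ℝ≥0} (hst : s ≤ t) {F : Set Ω} (hF : MeasurableSet[𝓕 s] F) :
    ∫⁻ ω in F, ν ω (Ioc s t ×ˢ A) ∂P = ENNReal.ofReal (secondMoment M A x s t F) := by
  have hi : ∀ r, IntegrableOn (fun ω => (ν ω (Iic r ×ˢ A)).toReal) F P := fun r =>
    (hν.integrable h𝓕 hM hA hAm r).integrableOn
  rw [hν.secondMoment_eq h𝓕 hM hA hAm hst hF]
  refine Eq.trans ?_ (ofReal_integral_eq_lintegral_ofReal ((hi t).sub (hi s)) ?_).symm
  · refine lintegral_congr_ae (ae_restrict_of_ae ?_)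
    filter_upwards [hν.lt_top hA] with ω hω
    exact measure_Ioc_prod_eq hAm hω hst
  · refine ae_restrict_of_ae ?_
    filter_upwards [hν.lt_top hA] with ω hω
    exact sub_nonneg.2 (monotone_toReal_measure_Iic hω hst)

theorem IsIntensityMeasure.lintegral_Iic_ne_top [IsFiniteMeasure P]
    (h𝓕 : ∀ s : Set Ω, P s = 0 → MeasurableSet[𝓕 0] s)
    (hM : IsCylindricalOrthogonalMVM 𝓕 P 𝒜 M)
    {x : StrongDual ℝ X} {ν : Ω → Measure (ℝ≥0 × U)}
    (hν : IsIntensityMeasure 𝓕 P 𝒜 M x ν) {A : Set U} (hA : A ∈ 𝒜) (hAm : MeasurableSet A)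
    (t : ℝ≥0) : ∫⁻ ω, ν ω (Iic t ×ˢ A) ∂P ≠ ∞ := by
  have h := ofReal_integral_eq_lintegral_ofReal (hν.integrable h𝓕 hM hA hAm t)
    (ae_of_all _ fun ω => ENNReal.toReal_nonneg)
  have e : ∫⁻ ω, ν ω (Iic t ×ˢ A) ∂P = ∫⁻ ω, ENNReal.ofReal (ν ω (Iic t ×ˢ A)).toReal ∂P := by
    refine lintegral_congr_ae ?_
    filter_upwards [hν.lt_top hA] with ω hω
    rw [ENNReal.ofReal_toReal (hω t).ne]
  rw [e, ← h]
  exact ENNReal.ofReal_ne_top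

theorem IsIntensityMeasure.setLIntegral_zero {x : StrongDual ℝ X} {ν : Ω → Measure (ℝ≥0 × U)}
    (hν : IsIntensityMeasure 𝓕 P 𝒜 M x ν) {A : Set U} (hA : A ∈ 𝒜) (F : Set Ω) :
    ∫⁻ ω in F, ν ω ({0} ×ˢ A) ∂P = 0 := by
  rw [← lintegral_zero (μ := P.restrict F)]
  exact lintegral_congr_ae (ae_restrict_of_ae (hν.zero_eq hA))

/-- An intensity measure, as a kernel. -/
noncomputable def IsIntensityMeasure.kernel {x : StrongDual ℝ X} {ν : Ω → Measure (ℝ≥0 × U)}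
    (hν : IsIntensityMeasure 𝓕 P 𝒜 M x ν) : Kernel Ω (ℝ≥0 × U) := ⟨ν, hν.measurable⟩

theorem IsIntensityMeasure.kernel_apply {x : StrongDual ℝ X} {ν : Ω → Measure (ℝ≥0 × U)}
    (hν : IsIntensityMeasure 𝓕 P 𝒜 M x ν) (ω : Ω) : hν.kernel ω = ν ω := rfl

theorem IsIntensityMeasure.isPredictableRM [IsFiniteMeasure P]
    (h𝓕 : ∀ s : Set Ω, P s = 0 → MeasurableSet[𝓕 0] s)
    (hM : IsCylindricalOrthogonalMVM 𝓕 P 𝒜 M) {S : ℕ → Set U} (hSm : ∀ k, MeasurableSet (S k))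
    (hS𝒜 : ∀ k, S k ∈ 𝒜) {x : StrongDual ℝ X} {ν : Ω → Measure (ℝ≥0 × U)}
    (hν : IsIntensityMeasure 𝓕 P 𝒜 M x ν) : IsPredictableRM 𝓕 P S hν.kernel where
  predictable _ hA := (hν.measurable_Iic hA).comp measurable_pred_toProd
  mean T k := hν.lintegral_Iic_ne_top h𝓕 hM (hS𝒜 k) (hSm k) T

theorem IsPredictableRM.add {S : ℕ → Set U} (hSm : ∀ k, MeasurableSet (S k))
    {κ₁ κ₂ : Kernel Ω (ℝ≥0 × U)}
    (h₁ : IsPredictableRM 𝓕 P S κ₁) (h₂ : IsPredictableRM 𝓕 P S κ₂) :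
    IsPredictableRM 𝓕 P S (κ₁ + κ₂) where
  predictable A hA := by
    simp only [FunLike.coe_add, Pi.add_apply, Measure.add_apply]
    exact (h₁.predictable A hA).add (h₂.predictable A hA)
  mean T k := by
    simp only [FunLike.coe_add, Pi.add_apply, Measure.add_apply]
    rw [lintegral_add_left (κ₁.measurable_coe (measurableSet_Iic.prod (hSm k)))]
    exact ENNReal.add_ne_top.2 ⟨h₁.mean T k, h₂.mean T k⟩

/-- The intensity measure is unique up to almost sure equality. -/
theorem IsIntensityMeasure.ae_eq [IsFiniteMeasure P] [MeasurableSpace.CountablyGenerated U]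
    (h𝓕 : ∀ s : Set Ω, P s = 0 → MeasurableSet[𝓕 0] s)
    (hM : IsCylindricalOrthogonalMVM 𝓕 P 𝒜 M) {S : ℕ → Set U} (hS : ⋃ k, S k = univ)
    (hSm : ∀ k, MeasurableSet (S k)) (hS𝒜 : ∀ k B, MeasurableSet B → B ⊆ S k → B ∈ 𝒜)
    {x : StrongDual ℝ X} {ν₁ ν₂ : Ω → Measure (ℝ≥0 × U)}
    (h₁ : IsIntensityMeasure 𝓕 P 𝒜 M x ν₁) (h₂ : IsIntensityMeasure 𝓕 P 𝒜 M x ν₂) :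
    ∀ᵐ ω ∂P, ν₁ ω = ν₂ ω := by
  have hS' : ∀ k, S k ∈ 𝒜 := fun k => hS𝒜 k _ (hSm k) subset_rfl
  refine IsPredictableRM.ae_eq h𝓕 hS hSm (h₁.isPredictableRM h𝓕 hM hSm hS')
    (h₂.isPredictableRM h𝓕 hM hSm hS') ?_ ?_
  · intro k A hAS hAm F hF
    have hA := hS𝒜 k A hAm hAS
    exact (h₁.setLIntegral_zero hA F).trans (h₂.setLIntegral_zero hA F).symm
  · intro k A hAS hAm i j F hij hF
    have hA := hS𝒜 k A hAm hAS
    exact (h₁.setLIntegral_Ioc h𝓕 hM hA hAm hij hF).trans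
      (h₂.setLIntegral_Ioc h𝓕 hM hA hAm hij hF).symm

/-- Linearity of $M(r,A)$ reduces this to the parallelogram identity for real numbers at each
$\omega$. -/
theorem secondMoment_parallelogram (hM : IsCylindricalOrthogonalMVM 𝓕 P 𝒜 M) {A : Set U}
    (hA : A ∈ 𝒜) (x y : StrongDual ℝ X) (s t : ℝ≥0) (F : Set Ω) :
    secondMoment M A (x + y) s t F + secondMoment M A (x - y) s t F =
      2 * (secondMoment M A x s t F + secondMoment M A y s t F) := by
  have key : ∀ r, ∫ ω in F, proc M A (x + y) r ω ^ 2 ∂P + ∫ ω in F, proc M A (x - y) r ω ^ 2 ∂P =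
      2 * (∫ ω in F, proc M A x r ω ^ 2 ∂P + ∫ ω in F, proc M A y r ω ^ 2 ∂P) := by
    intro r
    have hi : ∀ z, IntegrableOn (fun ω => proc M A z r ω ^ 2) F P := fun z =>
      (hM.memLp_proc hA z r).integrable_sq.integrableOn
    rw [← integral_add (hi _) (hi _), ← integral_add (hi _) (hi _), ← integral_const_mul]
    refine integral_congr_ae (ae_restrict_of_ae ?_)
    filter_upwards [proc_add A x y r, proc_sub A x y r] with ω h1 h2
    rw [h1, h2]
    ring
  simp only [secondMoment]
  linarith [key s, key t]

/-- The parallelogram identity for intensity measures. -/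
theorem IsIntensityMeasure.parallelogram [IsFiniteMeasure P]
    [MeasurableSpace.CountablyGenerated U]
    (h𝓕 : ∀ s : Set Ω, P s = 0 → MeasurableSet[𝓕 0] s)
    (hM : IsCylindricalOrthogonalMVM 𝓕 P 𝒜 M) {S : ℕ → Set U} (hS : ⋃ k, S k = univ)
    (hSm : ∀ k, MeasurableSet (S k)) (hS𝒜 : ∀ k B, MeasurableSet B → B ⊆ S k → B ∈ 𝒜)
    {x y : StrongDual ℝ X} {ν₁ ν₂ ν₃ ν₄ : Ω → Measure (ℝ≥0 × U)}
    (h₁ : IsIntensityMeasure 𝓕 P 𝒜 M (x + y) ν₁) (h₂ : IsIntensityMeasure 𝓕 P 𝒜 M (x - y) ν₂)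
    (h₃ : IsIntensityMeasure 𝓕 P 𝒜 M x ν₃) (h₄ : IsIntensityMeasure 𝓕 P 𝒜 M y ν₄) :
    ∀ᵐ ω ∂P, ν₁ ω + ν₂ ω = (ν₃ ω + ν₄ ω) + (ν₃ ω + ν₄ ω) := by
  have hS' : ∀ k, S k ∈ 𝒜 := fun k => hS𝒜 k _ (hSm k) subset_rfl
  have r₁ := h₁.isPredictableRM h𝓕 hM hSm hS'
  have r₂ := h₂.isPredictableRM h𝓕 hM hSm hS'
  have r₃ := h₃.isPredictableRM h𝓕 hM hSm hS'
  have r₄ := h₄.isPredictableRM h𝓕 hM hSm hS'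
  have hadd : ∀ (κ₁ κ₂ : Kernel Ω (ℝ≥0 × U)) (F : Set Ω) (C : Set (ℝ≥0 × U)), MeasurableSet C →
      ∫⁻ ω in F, (κ₁ + κ₂) ω C ∂P = ∫⁻ ω in F, κ₁ ω C ∂P + ∫⁻ ω in F, κ₂ ω C ∂P := by
    intro κ₁ κ₂ F C hC
    simp only [FunLike.coe_add, Pi.add_apply, Measure.add_apply]
    exact lintegral_add_left (κ₁.measurable_coe hC) _
  -- Both sides are predictable random measures, so comparing second moments on rectangles is
  -- enough.
  refine IsPredictableRM.ae_eq h𝓕 hS hSm (r₁.add hSm r₂)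
    ((r₃.add hSm r₄).add hSm (r₃.add hSm r₄)) ?_ ?_
  · intro k A hAS hAm F hF
    have hA := hS𝒜 k A hAm hAS
    have hC : MeasurableSet ({0} ×ˢ A : Set (ℝ≥0 × U)) := (measurableSet_singleton _).prod hAm
    simp only [hadd _ _ _ _ hC, IsIntensityMeasure.kernel_apply, h₁.setLIntegral_zero hA,
      h₂.setLIntegral_zero hA, h₃.setLIntegral_zero hA, h₄.setLIntegral_zero hA, add_zero]
  · intro k A hAS hAm i j F hij hF
    have hA := hS𝒜 k A hAm hAS
    have hC : MeasurableSet (Ioc i j ×ˢ A : Set (ℝ≥0 × U)) := measurableSet_Ioc.prod hAm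
    have n₁ := h₁.secondMoment_nonneg h𝓕 hM hA hAm hij hF
    have n₂ := h₂.secondMoment_nonneg h𝓕 hM hA hAm hij hF
    have n₃ := h₃.secondMoment_nonneg h𝓕 hM hA hAm hij hF
    have n₄ := h₄.secondMoment_nonneg h𝓕 hM hA hAm hij hF
    simp only [hadd _ _ _ _ hC, IsIntensityMeasure.kernel_apply,
      h₁.setLIntegral_Ioc h𝓕 hM hA hAm hij hF, h₂.setLIntegral_Ioc h𝓕 hM hA hAm hij hF,
      h₃.setLIntegral_Ioc h𝓕 hM hA hAm hij hF, h₄.setLIntegral_Ioc h𝓕 hM hA hAm hij hF]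
    rw [← ENNReal.ofReal_add n₁ n₂, ← ENNReal.ofReal_add n₃ n₄,
      ← ENNReal.ofReal_add (add_nonneg n₃ n₄) (add_nonneg n₃ n₄),
      secondMoment_parallelogram hM hA, two_mul]

/-- The quadratic variation supplies intensity measures only on the unit sphere; scaling supplies
them for every nonzero vector. -/
theorem IsIntensityMeasure.smul (h𝓕 : ∀ s : Set Ω, P s = 0 → MeasurableSet[𝓕 0] s)
    (hM : IsCylindricalOrthogonalMVM 𝓕 P 𝒜 M) {x : StrongDual ℝ X}
    {ν : Ω → Measure (ℝ≥0 × U)} (hν : IsIntensityMeasure 𝓕 P 𝒜 M x ν) (c : ℝ≥0) :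
    IsIntensityMeasure 𝓕 P 𝒜 M ((c : ℝ) • x) (fun ω => (c ^ 2 : ℝ≥0) • ν ω) where
  measurable := by
    refine Measure.measurable_of_measurable_coe _ fun s hs => ?_
    simp only [Measure.smul_apply]
    exact ((Measure.measurable_coe hs).comp hν.measurable).const_smul (c ^ 2 : ℝ≥0)
  sigmaFinite := by
    filter_upwards [hν.sigmaFinite] with ω hω
    infer_instance
  predictable A hA := by
    simp only [Measure.smul_apply]
    exact (hν.predictable A hA).const_smul (c ^ 2 : ℝ≥0)
  bracket A hA := by
    obtain ⟨V, hV, h⟩ := hν.bracket A hA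
    have hVp : IsStronglyPredictable 𝓕 fun t ω => (c : ℝ) ^ 2 * V t ω :=
      StronglyMeasurable.const_mul hV.predictable _
    refine ⟨fun t ω => (c : ℝ) ^ 2 * V t ω, ⟨hVp, ?_, ?_, ?_, ?_⟩, fun t => ?_⟩
    · filter_upwards [hV.zero] with ω hω
      rw [hω, mul_zero]
    · filter_upwards [hV.rightCont] with ω hω t
      exact (hω t).const_mul _
    · filter_upwards [hV.finiteVariation] with ω hω
      exact (lipschitzWith_smul ((c : ℝ) ^ 2)).comp_locallyBoundedVariationOn hω
    · refine martingale_congr_ae (hV.martingale.smul ((c : ℝ) ^ 2)) (fun t => ?_) fun t => ?_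
      · filter_upwards [proc_smul (M := M) A c x t] with ω hω
        simp only [Pi.smul_apply, smul_eq_mul, hω]
        ring
      · have := hM.stronglyMeasurable_proc h𝓕 hA ((c : ℝ) • x) t
        exact (this.mul this).sub (hVp.stronglyAdapted t)
    · filter_upwards [h t] with ω hω
      rw [Measure.smul_apply]
      refine ⟨ENNReal.mul_lt_top (by simp) hω.1, ?_⟩
      rw [ENNReal.smul_def, smul_eq_mul, ENNReal.toReal_mul, hω.2]
      simp

theorem isIntensityMeasure_zero (h𝓕 : ∀ s : Set Ω, P s = 0 → MeasurableSet[𝓕 0] s)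
    (hM : IsCylindricalOrthogonalMVM 𝓕 P 𝒜 M) :
    IsIntensityMeasure 𝓕 P 𝒜 M 0 (fun _ => 0) where
  measurable := measurable_const
  sigmaFinite := ae_of_all _ fun _ => inferInstance
  predictable A hA := by
    simp only [Measure.coe_zero, Pi.zero_apply]
    exact measurable_const
  bracket A hA := by
    refine ⟨fun _ _ => 0, ⟨?_, ?_, ?_, ?_, ?_⟩, fun t => ?_⟩
    · exact stronglyMeasurable_const
    · exact ae_of_all _ fun _ => rfl
    · exact ae_of_all _ fun _ _ => continuousWithinAt_const
    · exact ae_of_all _ fun _ => (monotone_const.monotoneOn univ).locallyBoundedVariationOn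
    · refine martingale_congr_ae (martingale_zero ℝ 𝓕 P) (fun t => ?_) fun t => ?_
      · have : proc M A 0 t =ᵐ[P] 0 := by
          have h := AEEqFun.coeFn_zero (μ := P) (α := Ω) (β := ℝ)
          rw [← map_zero (M t A)] at h
          exact h
        filter_upwards [this] with ω hω
        simp [hω]
      · have := hM.stronglyMeasurable_proc h𝓕 hA 0 t
        exact (this.mul this).sub stronglyMeasurable_const
    · simp

/-- The covariation of `M(A)(x)` and `M(A)(y)`, by polarization of the intensity measures. -/
theorem isPredictableCovariation_polarization
    (h𝓕 : ∀ s : Set Ω, P s = 0 → MeasurableSet[𝓕 0] s)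
    (hM : IsCylindricalOrthogonalMVM 𝓕 P 𝒜 M) {x y : StrongDual ℝ X}
    {ν₁ ν₂ : Ω → Measure (ℝ≥0 × U)} (h₁ : IsIntensityMeasure 𝓕 P 𝒜 M (x + y) ν₁)
    (h₂ : IsIntensityMeasure 𝓕 P 𝒜 M (x - y) ν₂) {A : Set U} (hA : A ∈ 𝒜)
    (hAm : MeasurableSet A) :
    IsPredictableCovariation 𝓕 P (proc M A x) (proc M A y)
      (fun t ω => ((ν₁ ω (Iic t ×ˢ A)).toReal - (ν₂ ω (Iic t ×ˢ A)).toReal) / 4) := by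
  have hp : IsStronglyPredictable 𝓕
      (fun t ω => ((ν₁ ω (Iic t ×ˢ A)).toReal - (ν₂ ω (Iic t ×ˢ A)).toReal) / 4) := by
    have h : Measurable[𝓕.predictable] (Function.uncurry fun t ω =>
        ((ν₁ ω (Iic t ×ˢ A)).toReal - (ν₂ ω (Iic t ×ˢ A)).toReal) / 4) :=
      ((h₁.measurable_Iic hAm).ennreal_toReal.sub
        (h₂.measurable_Iic hAm).ennreal_toReal).div_const 4
    exact h.stronglyMeasurable
  refine ⟨hp, ?_, ?_, ?_, ?_⟩
  · have e : Iic (0 : ℝ≥0) = {0} := by ext; simp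
    filter_upwards [h₁.zero_eq hA, h₂.zero_eq hA] with ω e1 e2
    simp [e, e1, e2]
  · filter_upwards [h₁.lt_top hA, h₂.lt_top hA] with ω e1 e2 t
    exact ((continuousWithinAt_toReal_measure_Iic hAm e1 t).sub
      (continuousWithinAt_toReal_measure_Iic hAm e2 t)).div_const 4
  · filter_upwards [h₁.lt_top hA, h₂.lt_top hA] with ω e1 e2
    exact locallyBoundedVariationOn_sub_of_monotone (monotone_toReal_measure_Iic e1)
      (monotone_toReal_measure_Iic e2)
  · refine martingale_congr_ae (((h₁.martingale h𝓕 hM hA hAm).sub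
      (h₂.martingale h𝓕 hM hA hAm)).smul (1 / 4)) (fun t => ?_) fun t => ?_
    · filter_upwards [proc_add (M := M) A x y t, proc_sub (M := M) A x y t] with ω e1 e2
      simp only [Pi.smul_apply, Pi.sub_apply, smul_eq_mul, e1, e2]
      ring
    · exact ((hM.stronglyMeasurable_proc h𝓕 hA x t).mul
        (hM.stronglyMeasurable_proc h𝓕 hA y t)).sub (hp.stronglyAdapted t)

end Intensity

end CylMVM

namespace CylMVM

open ProbabilityTheory

/-! ### Predictable integrals and predictable Radon–Nikodym derivatives. -/

section PredictableDensity

variable {Ω U : Type*} {mΩ : MeasurableSpace Ω} {𝓕 : Filtration ℝ≥0 mΩ} {P : Measure Ω}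
  [MeasurableSpace U]

/-- The restrictions `κ ω|_{[0, t] × U}` of a predictable random measure form a kernel on the
predictable space. -/
theorem measurable_restrict_Iic {κ : Kernel Ω (ℝ≥0 × U)} (hκ : ∀ ω, κ ω univ < ∞)
    (hp : ∀ A, MeasurableSet A → Measurable fun z : Pred 𝓕 => κ z.point (Iic z.time ×ˢ A)) :
    Measurable fun z : Pred 𝓕 => (κ z.point).restrict (Iic z.time ×ˢ univ) := by
  have hi : ∀ z : Pred 𝓕, IsFiniteMeasure ((κ z.point).restrict (Iic z.time ×ˢ univ)) := fun z =>
    ⟨by rw [Measure.restrict_apply_univ]; exact lt_of_le_of_lt (measure_mono (subset_univ _)) (hκ _)⟩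
  have hgen : (inferInstance : MeasurableSpace (ℝ≥0 × U)) = MeasurableSpace.generateFrom
      (image2 (· ×ˢ ·) (range (Iic : ℝ≥0 → Set ℝ≥0)) {A : Set U | MeasurableSet A}) := by
    refine (generateFrom_eq_prod ?_ MeasurableSpace.generateFrom_measurableSet
      ⟨fun n : ℕ => Iic (n : ℝ≥0), fun n => mem_range_self _, ?_⟩
      ⟨fun _ => univ, fun _ => MeasurableSet.univ, iUnion_const _⟩).symm
    · rw [BorelSpace.measurable_eq (α := ℝ≥0), borel_eq_generateFrom_Iic]
    · refine eq_univ_of_forall fun t => ?_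
      obtain ⟨n, hn⟩ := exists_nat_ge t
      exact mem_iUnion.2 ⟨n, hn⟩
  refine Measurable.measure_of_isPiSystem hgen (isPiSystem_Iic.prod MeasurableSpace.isPiSystem_measurableSet) ?_ ?_
  -- The mass of $[0,t]\cap[0,s]$ is the value of a predictable process at the stopped point
  -- $(t\wedge s,\omega)$.
  · rintro _ ⟨_, ⟨s, rfl⟩, A, hA, rfl⟩
    convert (hp A hA).comp (measurable_pred_stop_const s) using 2 with z
    rw [Measure.restrict_apply (measurableSet_Iic.prod hA), prod_inter_prod, Iic_inter_Iic,
      inter_univ, Function.comp_apply, min_comm]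
  · simpa only [Measure.restrict_apply_univ] using hp univ MeasurableSet.univ

/-- The integral of a predictable function against a predictable random measure is predictable. -/
theorem measurable_setLIntegral_Iic {κ : Kernel Ω (ℝ≥0 × U)} (hκ : ∀ ω, κ ω univ < ∞)
    (hp : ∀ A, MeasurableSet A → Measurable fun z : Pred 𝓕 => κ z.point (Iic z.time ×ˢ A))
    {H : Pred 𝓕 × U → ℝ≥0∞} (hH : Measurable H) {A : Set U} (hA : MeasurableSet A) :
    Measurable fun z : Pred 𝓕 =>
      ∫⁻ p in Iic z.time ×ˢ A, H (⟨p.1, z.point⟩, p.2) ∂(κ z.point) := by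
  let K : Kernel (Pred 𝓕) (ℝ≥0 × U) := ⟨_, measurable_restrict_Iic hκ hp⟩
  have hK : IsSFiniteKernel K := isSFiniteKernel_of_isFiniteMeasure K fun z => by
    change (κ z.point).restrict _ univ < ∞
    rw [Measure.restrict_apply_univ]
    exact lt_of_le_of_lt (measure_mono (subset_univ _)) (hκ _)
  -- The integrand at $(r,\omega)$ is not visibly measurable in $((t,\omega),r)$ when $\omega$
  -- enters only through predictable sets. At $(t\wedge r,\omega)$ it is, and on the domain $r\le t$
  -- the two agree.
  have hHmin : Measurable fun q : Pred 𝓕 × (ℝ≥0 × U) =>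
      H ((⟨min q.1.time q.2.1, q.1.point⟩ : Pred 𝓕), q.2.2) :=
    hH.comp ((measurable_pred_stop.comp
      (measurable_fst.prodMk (measurable_fst.comp measurable_snd))).prodMk
      (measurable_snd.comp measurable_snd))
  have hS : MeasurableSet {q : Pred 𝓕 × (ℝ≥0 × U) | q.2.2 ∈ A} :=
    (measurable_snd.comp measurable_snd) hA
  have := Measurable.lintegral_kernel_prod_right' (κ := K) (hHmin.indicator hS)
  convert this using 2 with z
  have hB : MeasurableSet (Iic z.time ×ˢ univ : Set (ℝ≥0 × U)) :=
    measurableSet_Iic.prod MeasurableSet.univ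
  have hA' : MeasurableSet (univ ×ˢ A : Set (ℝ≥0 × U)) := MeasurableSet.univ.prod hA
  change _ = ∫⁻ p, _ ∂((κ z.point).restrict (Iic z.time ×ˢ univ))
  have e : (Iic z.time ×ˢ A : Set (ℝ≥0 × U)) = (univ ×ˢ A) ∩ (Iic z.time ×ˢ univ) := by
    ext; simp [and_comm]
  rw [e, ← Measure.restrict_restrict hA', ← lintegral_indicator hA']
  refine setLIntegral_congr_fun hB fun p hp => ?_
  have hpt : min z.time p.1 = p.1 := min_eq_right hp.1
  by_cases hpA : p.2 ∈ A
  · rw [indicator_of_mem (show p ∈ univ ×ˢ A from ⟨trivial, hpA⟩), indicator_of_mem (by exact hpA)]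
    simp only [hpt]
  · rw [indicator_of_notMem (show p ∉ univ ×ˢ A from fun h => hpA h.2),
      indicator_of_notMem (by exact hpA)]

/-- The section at `ω` of a subset of `([0, ∞) × Ω) × U`. -/
def predSection (ω : Ω) (D : Set (Pred 𝓕 × U)) : Set (ℝ≥0 × U) := {p | (⟨p.1, ω⟩, p.2) ∈ D}

theorem measurable_predMk :
    Measurable fun z : Ω × (ℝ≥0 × U) => ((⟨z.2.1, z.1⟩ : Pred 𝓕), z.2.2) :=
  (measurable_pred_mk_swap.comp (measurable_fst.prodMk (measurable_fst.comp measurable_snd))).prodMk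
    (measurable_snd.comp measurable_snd)

theorem measurable_predMk_right (ω : Ω) :
    Measurable fun p : ℝ≥0 × U => ((⟨p.1, ω⟩ : Pred 𝓕), p.2) :=
  measurable_predMk.comp measurable_prodMk_left

theorem measurableSet_predSection (ω : Ω) {D : Set (Pred 𝓕 × U)} (hD : MeasurableSet D) :
    MeasurableSet (predSection ω D) := measurable_predMk_right ω hD

/-- The mean of a random measure, as a measure on the predictable `σ`-algebra. -/
noncomputable def meanMeasure (𝓕 : Filtration ℝ≥0 mΩ) (P : Measure Ω) (κ : Kernel Ω (ℝ≥0 × U)) :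
    Measure (Pred 𝓕 × U) :=
  (P ⊗ₘ κ).map fun z => ((⟨z.2.1, z.1⟩ : Pred 𝓕), z.2.2)

theorem meanMeasure_apply [SFinite P] (κ : Kernel Ω (ℝ≥0 × U)) [IsSFiniteKernel κ]
    {D : Set (Pred 𝓕 × U)} (hD : MeasurableSet D) :
    meanMeasure 𝓕 P κ D = ∫⁻ ω, κ ω (predSection ω D) ∂P := by
  rw [meanMeasure, Measure.map_apply measurable_predMk hD,
    Measure.compProd_apply (measurable_predMk hD)]
  rfl

theorem lintegral_meanMeasure [SFinite P] (κ : Kernel Ω (ℝ≥0 × U)) [IsSFiniteKernel κ]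
    {H : Pred 𝓕 × U → ℝ≥0∞} (hH : Measurable H) :
    ∫⁻ z, H z ∂(meanMeasure 𝓕 P κ) = ∫⁻ ω, ∫⁻ p, H (⟨p.1, ω⟩, p.2) ∂(κ ω) ∂P :=
  (lintegral_map hH measurable_predMk).trans
    (Measure.lintegral_compProd (hH.comp measurable_predMk))

theorem measurable_uncurry_section {H : Pred 𝓕 × U → ℝ≥0∞} (hH : Measurable H) :
    Measurable (Function.uncurry fun (ω : Ω) (p : ℝ≥0 × U) => H (⟨p.1, ω⟩, p.2)) :=
  hH.comp measurable_predMk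

/-- A predictable random measure which is absolutely continuous with respect to another one
has a predictable density. -/
theorem exists_predictable_density [SFinite P] [MeasurableSpace.CountablyGenerated U]
    (h𝓕 : ∀ s : Set Ω, P s = 0 → MeasurableSet[𝓕 0] s) {S : ℕ → Set U}
    (hS : ⋃ k, S k = univ) (hSm : ∀ k, MeasurableSet (S k)) {κ L : Kernel Ω (ℝ≥0 × U)}
    (hκ : IsPredictableRM 𝓕 P S κ) (hκf : ∀ ω, κ ω univ < ∞)
    (hL : ∀ A, MeasurableSet A → Measurable fun z : Pred 𝓕 => L z.point (Iic z.time ×ˢ A))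
    (hLf : ∀ ω, L ω univ < ∞)
    (hLm : ∫⁻ ω, L ω univ ∂P ≠ ∞) (hac : ∀ᵐ ω ∂P, κ ω ≪ L ω) :
    ∃ f : Pred 𝓕 × U → ℝ≥0∞, Measurable f ∧
      ∀ᵐ ω ∂P, κ ω = (L ω).withDensity fun p => f (⟨p.1, ω⟩, p.2) := by
  have sκ := isSFiniteKernel_of_isFiniteMeasure κ hκf
  have sL := isSFiniteKernel_of_isFiniteMeasure L hLf
  have fL : IsFiniteMeasure (meanMeasure 𝓕 P L) :=
    ⟨by rw [meanMeasure_apply _ MeasurableSet.univ]; exact hLm.lt_top⟩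
  have hsf : SFinite (meanMeasure 𝓕 P κ) := by unfold meanMeasure; infer_instance
  -- Almost sure absolute continuity of the paths passes to the mean measures, where Radon–Nikodym
  -- gives a density measurable for the predictable σ-algebra.
  have hAC : meanMeasure 𝓕 P κ ≪ meanMeasure 𝓕 P L := by
    refine Measure.AbsolutelyContinuous.mk fun D hD h0 => ?_
    rw [meanMeasure_apply _ hD] at h0 ⊢
    rw [lintegral_eq_zero_iff] at h0
    · refine lintegral_eq_zero_of_ae_eq_zero ?_
      filter_upwards [h0, hac] with ω h1 h2 using h2 h1
    · exact Kernel.measurable_kernel_prodMk_left (κ := L) (measurable_predMk hD)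
  set f := (meanMeasure 𝓕 P κ).rnDeriv (meanMeasure 𝓕 P L)
  have hf : Measurable f := Measure.measurable_rnDeriv _ _
  have hfeq : (meanMeasure 𝓕 P L).withDensity f = meanMeasure 𝓕 P κ :=
    Measure.withDensity_rnDeriv_eq _ _ hAC
  refine ⟨f, hf, ?_⟩
  -- By construction $fL$ has the same mean as $\kappa$ on every predictable set. Being predictable
  -- itself, it equals $\kappa$ almost surely by uniqueness.
  let κ' : Kernel Ω (ℝ≥0 × U) := Kernel.withDensity L fun ω p => f (⟨p.1, ω⟩, p.2)
  have hκ' : ∀ ω, κ' ω = (L ω).withDensity fun p => f (⟨p.1, ω⟩, p.2) := fun ω =>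
    Kernel.withDensity_apply L (measurable_uncurry_section hf) ω
  have hsec : ∀ D : Set (Pred 𝓕 × U), MeasurableSet D →
      ∫⁻ ω, κ ω (predSection ω D) ∂P = ∫⁻ ω, κ' ω (predSection ω D) ∂P := by
    intro D hD
    rw [← meanMeasure_apply κ hD, ← hfeq, withDensity_apply _ hD, ← lintegral_indicator hD,
      lintegral_meanMeasure L (hf.indicator hD)]
    refine lintegral_congr fun ω => ?_
    rw [hκ', withDensity_apply _ (measurableSet_predSection ω hD),
      ← lintegral_indicator (measurableSet_predSection ω hD)]
    rfl
  have hrect : ∀ (B : Set ℝ≥0) (A : Set U) (F : Set Ω), MeasurableSet F → MeasurableSet A →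
      MeasurableSet {z : Pred 𝓕 | z.time ∈ B ∧ z.point ∈ F} →
      ∫⁻ ω in F, κ ω (B ×ˢ A) ∂P = ∫⁻ ω in F, κ' ω (B ×ˢ A) ∂P := by
    intro B A F hF hA hD
    have h := hsec _ (hD.prod hA)
    have key : ∀ (ρ : Kernel Ω (ℝ≥0 × U)), ∫⁻ ω, ρ ω (predSection ω
        ({z : Pred 𝓕 | z.time ∈ B ∧ z.point ∈ F} ×ˢ A)) ∂P = ∫⁻ ω in F, ρ ω (B ×ˢ A) ∂P := by
      intro ρ
      rw [← lintegral_indicator hF]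
      refine lintegral_congr fun ω => ?_
      by_cases hω : ω ∈ F
      · rw [indicator_of_mem hω]
        congr 1
        ext p
        simp [predSection, hω]
      · rw [indicator_of_notMem hω]
        convert measure_empty (μ := ρ ω)
        ext p
        simp [predSection, hω]
    rwa [key, key] at h
  have hpred' : IsPredictableRM 𝓕 P S κ' := by
    refine ⟨fun A hA => ?_, fun T k => ?_⟩
    · convert measurable_setLIntegral_Iic hLf hL hf hA using 2 with z
      rw [hκ', withDensity_apply _ (measurableSet_Iic.prod hA)]
    · have := hrect (Iic T) (S k) univ MeasurableSet.univ (hSm k) (by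
        have : MeasurableSet {z : Pred 𝓕 | z.time ∈ Iic T} :=
          measurable_pred_time measurableSet_Iic
        simpa using this)
      rw [setLIntegral_univ, setLIntegral_univ] at this
      rw [← this]
      exact hκ.mean T k
  have := IsPredictableRM.ae_eq h𝓕 hS hSm hκ hpred' ?_ ?_
  · filter_upwards [this] with ω hω
    rw [hω, hκ']
  · intro k A _ hA F hF
    exact hrect {0} A F (𝓕.le _ _ hF) hA (measurableSet_predRect_zero hF)
  · intro k A _ hA i j F hij hF
    refine hrect (Ioc i j) A F (𝓕.le _ _ hF) hA ?_
    convert (measurableSet_predRect_Ioi i hF).inter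
      (measurable_pred_time (𝓕 := 𝓕) (measurableSet_Iic (a := j))) using 1
    ext z
    simp
    tauto

end PredictableDensity

/-! ### Finite modifications and a common dominating measure. -/

section Modification

variable {Ω U : Type*} {mΩ : MeasurableSpace Ω} {𝓕 : Filtration ℝ≥0 mΩ} {P : Measure Ω}
  [MeasurableSpace U]

/-- The modification of a random measure which vanishes where the given one is infinite. -/
noncomputable def finiteModification (κ : Kernel Ω (ℝ≥0 × U)) : Kernel Ω (ℝ≥0 × U) :=
  open Classical in
  Kernel.piecewise (s := {ω | κ ω univ < ∞})
    (measurableSet_lt (κ.measurable_coe MeasurableSet.univ) measurable_const) κ 0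

theorem finiteModification_of_lt {κ : Kernel Ω (ℝ≥0 × U)} {ω : Ω} (h : κ ω univ < ∞) :
    finiteModification κ ω = κ ω := by
  rw [finiteModification, Kernel.piecewise_apply, if_pos (by exact h)]

theorem finiteModification_of_not_lt {κ : Kernel Ω (ℝ≥0 × U)} {ω : Ω} (h : ¬ κ ω univ < ∞) :
    finiteModification κ ω = 0 := by
  rw [finiteModification, Kernel.piecewise_apply, if_neg (by exact h)]
  rfl

theorem finiteModification_lt_top (κ : Kernel Ω (ℝ≥0 × U)) (ω : Ω) :
    finiteModification κ ω univ < ∞ := by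
  by_cases h : κ ω univ < ∞
  · rwa [finiteModification_of_lt h]
  · rw [finiteModification_of_not_lt h]; simp

theorem finiteModification_le (κ : Kernel Ω (ℝ≥0 × U)) (ω : Ω) :
    finiteModification κ ω ≤ κ ω := by
  by_cases h : κ ω univ < ∞
  · rw [finiteModification_of_lt h]
  · rw [finiteModification_of_not_lt h]; exact Measure.zero_le _

/-- The event of infinite mass is null, hence in $\mathcal F_0$, and multiplying by its complement's
indicator preserves predictability. -/
theorem measurable_finiteModification (h𝓕 : ∀ s : Set Ω, P s = 0 → MeasurableSet[𝓕 0] s)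
    {κ : Kernel Ω (ℝ≥0 × U)} (hκ : ∀ᵐ ω ∂P, κ ω univ < ∞) {A : Set U}
    (hp : Measurable fun z : Pred 𝓕 => κ z.point (Iic z.time ×ˢ A)) :
    Measurable fun z : Pred 𝓕 => finiteModification κ z.point (Iic z.time ×ˢ A) := by
  have hG : MeasurableSet[𝓕 0] {ω | κ ω univ < ∞} := by
    have := (h𝓕 {ω | κ ω univ < ∞}ᶜ (mem_ae_iff.1 hκ)).compl
    rwa [compl_compl] at this
  convert hp.indicator (measurableSet_pred_point hG) using 2 with z
  by_cases h : κ z.point univ < ∞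
  · rw [finiteModification_of_lt h, indicator_of_mem (by exact h)]
  · rw [finiteModification_of_not_lt h, indicator_of_notMem (by exact h)]
    simp

/-- A countable family of predictable random measures is absolutely continuous with respect to a
single predictable random measure of finite mean. -/
theorem exists_dominating_rm (h𝓕 : ∀ s : Set Ω, P s = 0 → MeasurableSet[𝓕 0] s) {S : ℕ → Set U}
    (hS : ⋃ k, S k = univ) (hSm : ∀ k, MeasurableSet (S k)) {ι : Type*} [Countable ι]
    (κ : ι → Kernel Ω (ℝ≥0 × U))
    (hp : ∀ i A, MeasurableSet A → Measurable fun z : Pred 𝓕 => κ i z.point (Iic z.time ×ˢ A))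
    (hm : ∀ i k, ∫⁻ ω, κ i ω (univ ×ˢ S k) ∂P ≠ ∞) :
    ∃ L : Kernel Ω (ℝ≥0 × U), (∀ ω, L ω univ < ∞) ∧
      (∀ A, MeasurableSet A → Measurable fun z : Pred 𝓕 => L z.point (Iic z.time ×ˢ A)) ∧
      ∫⁻ ω, L ω univ ∂P ≠ ∞ ∧ (∀ᵐ ω ∂P, ∀ i, κ i ω ≪ L ω) ∧
      ∀ ω C, MeasurableSet C → (∀ i, κ i ω C = 0) → L ω C = 0 := by
  have : Encodable ι := Encodable.ofCountable ι
  obtain ⟨ε, hε, hεs⟩ := ENNReal.exists_pos_sum_of_countable' (ε := 1) one_ne_zero (ι × ℕ)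
  -- The weights are chosen so that each weighted mean is at most $\varepsilon_p$, with
  -- $\sum_p\varepsilon_p<1$; the $1$ in the denominator covers zero means.
  set c : ι × ℕ → ℝ≥0∞ := fun p => ε p / (1 + ∫⁻ ω, κ p.1 ω (univ ×ˢ S p.2) ∂P) with hc
  have hc0 : ∀ p, c p ≠ 0 := fun p => (ENNReal.div_pos (hε p).ne'
    (ENNReal.add_ne_top.2 ⟨ENNReal.one_ne_top, hm _ _⟩)).ne'
  have hcm : ∀ p : ι × ℕ, c p * ∫⁻ ω, κ p.1 ω (univ ×ˢ S p.2) ∂P ≤ ε p := by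
    intro p
    calc c p * ∫⁻ ω, κ p.1 ω (univ ×ˢ S p.2) ∂P
        ≤ c p * (1 + ∫⁻ ω, κ p.1 ω (univ ×ˢ S p.2) ∂P) := by gcongr; exact le_add_self
      _ ≤ ε p := by rw [mul_comm]; exact ENNReal.mul_div_le
  have hu : ∀ k, MeasurableSet (univ ×ˢ S k : Set (ℝ≥0 × U)) := fun k =>
    MeasurableSet.univ.prod (hSm k)
  have hval : ∀ ω (C : Set (ℝ≥0 × U)), MeasurableSet C →
      Measure.sum (fun p : ι × ℕ => c p • (κ p.1 ω).restrict (univ ×ˢ S p.2)) C =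
        ∑' p : ι × ℕ, c p * κ p.1 ω (C ∩ univ ×ˢ S p.2) := by
    intro ω C hC
    rw [Measure.sum_apply _ hC]
    simp only [Measure.smul_apply, Measure.restrict_apply hC, smul_eq_mul]
  let L₀ : Kernel Ω (ℝ≥0 × U) :=
    ⟨fun ω => Measure.sum fun p : ι × ℕ => c p • (κ p.1 ω).restrict (univ ×ˢ S p.2), by
      refine Measure.measurable_of_measurable_coe _ fun C hC => ?_
      simp only [hval _ C hC]
      exact Measurable.tsum fun p =>
        ((κ p.1).measurable_coe (hC.inter (hu p.2))).const_mul _⟩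
  have hL₀ : ∀ ω (C : Set (ℝ≥0 × U)), MeasurableSet C →
      L₀ ω C = ∑' p : ι × ℕ, c p * κ p.1 ω (C ∩ univ ×ˢ S p.2) := hval
  have hmean : ∫⁻ ω, L₀ ω univ ∂P ≠ ∞ := by
    simp only [hL₀ _ univ MeasurableSet.univ, univ_inter]
    rw [lintegral_tsum fun p : ι × ℕ => (((κ p.1).measurable_coe (hu p.2)).const_mul _).aemeasurable]
    simp only [lintegral_const_mul _ ((κ _).measurable_coe (hu _))]
    exact ne_top_of_le_ne_top (hεs.trans ENNReal.one_lt_top).ne (ENNReal.tsum_le_tsum hcm)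
  have hae : ∀ᵐ ω ∂P, L₀ ω univ < ∞ := ae_lt_top (L₀.measurable_coe MeasurableSet.univ) hmean
  refine ⟨finiteModification L₀, finiteModification_lt_top L₀, fun A hA => ?_, ?_, ?_, ?_⟩
  · refine measurable_finiteModification h𝓕 hae ?_
    simp only [hL₀ _ _ (measurableSet_Iic.prod hA), prod_inter_prod, inter_univ]
    exact Measurable.tsum fun p => (hp p.1 _ (hA.inter (hSm p.2))).const_mul _
  · exact ne_top_of_le_ne_top hmean (lintegral_mono fun ω => finiteModification_le L₀ ω _)
  · filter_upwards [hae] with ω hω i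
    rw [finiteModification_of_lt hω]
    refine Measure.AbsolutelyContinuous.mk fun C hC h0 => ?_
    rw [hL₀ ω C hC, ENNReal.tsum_eq_zero] at h0
    have : C = ⋃ k, C ∩ univ ×ˢ S k := by
      rw [← inter_iUnion, ← prod_iUnion, hS, univ_prod_univ, inter_univ]
    rw [this]
    exact measure_iUnion_null fun k => (mul_eq_zero.1 (h0 (i, k))).resolve_left (hc0 _)
  · intro ω C hC h
    refine le_antisymm ((finiteModification_le L₀ ω C).trans ?_) zero_le
    rw [hL₀ ω C hC, nonpos_iff_eq_zero, ENNReal.tsum_eq_zero]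
    intro p
    rw [measure_mono_null inter_subset_left (h p.1), mul_zero]

end Modification

end CylMVM

namespace CylMVM

/-! ### Quadratic forms on abelian groups and their extension by continuity. -/

section QuadraticForms

/-- A real function on a commutative group satisfying the parallelogram identity comes from a
symmetric bi-additive form. -/
theorem exists_biadditive_of_parallelogram {G : Type*} [AddCommGroup G] {φ : G → ℝ}
    (h : ∀ x y, φ (x + y) + φ (x - y) = 2 * (φ x + φ y)) :
    ∃ b : G →+ G →+ ℝ, (∀ x y, b x y = (φ (x + y) - φ (x - y)) / 4) ∧ (∀ x, b x x = φ x) ∧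
      ∀ x y, b x y = b y x := by
  have h0 : φ 0 = 0 := by
    have := h 0 0
    simp only [add_zero, sub_zero] at this
    linarith
  have hneg : ∀ x, φ (-x) = φ x := by
    intro x
    have := h 0 x
    simp only [zero_add, zero_sub, h0] at this
    linarith
  have hsub : ∀ x y, φ (x - y) = φ (y - x) := by
    intro x y
    rw [← hneg (y - x), neg_sub]
  -- The Jordan–von Neumann computation: four instances of the parallelogram law combine linearly
  -- once $\varphi$ is known to be even.
  have hadd : ∀ x z y, (φ (x + z + y) - φ (x + z - y)) / 4 =
      (φ (x + y) - φ (x - y)) / 4 + (φ (z + y) - φ (z - y)) / 4 := by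
    intro x z y
    have e1 := h (x + y) z
    have e2 := h (x - y) z
    have e3 := h (z + y) x
    have e4 := h (z - y) x
    have f1 : φ (x + y - z) = φ (z - y - x) := by rw [hsub]; congr 1; abel
    have f2 : φ (x - y - z) = φ (z + y - x) := by rw [hsub]; congr 1; abel
    have g1 : x + y + z = x + z + y := by abel
    have g2 : x - y + z = x + z - y := by abel
    have g3 : z + y + x = x + z + y := by abel
    have g4 : z - y + x = x + z - y := by abel
    rw [g1] at e1; rw [g2] at e2; rw [g3] at e3; rw [g4] at e4
    linarith
  have hsymm : ∀ x y, (φ (x + y) - φ (x - y)) / 4 = (φ (y + x) - φ (y - x)) / 4 := by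
    intro x y
    rw [add_comm x y, hsub x y]
  refine ⟨AddMonoidHom.mk' (fun x => AddMonoidHom.mk' (fun y => (φ (x + y) - φ (x - y)) / 4) ?_) ?_,
    fun x y => rfl, fun x => ?_, hsymm⟩
  · intro y z
    rw [hsymm, hadd, hsymm y, hsymm z]
  · intro x z
    ext y
    exact hadd x z y
  · have := h x x
    simp only [sub_self, h0] at this
    simp only [AddMonoidHom.mk'_apply, sub_self, h0]
    linarith

/-- Only integer scalars are available. Nonnegativity of $b(mx+ny,mx+ny)$ gives a quadratic
polynomial that is nonnegative on $\mathbb Q$, hence on $\mathbb R$, and its discriminant is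
nonpositive. -/
theorem sq_biadditive_le {G : Type*} [AddCommGroup G] (b : G →+ G →+ ℝ)
    (hs : ∀ x y, b x y = b y x) (hp : ∀ x, 0 ≤ b x x) (x y : G) :
    b x y ^ 2 ≤ b x x * b y y := by
  have hmn : ∀ m n : ℤ, 0 ≤ (m : ℝ) ^ 2 * b x x + 2 * m * n * b x y + (n : ℝ) ^ 2 * b y y := by
    intro m n
    have := hp (m • x + n • y)
    have hr : ∀ (k : ℤ) (u v : G), b u (k • v) = k * b u v := fun k u v => by
      rw [map_zsmul, zsmul_eq_mul]
    have hl : ∀ (k : ℤ) (u v : G), b (k • u) v = k * b u v := fun k u v => by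
      rw [hs, hr, hs v u]
    simp only [map_add, AddMonoidHom.add_apply, hr, hl, hs y x] at this
    linarith
  have hq : ∀ q : ℚ, 0 ≤ b x x * ((q : ℝ) * q) + 2 * b x y * q + b y y := by
    intro q
    have hd : (0 : ℝ) < q.den := by exact_mod_cast q.den_pos
    have e : (q : ℝ) = q.num / q.den := by exact_mod_cast (Rat.num_div_den q).symm
    have := hmn q.num q.den
    rw [e]
    have e2 : b x x * ((q.num : ℝ) / q.den * (q.num / q.den)) + 2 * b x y * (q.num / q.den) + b y y =
        ((q.num : ℝ) ^ 2 * b x x + 2 * q.num * (q.den : ℤ) * b x y +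
          ((q.den : ℤ) : ℝ) ^ 2 * b y y) / (q.den : ℝ) ^ 2 := by
      push_cast
      field_simp
    rw [e2]
    positivity
  have hr : ∀ r : ℝ, 0 ≤ b x x * (r * r) + 2 * b x y * r + b y y := by
    have hc : IsClosed {r : ℝ | 0 ≤ b x x * (r * r) + 2 * b x y * r + b y y} :=
      isClosed_le continuous_const (by fun_prop)
    intro r
    have : closure (range ((↑) : ℚ → ℝ)) ⊆ _ := hc.closure_subset_iff.2 (by
      rintro _ ⟨q, rfl⟩
      exact hq q)
    exact this (Rat.denseRange_cast r)
  have := discrim_le_zero hr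
  rw [discrim] at this
  nlinarith

variable {V : Type*} [NormedAddCommGroup V]

/-- Since $\varphi(x)-\varphi(y)=b(x-y,x+y)$, Cauchy–Schwarz gives the bound. It yields continuity
of $\varphi$ along convergent sequences in $E$. -/
theorem abs_sub_le_of_parallelogram {E : AddSubgroup V} {φ : V → ℝ} {g : ℝ}
    (hpar : ∀ x ∈ E, ∀ y ∈ E, φ (x + y) + φ (x - y) = 2 * (φ x + φ y))
    (h0 : ∀ x ∈ E, 0 ≤ φ x) (hg : ∀ x ∈ E, φ x ≤ g * ‖x‖ ^ 2) {x y : V} (hx : x ∈ E)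
    (hy : y ∈ E) : |φ x - φ y| ≤ |g| * (‖x - y‖ * ‖x + y‖) := by
  obtain ⟨b, -, hb, hs⟩ := exists_biadditive_of_parallelogram (G := E) (φ := fun x => φ x)
    fun x y => hpar x x.2 y y.2
  have hb' : ∀ x : E, b x x = φ x := hb
  set u : E := ⟨x, hx⟩
  set v : E := ⟨y, hy⟩
  have e : b (u - v) (u + v) = φ x - φ y := by
    simp only [map_add, map_sub, AddMonoidHom.sub_apply, hs v u, hb']
    simp only [u, v]
    ring
  have hcs := sq_biadditive_le b hs (fun z => (hb' z).symm ▸ h0 z z.2) (u - v) (u + v)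
  rw [e, hb', hb'] at hcs
  have h1 : φ (x - y) ≤ |g| * ‖x - y‖ ^ 2 := (hg _ (E.sub_mem hx hy)).trans
    (mul_le_mul_of_nonneg_right (le_abs_self g) (sq_nonneg _))
  have h2 : φ (x + y) ≤ |g| * ‖x + y‖ ^ 2 := (hg _ (E.add_mem hx hy)).trans
    (mul_le_mul_of_nonneg_right (le_abs_self g) (sq_nonneg _))
  refine abs_le_of_sq_le_sq (hcs.trans ?_) (by positivity)
  calc φ (x - y) * φ (x + y) ≤ (|g| * ‖x - y‖ ^ 2) * (|g| * ‖x + y‖ ^ 2) :=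
        mul_le_mul h1 h2 (h0 _ (E.add_mem hx hy)) (by positivity)
    _ = _ := by ring

theorem tendsto_sub_of_parallelogram {E : AddSubgroup V} {φ : V → ℝ} {g : ℝ}
    (hpar : ∀ x ∈ E, ∀ y ∈ E, φ (x + y) + φ (x - y) = 2 * (φ x + φ y))
    (h0 : ∀ x ∈ E, 0 ≤ φ x) (hg : ∀ x ∈ E, φ x ≤ g * ‖x‖ ^ 2) {x : V} {u v : ℕ → V}
    (hu : ∀ n, u n ∈ E) (hv : ∀ n, v n ∈ E) (hux : Tendsto u atTop (𝓝 x))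
    (hvx : Tendsto v atTop (𝓝 x)) : Tendsto (fun n => φ (u n) - φ (v n)) atTop (𝓝 0) := by
  refine squeeze_zero_norm (a := fun n => |g| * (‖u n - v n‖ * ‖u n + v n‖)) (fun n => ?_) ?_
  · exact abs_sub_le_of_parallelogram hpar h0 hg (hu n) (hv n)
  · have h := ((hux.sub hvx).norm.mul (hux.add hvx).norm).const_mul |g|
    simpa using h

/-- Extension by continuity of a bounded nonnegative quadratic form, defined on a dense subgroup,
to a continuous bilinear form. -/
theorem exists_bilin_of_parallelogram [NormedSpace ℝ V] {E : AddSubgroup V} {φ : V → ℝ} {g : ℝ}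
    (hg0 : 0 ≤ g)
    (hpar : ∀ x ∈ E, ∀ y ∈ E, φ (x + y) + φ (x - y) = 2 * (φ x + φ y))
    (h0 : ∀ x ∈ E, 0 ≤ φ x) (hg : ∀ x ∈ E, φ x ≤ g * ‖x‖ ^ 2) {a : V → ℕ → V}
    (haE : ∀ x n, a x n ∈ E) (ha : ∀ x, Tendsto (a x) atTop (𝓝 x)) :
    ∃ B : V →L[ℝ] V →L[ℝ] ℝ,
      (∀ x y, Tendsto (fun n => (φ (a (x + y) n) - φ (a (x - y) n)) / 4) atTop (𝓝 (B x y))) ∧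
      (∀ x y, B x y = B y x) ∧ (∀ x, 0 ≤ B x x) ∧ (∀ x ∈ E, B x x = φ x) ∧ ‖B‖ ≤ g := by
  have hlim : ∀ x, ∃ l, Tendsto (fun n => φ (a x n)) atTop (𝓝 l) := by
    intro x
    refine cauchySeq_tendsto_of_complete (cauchySeq_iff_tendsto_dist_atTop_0.2 ?_)
    refine squeeze_zero (g := fun p : ℕ × ℕ => |g| * (‖a x p.1 - a x p.2‖ * ‖a x p.1 + a x p.2‖))
      (fun _ => dist_nonneg) (fun p => ?_) ?_
    · exact abs_sub_le_of_parallelogram hpar h0 hg (haE x _) (haE x _)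
    · have h1 : Tendsto (fun p : ℕ × ℕ => a x p.1) atTop (𝓝 x) :=
        (ha x).comp (prod_atTop_atTop_eq (α := ℕ) (β := ℕ) ▸ tendsto_fst)
      have h2 : Tendsto (fun p : ℕ × ℕ => a x p.2) atTop (𝓝 x) :=
        (ha x).comp (prod_atTop_atTop_eq (α := ℕ) (β := ℕ) ▸ tendsto_snd)
      simpa using ((h1.sub h2).norm.mul (h1.add h2).norm).const_mul |g|
  choose L hL using hlim
  -- The limit does not depend on the approximating sequence, so $a(x)\pm a(y)$ may be used for
  -- $x\pm y$ and the parallelogram law survives.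
  have hLu : ∀ x (u : ℕ → V), (∀ n, u n ∈ E) → Tendsto u atTop (𝓝 x) →
      Tendsto (fun n => φ (u n)) atTop (𝓝 (L x)) := by
    intro x u hu hux
    have := (tendsto_sub_of_parallelogram hpar h0 hg hu (haE x) hux (ha x)).add (hL x)
    simpa using this
  have hLpar : ∀ x y, L (x + y) + L (x - y) = 2 * (L x + L y) := by
    intro x y
    have e1 := hLu (x + y) (fun n => a x n + a y n) (fun n => E.add_mem (haE _ _) (haE _ _))
      ((ha x).add (ha y))
    have e2 := hLu (x - y) (fun n => a x n - a y n) (fun n => E.sub_mem (haE _ _) (haE _ _))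
      ((ha x).sub (ha y))
    refine tendsto_nhds_unique (e1.add e2) ?_
    simp only [hpar _ (haE x _) _ (haE y _)]
    exact ((hL x).add (hL y)).const_mul 2
  have hL0 : ∀ x, 0 ≤ L x := fun x => ge_of_tendsto' (hL x) fun n => h0 _ (haE x n)
  have hLg : ∀ x, L x ≤ g * ‖x‖ ^ 2 := fun x =>
    le_of_tendsto_of_tendsto' (hL x) (((ha x).norm.pow 2).const_mul g) fun n => hg _ (haE x n)
  have hLE : ∀ x ∈ E, L x = φ x := fun x hx =>
    tendsto_nhds_unique (hLu x (fun _ => x) (fun _ => hx) tendsto_const_nhds) tendsto_const_nhds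
  obtain ⟨b, hb, hbd, hs⟩ := exists_biadditive_of_parallelogram hLpar
  have hbound : ∀ x y, ‖b x y‖ ≤ g * ‖x‖ * ‖y‖ := by
    intro x y
    have hcs := sq_biadditive_le b hs (fun z => (hbd z).symm ▸ hL0 z) x y
    rw [hbd, hbd] at hcs
    rw [Real.norm_eq_abs]
    refine abs_le_of_sq_le_sq (hcs.trans ?_) (by positivity)
    calc L x * L y ≤ (g * ‖x‖ ^ 2) * (g * ‖y‖ ^ 2) :=
          mul_le_mul (hLg x) (hLg y) (hL0 y) (by positivity)
      _ = _ := by ring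
  have hcont : ∀ x, Continuous (b x) := fun x =>
    AddMonoidHomClass.continuous_of_bound (b x) (g * ‖x‖) fun y => hbound x y
  -- Additivity and continuity together imply real homogeneity.
  have hsmul : ∀ (c : ℝ) x y, b x (c • y) = c * b x y := fun c x y =>
    map_real_smul (b x) (hcont x) c y
  obtain ⟨B, hB, hBn⟩ : ∃ B : V →L[ℝ] V →L[ℝ] ℝ, (∀ x y, B x y = b x y) ∧ ‖B‖ ≤ g :=
    ⟨LinearMap.mkContinuous₂ (LinearMap.mk₂ ℝ (fun x y => b x y) (fun x y z => by simp)
      (fun c x y => by rw [hs, hsmul, hs, smul_eq_mul]) (fun x y z => by simp)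
      (fun c x y => hsmul c x y)) g hbound, fun _ _ => rfl, LinearMap.mkContinuous₂_norm_le _ hg0 _⟩
  refine ⟨B, fun x y => ?_, fun x y => by rw [hB, hB, hs], fun x => ?_, fun x hx => ?_, hBn⟩
  · rw [hB, hb]
    exact ((hL _).sub (hL _)).div_const 4
  · rw [hB, hbd]
    exact hL0 x
  · rw [hB, hbd, hLE x hx]

end QuadraticForms

end CylMVM

namespace CylMVM

open ProbabilityTheory

/-! ### Countable subgroups and suprema of densities. -/

section Auxiliary

/-- The integer combinations suffice: the parallelogram identity involves only sums and differences,
and countability keeps all exceptional events in one null set. -/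
theorem exists_countable_addSubgroup {V : Type*} [AddCommGroup V] {s : Set V} (hs : s.Countable) :
    ∃ E : AddSubgroup V, s ⊆ E ∧ (E : Set V).Countable := by
  have := hs.to_subtype
  refine ⟨(Finsupp.liftAddHom fun i : s => zmultiplesHom V (i : V)).range, fun x hx => ?_, ?_⟩
  · exact ⟨Finsupp.single ⟨x, hx⟩ 1, by simp⟩
  · rw [AddMonoidHom.coe_range]
    exact countable_range _

variable {α : Type*} {mα : MeasurableSpace α}

/-- Split each set according to which of the two densities is larger. -/
theorem withDensity_sup_le {μ ν : Measure α} {h k : α → ℝ≥0∞} (hm : Measurable h)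
    (km : Measurable k) (hh : μ.withDensity h ≤ ν) (hk : μ.withDensity k ≤ ν) :
    μ.withDensity (h ⊔ k) ≤ ν := by
  refine Measure.le_iff.2 fun C hC => ?_
  have hB : MeasurableSet {a | k a ≤ h a} := measurableSet_le km hm
  rw [← measure_inter_add_sdiff C hB, withDensity_apply _ (hC.inter hB)] at *
  rw [← measure_inter_add_sdiff C hB, withDensity_apply _ (hC.diff hB)]
  refine add_le_add ?_ ?_
  · refine le_trans (le_of_eq ?_) (hh (C ∩ {a | k a ≤ h a}))
    rw [withDensity_apply _ (hC.inter hB)]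
    refine setLIntegral_congr_fun (hC.inter hB) fun a ha => ?_
    exact sup_eq_left.2 ha.2
  · refine le_trans (le_of_eq ?_) (hk (C \ {a | k a ≤ h a}))
    rw [withDensity_apply _ (hC.diff hB)]
    refine setLIntegral_congr_fun (hC.diff hB) fun a ha => ?_
    exact sup_eq_right.2 (le_of_lt (not_le.1 ha.2))

/-- Finite suprema by induction, then monotone convergence along partial suprema. -/
theorem withDensity_iSup_le {μ ν : Measure α} {h : ℕ → α → ℝ≥0∞} (hm : ∀ n, Measurable (h n))
    (hh : ∀ n, μ.withDensity (h n) ≤ ν) : μ.withDensity (⨆ n, h n) ≤ ν := by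
  have hp : ∀ n, Measurable (partialSups h n) ∧ μ.withDensity (partialSups h n) ≤ ν := by
    intro n
    induction n with
    | zero => simpa using ⟨hm 0, hh 0⟩
    | succ n ih =>
      rw [partialSups_add_one]
      exact ⟨ih.1.sup (hm _), withDensity_sup_le ih.1 (hm _) ih.2 (hh _)⟩
  refine Measure.le_iff.2 fun C hC => ?_
  rw [withDensity_apply _ hC, ← iSup_partialSups_eq]
  simp only [iSup_apply]
  rw [lintegral_iSup (fun n => (hp n).1) fun i j hij a => (partialSups h).mono hij a]
  refine iSup_le fun n => ?_
  rw [← withDensity_apply _ hC]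
  exact (hp n).2 C

end Auxiliary

end CylMVM

namespace CylMVM

open ProbabilityTheory

/-! ### Quadratic families of random measures and normalized bilinear forms. -/

section QuadraticFamily

variable {Ω U : Type*} {mΩ : MeasurableSpace Ω} {𝓕 : Filtration ℝ≥0 mΩ} {P : Measure Ω}
  [MeasurableSpace U] {V : Type*} [NormedAddCommGroup V]

/-- Families of finite predictable random measures depending quadratically on a vector, and
bounded by `‖x‖² η`. -/
structure IsQuadraticFamily (𝓕 : Filtration ℝ≥0 mΩ) (P : Measure Ω) (S : ℕ → Set U)
    (η : Kernel Ω (ℝ≥0 × U)) (κ : V → Kernel Ω (ℝ≥0 × U)) : Prop where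
  finite : ∀ x ω, κ x ω univ < ∞
  predictable : ∀ x A, MeasurableSet A →
    Measurable fun z : Pred 𝓕 => κ x z.point (Iic z.time ×ˢ A)
  mean : ∀ x k, ∫⁻ ω, κ x ω (univ ×ˢ S k) ∂P ≠ ∞
  finite_bound : ∀ᵐ ω ∂P, η ω univ < ∞
  le : ∀ x, ∀ᵐ ω ∂P, κ x ω ≤ (‖x‖₊ ^ 2 : ℝ≥0) • η ω
  parallelogram : ∀ x y, ∀ᵐ ω ∂P,
    κ (x + y) ω + κ (x - y) ω = (κ x ω + κ y ω) + (κ x ω + κ y ω)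

variable {S : ℕ → Set U} {η : Kernel Ω (ℝ≥0 × U)} {κ : V → Kernel Ω (ℝ≥0 × U)}

/-- Outside a null set depending on $x$ and $u$, the quadratic identities hold on the countable
subgroup generated by $x$ and the $u_n$, where a bounded quadratic form is continuous. -/
theorem IsQuadraticFamily.tendsto (h : IsQuadraticFamily 𝓕 P S η κ) {x : V} {u : ℕ → V}
    (hu : Tendsto u atTop (𝓝 x)) :
    ∀ᵐ ω ∂P, ∀ C, Tendsto (fun n => κ (u n) ω C) atTop (𝓝 (κ x ω C)) := by
  obtain ⟨E, hE, hEc⟩ := exists_countable_addSubgroup ((countable_range u).insert x)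
  have huE : ∀ n, u n ∈ E := fun n => hE (mem_insert_of_mem _ (mem_range_self n))
  have hxE : x ∈ E := hE (mem_insert _ _)
  have hp : ∀ᵐ ω ∂P, ∀ y ∈ (E : Set V), ∀ z ∈ (E : Set V),
      κ (y + z) ω + κ (y - z) ω = (κ y ω + κ z ω) + (κ y ω + κ z ω) :=
    (ae_ball_iff hEc).2 fun y _ => (ae_ball_iff hEc).2 fun z _ => h.parallelogram y z
  have hl : ∀ᵐ ω ∂P, ∀ y ∈ (E : Set V), κ y ω ≤ (‖y‖₊ ^ 2 : ℝ≥0) • η ω :=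
    (ae_ball_iff hEc).2 fun y _ => h.le y
  filter_upwards [hp, hl, h.finite_bound] with ω h1 h2 h3 C
  have hf : ∀ y, κ y ω C ≠ ∞ := fun y =>
    ne_top_of_le_ne_top (h.finite y ω).ne (measure_mono (subset_univ C))
  have hηf : η ω C ≠ ∞ := ne_top_of_le_ne_top h3.ne (measure_mono (subset_univ C))
  have key := tendsto_sub_of_parallelogram (E := E) (φ := fun y => (κ y ω C).toReal)
    (g := (η ω C).toReal) (fun y hy z hz => ?_) (fun y _ => ENNReal.toReal_nonneg)
    (fun y hy => ?_) huE (fun _ => hxE) hu tendsto_const_nhds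
  · have := key.add_const ((κ x ω C).toReal)
    simp only [sub_add_cancel, zero_add] at this
    have h4 := (ENNReal.continuous_ofReal.tendsto _).comp this
    rw [ENNReal.ofReal_toReal (hf x)] at h4
    refine h4.congr fun n => ?_
    rw [Function.comp_apply, ENNReal.ofReal_toReal (hf _)]
  · have := congrArg (fun μ => (μ C).toReal) (h1 y hy z hz)
    simp only [Measure.add_apply] at this
    rw [ENNReal.toReal_add (hf _) (hf _), ENNReal.toReal_add (by simp [hf]) (by simp [hf]),
      ENNReal.toReal_add (hf _) (hf _)] at this
    rw [this, two_mul]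
  · have := ENNReal.toReal_mono (ENNReal.mul_ne_top (by simp) hηf) (h2 y hy C)
    simpa [ENNReal.toReal_mul, mul_comm] using this

/-- The parts of the conclusion which concern a single point: `B` is the normalized form with
values `f x / g`. -/
theorem exists_normalized_bilin [NormedSpace ℝ V] {E : AddSubgroup V} {f : V → ℝ≥0∞} {g : ℝ≥0∞}
    (hg0 : g ≠ 0) (hg : g ≠ ∞)
    (hpar : ∀ x ∈ E, ∀ y ∈ E, f (x + y) + f (x - y) = (f x + f y) + (f x + f y))
    (hfg : ∀ x ∈ E, f x ≤ (‖x‖₊ ^ 2 : ℝ≥0) * g)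
    (hsup : ∀ c : ℝ≥0∞, (∀ x ∈ E, f x ≤ (‖x‖₊ ^ 2 : ℝ≥0) * c) → g ≤ c) {a : V → ℕ → V}
    (haE : ∀ x n, a x n ∈ E) (ha : ∀ x, Tendsto (a x) atTop (𝓝 x)) :
    ∃ B : V →L[ℝ] V →L[ℝ] ℝ,
      (∀ x y, Tendsto (fun n => ((f (a (x + y) n) / g).toReal - (f (a (x - y) n) / g).toReal) / 4)
        atTop (𝓝 (B x y))) ∧
      (∀ x y, B x y = B y x) ∧ (∀ x, 0 ≤ B x x) ∧
      (∀ x ∈ E, ENNReal.ofReal (B x x) = f x / g) ∧ ‖B‖ = 1 := by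
  have hf : ∀ x ∈ E, f x ≠ ∞ := fun x hx =>
    ne_top_of_le_ne_top (ENNReal.mul_ne_top (by simp) hg) (hfg x hx)
  have hff : ∀ x ∈ E, f x / g ≠ ∞ := fun x hx => ENNReal.div_ne_top (hf x hx) hg0
  have hp : ∀ x ∈ E, ∀ y ∈ E, (f (x + y) / g).toReal + (f (x - y) / g).toReal =
      2 * ((f x / g).toReal + (f y / g).toReal) := by
    intro x hx y hy
    have := congrArg (fun r => (r / g).toReal) (hpar x hx y hy)
    simp only [ENNReal.add_div] at this
    have hx' := hff x hx
    have hy' := hff y hy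
    rw [ENNReal.toReal_add (hff _ (E.add_mem hx hy)) (hff _ (E.sub_mem hx hy)),
      ENNReal.toReal_add (by simp [hx', hy']) (by simp [hx', hy']),
      ENNReal.toReal_add hx' hy'] at this
    rw [this, two_mul]
  have hb : ∀ x ∈ E, (f x / g).toReal ≤ 1 * ‖x‖ ^ 2 := by
    intro x hx
    have : f x / g ≤ (‖x‖₊ ^ 2 : ℝ≥0) := ENNReal.div_le_of_le_mul (hfg x hx)
    have := ENNReal.toReal_mono (by simp) this
    simpa using this
  obtain ⟨B, h1, h2, h3, h4, h5⟩ := exists_bilin_of_parallelogram (E := E)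
    (φ := fun x => (f x / g).toReal) (g := 1) zero_le_one hp
    (fun x _ => ENNReal.toReal_nonneg) hb haE ha
  have h4' : ∀ x ∈ E, ENNReal.ofReal (B x x) = f x / g := fun x hx => by
    rw [h4 x hx, ENNReal.ofReal_toReal (hff x hx)]
  refine ⟨B, h1, h2, h3, h4', le_antisymm h5 ?_⟩
  -- The number $\|B\|g$ is admissible in the definition of the supremum $g$, so $g\le\|B\|g$ and
  -- $\|B\|\ge1$.
  have hle := hsup (ENNReal.ofReal ‖B‖ * g) fun x hx => ?_
  · have : 1 * g ≤ ENNReal.ofReal ‖B‖ * g := by rwa [one_mul]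
    rw [ENNReal.mul_le_mul_iff_left hg0 hg] at this
    exact ENNReal.one_le_ofReal.1 this
  · have e : f x = ENNReal.ofReal (B x x) * g := by
      rw [h4' x hx, ENNReal.div_mul_cancel hg0 hg]
    rw [e, ← mul_assoc]
    gcongr
    have hb : B x x ≤ ‖x‖ ^ 2 * ‖B‖ := by
      have := (le_abs_self _).trans (B.le_opNorm₂ x x)
      nlinarith
    refine (ENNReal.ofReal_le_ofReal hb).trans (le_of_eq ?_)
    rw [ENNReal.ofReal_mul (sq_nonneg _), ← coe_nnnorm, ← NNReal.coe_pow,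
      ENNReal.ofReal_coe_nnreal]

end QuadraticFamily

end CylMVM

namespace CylMVM

open ProbabilityTheory

/-! ### The predictable field of bilinear forms. -/

section QuadraticDensity

variable {Ω U : Type*} {mΩ : MeasurableSpace Ω} {𝓕 : Filtration ℝ≥0 mΩ} {P : Measure Ω}
  [MeasurableSpace U] {V : Type*} [NormedAddCommGroup V]
  {S : ℕ → Set U} {η : Kernel Ω (ℝ≥0 × U)} {κ : V → Kernel Ω (ℝ≥0 × U)}

/-- The supremum of the normalized values `f x / ‖x‖²` over a sequence of vectors. -/
noncomputable def supRatio {Z : Type*} (e : ℕ → V) (f : V → Z → ℝ≥0∞) : Z → ℝ≥0∞ :=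
  ⨆ n, fun z => (((‖e n‖₊ ^ 2)⁻¹ : ℝ≥0) : ℝ≥0∞) * f (e n) z

theorem measurable_supRatio {Z : Type*} [MeasurableSpace Z] {e : ℕ → V} {f : V → Z → ℝ≥0∞}
    (hf : ∀ x, Measurable (f x)) : Measurable (supRatio e f) := by
  have := Measurable.iSup fun n => (hf (e n)).const_mul (((‖e n‖₊ ^ 2)⁻¹ : ℝ≥0) : ℝ≥0∞)
  convert this using 1
  ext z
  simp [supRatio]

/-- A zero vector contributes nothing to the supremum because `0⁻¹ = 0`; the assumption $f_0=0$
covers that case. -/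
theorem le_supRatio {Z : Type*} {e : ℕ → V} {f : V → Z → ℝ≥0∞} {z : Z} (h0 : f 0 z = 0) (n : ℕ) :
    f (e n) z ≤ (‖e n‖₊ ^ 2 : ℝ≥0) * supRatio e f z := by
  rcases eq_or_ne (e n) 0 with h | h
  · simp [h, h0]
  · have hne : (‖e n‖₊ ^ 2 : ℝ≥0) ≠ 0 := pow_ne_zero 2 (nnnorm_ne_zero_iff.2 h)
    calc f (e n) z = (‖e n‖₊ ^ 2 : ℝ≥0) * ((((‖e n‖₊ ^ 2)⁻¹ : ℝ≥0) : ℝ≥0∞) * f (e n) z) := by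
          rw [← mul_assoc, ← ENNReal.coe_mul, mul_inv_cancel₀ hne, ENNReal.coe_one, one_mul]
      _ ≤ _ := by
          gcongr
          rw [supRatio, iSup_apply]
          exact le_iSup (fun n => (((‖e n‖₊ ^ 2)⁻¹ : ℝ≥0) : ℝ≥0∞) * f (e n) z) n

theorem inv_coe_mul_coe_le_one (r : ℝ≥0) : ((r⁻¹ : ℝ≥0) : ℝ≥0∞) * (r : ℝ≥0∞) ≤ 1 := by
  rw [← ENNReal.coe_mul]
  rcases eq_or_ne r 0 with h | h
  · simp [h]
  · rw [inv_mul_cancel₀ h, ENNReal.coe_one]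

theorem supRatio_le {Z : Type*} {e : ℕ → V} {f : V → Z → ℝ≥0∞} {z : Z} {c : ℝ≥0∞}
    (h : ∀ n, f (e n) z ≤ (‖e n‖₊ ^ 2 : ℝ≥0) * c) : supRatio e f z ≤ c := by
  rw [supRatio, iSup_apply]
  refine iSup_le fun n => ?_
  calc (((‖e n‖₊ ^ 2)⁻¹ : ℝ≥0) : ℝ≥0∞) * f (e n) z
      ≤ (((‖e n‖₊ ^ 2)⁻¹ : ℝ≥0) : ℝ≥0∞) * ((‖e n‖₊ ^ 2 : ℝ≥0) * c) := by gcongr; exact h n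
    _ = ((((‖e n‖₊ ^ 2)⁻¹ : ℝ≥0) : ℝ≥0∞) * (‖e n‖₊ ^ 2 : ℝ≥0)) * c := by rw [mul_assoc]
    _ ≤ 1 * c := by gcongr; exact inv_coe_mul_coe_le_one _
    _ = c := one_mul c

/-- The points at which the densities `f x` form a quadratic form with positive finite norm. -/
def goodSet {Z : Type*} (e : ℕ → V) (f : V → Z → ℝ≥0∞) : Set Z :=
  {z | (supRatio e f z ≠ 0 ∧ supRatio e f z ≠ ∞) ∧ f 0 z = 0 ∧ ∀ m n,
    f (e m + e n) z + f (e m - e n) z = (f (e m) z + f (e n) z) + (f (e m) z + f (e n) z)}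

theorem measurableSet_goodSet {Z : Type*} [MeasurableSpace Z] {e : ℕ → V} {f : V → Z → ℝ≥0∞}
    (hf : ∀ x, Measurable (f x)) : MeasurableSet (goodSet e f) := by
  have hg := measurable_supRatio (e := e) hf
  refine ((hg (measurableSet_singleton 0).compl).inter
    (hg (measurableSet_singleton ∞).compl)).inter ((hf 0 (measurableSet_singleton 0)).inter ?_)
  have : {z | ∀ m n, f (e m + e n) z + f (e m - e n) z =
      (f (e m) z + f (e n) z) + (f (e m) z + f (e n) z)} = ⋂ m, ⋂ n,
      {z | f (e m + e n) z + f (e m - e n) z =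
        (f (e m) z + f (e n) z) + (f (e m) z + f (e n) z)} := by
    ext; simp
  change MeasurableSet {z | ∀ m n, f (e m + e n) z + f (e m - e n) z =
      (f (e m) z + f (e n) z) + (f (e m) z + f (e n) z)}
  rw [this]
  exact MeasurableSet.iInter fun m => MeasurableSet.iInter fun n =>
    measurableSet_eq_fun ((hf _).add (hf _)) (((hf _).add (hf _)).add ((hf _).add (hf _)))

/-- A measurable choice of normalized bilinear forms. -/
theorem exists_measurable_normalized_bilin [NormedSpace ℝ V] {Z : Type*} [MeasurableSpace Z]
    {E : AddSubgroup V} {e : ℕ → V} (he : range e = (E : Set V)) {f : V → Z → ℝ≥0∞}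
    (hf : ∀ x, Measurable (f x)) {a : V → ℕ → V}
    (haE : ∀ x n, a x n ∈ E) (ha : ∀ x, Tendsto (a x) atTop (𝓝 x)) :
    ∃ Q : Z → V →L[ℝ] V →L[ℝ] ℝ, (∀ x y, Measurable fun z => Q z x y) ∧
      (∀ z x y, Q z x y = Q z y x) ∧ (∀ z x, 0 ≤ Q z x x) ∧ (∀ z, ‖Q z‖ ≤ 1) ∧
      (∀ z ∈ goodSet e f, ‖Q z‖ = 1) ∧
      ∀ z ∈ goodSet e f, ∀ x ∈ E, ENNReal.ofReal (Q z x x) = f x z / supRatio e f z := by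
  have heE : ∀ n, e n ∈ E := fun n => he.subset (mem_range_self n)
  have hE : ∀ x ∈ E, ∃ n, e n = x := fun x hx => he.superset hx
  -- The form is chosen as zero off the good set. Recording it as a limit of explicit measurable
  -- functions makes the pointwise choice measurable.
  have key : ∀ z, ∃ B : V →L[ℝ] V →L[ℝ] ℝ,
      (∀ x y, Tendsto (fun n => (goodSet e f).indicator (fun z =>
        ((f (a (x + y) n) z / supRatio e f z).toReal -
          (f (a (x - y) n) z / supRatio e f z).toReal) / 4) z) atTop (𝓝 (B x y))) ∧
      (∀ x y, B x y = B y x) ∧ (∀ x, 0 ≤ B x x) ∧ ‖B‖ ≤ 1 ∧ (z ∈ goodSet e f → ‖B‖ = 1) ∧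
      (z ∈ goodSet e f → ∀ x ∈ E, ENNReal.ofReal (B x x) = f x z / supRatio e f z) := by
    intro z
    by_cases hz : z ∈ goodSet e f
    · have hpar : ∀ x ∈ E, ∀ y ∈ E,
          f (x + y) z + f (x - y) z = (f x z + f y z) + (f x z + f y z) := by
        intro x hx y hy
        obtain ⟨m, rfl⟩ := hE x hx
        obtain ⟨n, rfl⟩ := hE y hy
        exact hz.2.2 m n
      have hle : ∀ x ∈ E, f x z ≤ (‖x‖₊ ^ 2 : ℝ≥0) * supRatio e f z := by
        intro x hx
        obtain ⟨n, rfl⟩ := hE x hx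
        exact le_supRatio hz.2.1 n
      obtain ⟨B, h1, h2, h3, h4, h5⟩ := exists_normalized_bilin (E := E) (f := fun x => f x z)
        hz.1.1 hz.1.2 hpar hle (fun c hc => supRatio_le fun n => hc _ (heE n)) haE ha
      refine ⟨B, fun x y => ?_, h2, h3, h5.le, fun _ => h5, fun _ => h4⟩
      simpa only [indicator_of_mem hz] using h1 x y
    · refine ⟨0, fun x y => ?_, fun x y => rfl, fun x => le_rfl, by simp, fun h => absurd h hz,
        fun h => absurd h hz⟩
      simp only [indicator_of_notMem hz]
      exact tendsto_const_nhds
  choose Q h1 h2 h3 h4 h5 h6 using key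
  refine ⟨Q, fun x y => ?_, h2, h3, h4, h5, h6⟩
  refine measurable_of_tendsto_metrizable (f := fun n => (goodSet e f).indicator (fun z =>
        ((f (a (x + y) n) z / supRatio e f z).toReal -
          (f (a (x - y) n) z / supRatio e f z).toReal) / 4)) (fun n => ?_)
    (tendsto_pi_nhds.2 fun z => h1 z x y)
  have hg := measurable_supRatio (e := e) hf
  exact ((((hf _).div hg).ennreal_toReal.sub ((hf _).div hg).ennreal_toReal).div_const 4).indicator
    (measurableSet_goodSet hf)

/-- Passage to the limit in the density of a bounded quadratic family. -/
theorem tendsto_withDensity_bilin [NormedSpace ℝ V] {α : Type*} {mα : MeasurableSpace α}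
    {μ : Measure α} (hμ : μ univ < ∞) {q : α → V →L[ℝ] V →L[ℝ] ℝ}
    (hq : ∀ x y, Measurable fun p => q p x y) (hb : ∀ p, ‖q p‖ ≤ 1) {x : V} {u : ℕ → V}
    (hu : Tendsto u atTop (𝓝 x)) {C : Set α} (hC : MeasurableSet C) :
    Tendsto (fun n => μ.withDensity (fun p => ENNReal.ofReal (q p (u n) (u n))) C) atTop
      (𝓝 (μ.withDensity (fun p => ENNReal.ofReal (q p x x)) C)) := by
  obtain ⟨R, hR⟩ := (Metric.isBounded_range_of_tendsto u hu).exists_norm_le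
  have hR' : ∀ n, ‖u n‖ ≤ R := fun n => hR _ (mem_range_self n)
  simp only [withDensity_apply _ hC]
  refine tendsto_lintegral_of_dominated_convergence (fun _ => ENNReal.ofReal (R * R))
    (fun n => (hq _ _).ennreal_ofReal) (fun n => ae_of_all _ fun p => ?_) ?_
    (ae_of_all _ fun p => ?_)
  · refine ENNReal.ofReal_le_ofReal ?_
    have h1 := (le_abs_self _).trans ((q p).le_opNorm₂ (u n) (u n))
    refine h1.trans ?_
    have h0 := norm_nonneg (u n)
    calc ‖q p‖ * ‖u n‖ * ‖u n‖ ≤ 1 * R * R := by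
          gcongr
          · linarith [hR' n]
          · exact hb p
          · exact hR' n
          · exact hR' n
      _ = R * R := by ring
  · rw [lintegral_const, Measure.restrict_apply_univ]
    exact ENNReal.mul_ne_top ENNReal.ofReal_ne_top
      (ne_top_of_le_ne_top hμ.ne (measure_mono (subset_univ C)))
  · refine (ENNReal.continuous_ofReal.tendsto _).comp ?_
    have h1 : Continuous fun v => q p v v := (q p).continuous.clm_apply continuous_id
    exact (h1.tendsto x).comp hu

/-- Predictable densities of a quadratic family with respect to a minimal bound. -/
theorem IsQuadraticFamily.exists_density [SFinite P] [MeasurableSpace.CountablyGenerated U]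
    [NormedSpace ℝ V] [TopologicalSpace.SeparableSpace V]
    (h𝓕 : ∀ s : Set Ω, P s = 0 → MeasurableSet[𝓕 0] s)
    (hS : ⋃ k, S k = univ) (hSm : ∀ k, MeasurableSet (S k)) (h : IsQuadraticFamily 𝓕 P S η κ)
    (hmin : ∀ ζ : Kernel Ω (ℝ≥0 × U), (∀ x, ‖x‖ = 1 → ∀ᵐ ω ∂P, κ x ω ≤ ζ ω) →
      (∀ᵐ ω ∂P, ζ ω ≤ η ω) → ∀ᵐ ω ∂P, η ω ≤ ζ ω) :
    ∃ Q : Pred 𝓕 × U → V →L[ℝ] V →L[ℝ] ℝ, (∀ x y, Measurable fun z => Q z x y) ∧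
      (∀ z x y, Q z x y = Q z y x) ∧ (∀ z x, 0 ≤ Q z x x) ∧ (∀ z, ‖Q z‖ ≤ 1) ∧
      (∀ᵐ ω ∂P, ∀ᵐ p ∂(η ω), ‖Q (⟨p.1, ω⟩, p.2)‖ = 1) ∧
      ∀ x, ∀ᵐ ω ∂P,
        κ x ω = (η ω).withDensity fun p => ENNReal.ofReal (Q (⟨p.1, ω⟩, p.2) x x) := by
  obtain ⟨E, hdE, hEc⟩ :=
    exists_countable_addSubgroup (countable_range (TopologicalSpace.denseSeq V))
  obtain ⟨e, he⟩ := hEc.exists_eq_range ⟨0, E.zero_mem⟩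
  have hE : ∀ x ∈ E, ∃ n, e n = x := fun x hx => he.subset hx
  have heE : ∀ n, e n ∈ E := fun n => he.superset (mem_range_self n)
  have hdense : ∀ x : V, ∃ u : ℕ → V, (∀ n, u n ∈ E) ∧ Tendsto u atTop (𝓝 x) := fun x =>
    mem_closure_iff_seq_limit.1 (closure_mono hdE (TopologicalSpace.denseRange_denseSeq V x))
  choose a haE ha using hdense
  have hrm : ∀ x, IsPredictableRM 𝓕 P S (κ x) := fun x => ⟨h.predictable x, fun T k =>
    ne_top_of_le_ne_top (h.mean x k) (lintegral_mono fun ω =>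
      measure_mono (prod_mono (subset_univ _) subset_rfl))⟩
  -- Since $\eta$ is not known to be predictable, densities are first taken with respect to a
  -- predictable $L$.
  obtain ⟨L, hLf, hLp, hLm, hLac, -⟩ := exists_dominating_rm (P := P) h𝓕 hS hSm
    (fun n => κ (e n)) (fun n => h.predictable _) (fun n => h.mean _)
  have sL := isSFiniteKernel_of_isFiniteMeasure L hLf
  have hfex : ∀ x, ∃ f : Pred 𝓕 × U → ℝ≥0∞, Measurable f ∧ (x ∈ E →
      ∀ᵐ ω ∂P, κ x ω = (L ω).withDensity fun p => f (⟨p.1, ω⟩, p.2)) := by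
    intro x
    by_cases hx : x ∈ E
    · obtain ⟨n, rfl⟩ := hE x hx
      obtain ⟨f, hf, hfe⟩ := exists_predictable_density h𝓕 hS hSm (hrm (e n)) (h.finite (e n))
        hLp hLf hLm (hLac.mono fun ω hω => hω n)
      exact ⟨f, hf, fun _ => hfe⟩
    · exact ⟨0, measurable_const, fun h => absurd h hx⟩
  choose f hf hfe using hfex
  set g := supRatio e f with hgdef
  have hg : Measurable g := measurable_supRatio hf
  obtain ⟨Q, hQm, hQs, hQp, hQ1, hQn, hQd⟩ :=
    exists_measurable_normalized_bilin (E := E) he.symm hf haE ha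
  -- pathwise consequences for all vectors of the countable subgroup
  have hfe' : ∀ᵐ ω ∂P, ∀ x ∈ (E : Set V),
      κ x ω = (L ω).withDensity fun p => f x (⟨p.1, ω⟩, p.2) :=
    (ae_ball_iff hEc).2 fun x hx => hfe x hx
  have hle' : ∀ᵐ ω ∂P, ∀ x ∈ (E : Set V), κ x ω ≤ (‖x‖₊ ^ 2 : ℝ≥0) • η ω :=
    (ae_ball_iff hEc).2 fun x _ => h.le x
  have hpar' : ∀ᵐ ω ∂P, ∀ x ∈ (E : Set V), ∀ y ∈ (E : Set V),
      κ (x + y) ω + κ (x - y) ω = (κ x ω + κ y ω) + (κ x ω + κ y ω) :=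
    (ae_ball_iff hEc).2 fun x _ => (ae_ball_iff hEc).2 fun y _ => h.parallelogram x y
  have hsec : ∀ x (ω : Ω), Measurable fun p : ℝ≥0 × U => f x (⟨p.1, ω⟩, p.2) := fun x ω =>
    (hf x).comp (measurable_predMk_right ω)
  have hgsec : ∀ ω : Ω, Measurable fun p : ℝ≥0 × U => g (⟨p.1, ω⟩, p.2) := fun ω =>
    hg.comp (measurable_predMk_right ω)
  have hf0 : ∀ᵐ ω ∂P, ∀ᵐ p ∂(L ω), f 0 (⟨p.1, ω⟩, p.2) = 0 := by
    filter_upwards [hfe', hle'] with ω h1 h2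
    have h3 : κ 0 ω univ = 0 := by
      have := h2 0 E.zero_mem univ
      simpa using this
    rw [h1 0 E.zero_mem, withDensity_apply _ MeasurableSet.univ, setLIntegral_univ,
      lintegral_eq_zero_iff (hsec 0 ω)] at h3
    exact h3
  have hgood : ∀ᵐ ω ∂P, ∀ᵐ p ∂(L ω), ∀ m n,
      f (e m + e n) (⟨p.1, ω⟩, p.2) + f (e m - e n) (⟨p.1, ω⟩, p.2) =
        (f (e m) (⟨p.1, ω⟩, p.2) + f (e n) (⟨p.1, ω⟩, p.2)) +
          (f (e m) (⟨p.1, ω⟩, p.2) + f (e n) (⟨p.1, ω⟩, p.2)) := by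
    filter_upwards [hfe', hpar'] with ω h1 h2
    have hfin : IsFiniteMeasure (L ω) := ⟨hLf ω⟩
    refine ae_all_iff.2 fun m => ae_all_iff.2 fun n => ?_
    have h3 := h2 _ (heE m) _ (heE n)
    rw [h1 _ (E.add_mem (heE m) (heE n)), h1 _ (E.sub_mem (heE m) (heE n)), h1 _ (heE m),
      h1 _ (heE n), ← withDensity_add_left (hsec _ ω), ← withDensity_add_left (hsec _ ω),
      ← withDensity_add_left ((hsec _ ω).add (hsec _ ω))] at h3
    exact (withDensity_eq_iff_of_sigmaFinite ((hsec _ ω).add (hsec _ ω)).aemeasurable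
      (((hsec _ ω).add (hsec _ ω)).add ((hsec _ ω).add (hsec _ ω))).aemeasurable).1 h3
  -- The candidate $gL$ for the least bound of the family.
  let ζ : Kernel Ω (ℝ≥0 × U) := Kernel.withDensity L fun ω p => g (⟨p.1, ω⟩, p.2)
  have hζ : ∀ ω, ζ ω = (L ω).withDensity fun p => g (⟨p.1, ω⟩, p.2) := fun ω =>
    Kernel.withDensity_apply L (measurable_uncurry_section hg) ω
  have hζη : ∀ᵐ ω ∂P, ζ ω ≤ η ω := by
    filter_upwards [hfe', hle'] with ω h1 h2
    rw [hζ]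
    have : (fun p : ℝ≥0 × U => g (⟨p.1, ω⟩, p.2)) = ⨆ n, fun p : ℝ≥0 × U =>
        (((‖e n‖₊ ^ 2)⁻¹ : ℝ≥0) : ℝ≥0∞) * f (e n) (⟨p.1, ω⟩, p.2) := by
      ext p
      simp only [hgdef, supRatio, iSup_apply]
    rw [this]
    refine withDensity_iSup_le (fun n => (hsec _ ω).const_mul _) fun n => ?_
    have e1 : (L ω).withDensity (fun p : ℝ≥0 × U =>
        (((‖e n‖₊ ^ 2)⁻¹ : ℝ≥0) : ℝ≥0∞) * f (e n) (⟨p.1, ω⟩, p.2)) =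
        (((‖e n‖₊ ^ 2)⁻¹ : ℝ≥0) : ℝ≥0∞) • κ (e n) ω := by
      rw [h1 _ (heE n), ← withDensity_smul _ (hsec _ ω)]
      rfl
    rw [e1]
    refine Measure.le_iff.2 fun C hC => ?_
    rw [Measure.smul_apply, smul_eq_mul]
    calc (((‖e n‖₊ ^ 2)⁻¹ : ℝ≥0) : ℝ≥0∞) * κ (e n) ω C
        ≤ (((‖e n‖₊ ^ 2)⁻¹ : ℝ≥0) : ℝ≥0∞) * ((‖e n‖₊ ^ 2 : ℝ≥0) * η ω C) := by
          gcongr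
          exact h2 _ (heE n) C
      _ = ((((‖e n‖₊ ^ 2)⁻¹ : ℝ≥0) : ℝ≥0∞) * (‖e n‖₊ ^ 2 : ℝ≥0)) * η ω C := by rw [mul_assoc]
      _ ≤ 1 * η ω C := by gcongr; exact inv_coe_mul_coe_le_one _
      _ = η ω C := one_mul _
  have hκζ : ∀ᵐ ω ∂P, ∀ x ∈ (E : Set V), κ x ω ≤ (‖x‖₊ ^ 2 : ℝ≥0) • ζ ω := by
    filter_upwards [hfe', hf0] with ω h1 h2 x hx
    obtain ⟨n, rfl⟩ := hE x hx
    refine Measure.le_iff.2 fun C hC => ?_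
    rw [h1 _ hx, Measure.smul_apply, hζ, withDensity_apply _ hC, withDensity_apply _ hC,
      ENNReal.smul_def, smul_eq_mul, ← lintegral_const_mul _ (hgsec ω)]
    refine lintegral_mono_ae (ae_restrict_of_ae ?_)
    filter_upwards [h2] with p hp
    exact le_supRatio hp n
  -- Minimality needs $\kappa_x\le\zeta$ for every unit vector, whereas the bound is known on $E$
  -- only; approximating $x$ from $E$ and continuity of the family close the gap.
  have hηζ : ∀ᵐ ω ∂P, η ω = ζ ω := by
    have := hmin ζ (fun x hx => ?_) hζη
    · filter_upwards [this, hζη] with ω h1 h2 using le_antisymm h1 h2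
    · filter_upwards [hκζ, h.tendsto (ha x), hζη, h.finite_bound] with ω h1 h2 h3 h4
      refine Measure.le_iff.2 fun C hC => ?_
      have hne : ζ ω C ≠ ∞ := ne_top_of_le_ne_top h4.ne
        ((h3 C).trans (measure_mono (subset_univ C)))
      have hlim : Tendsto (fun n => ((‖a x n‖₊ ^ 2 : ℝ≥0) : ℝ≥0∞) * ζ ω C) atTop
          (𝓝 (((‖x‖₊ ^ 2 : ℝ≥0) : ℝ≥0∞) * ζ ω C)) := by
        refine ENNReal.Tendsto.mul_const ?_ (Or.inr hne)
        exact ENNReal.tendsto_coe.2 (((ha x).nnnorm).pow 2)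
      have hx1 : ‖x‖₊ = 1 := by ext; exact hx
      rw [hx1, one_pow, ENNReal.coe_one, one_mul] at hlim
      exact le_of_tendsto_of_tendsto' (h2 C) hlim fun n => h1 _ (haE x n) C
  -- Points with $g=0$ may fail to be good, but they carry no mass of $\eta=gL$.
  have hLgood : ∀ᵐ ω ∂P, ∀ᵐ p ∂(L ω), g (⟨p.1, ω⟩, p.2) = 0 ∨
      ((⟨p.1, ω⟩, p.2) : Pred 𝓕 × U) ∈ goodSet e f := by
    filter_upwards [hf0, hgood, hζη, h.finite_bound] with ω h1 h2 h3 h4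
    have hfin : ∀ᵐ p ∂(L ω), g (⟨p.1, ω⟩, p.2) < ∞ := by
      refine ae_lt_top (hgsec ω) ?_
      rw [← setLIntegral_univ, ← withDensity_apply _ MeasurableSet.univ, ← hζ]
      exact ne_top_of_le_ne_top h4.ne (h3 _)
    filter_upwards [h1, h2, hfin] with p p1 p2 p3
    by_cases hp : g (⟨p.1, ω⟩, p.2) = 0
    · exact Or.inl hp
    · exact Or.inr ⟨⟨hp, p3.ne⟩, p1, p2⟩
  have hdE' : ∀ᵐ ω ∂P, ∀ x ∈ (E : Set V),
      κ x ω = (η ω).withDensity fun p => ENNReal.ofReal (Q (⟨p.1, ω⟩, p.2) x x) := by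
    filter_upwards [hfe', hηζ, hLgood, hf0] with ω h1 h2 h3 h4 x hx
    have hm : Measurable fun p : ℝ≥0 × U => ENNReal.ofReal (Q (⟨p.1, ω⟩, p.2) x x) :=
      ((hQm x x).comp (measurable_predMk_right ω)).ennreal_ofReal
    rw [h2, hζ, h1 x hx, ← withDensity_mul _ (hgsec ω) hm]
    refine withDensity_congr_ae ?_
    filter_upwards [h3, h4] with p p1 p2
    rw [Pi.mul_apply]
    rcases p1 with p1 | p1
    · rw [p1, zero_mul]
      obtain ⟨n, rfl⟩ := hE x hx
      have := le_supRatio (e := e) p2 n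
      rw [← hgdef, p1, mul_zero] at this
      exact le_antisymm this zero_le
    · rw [hQd _ p1 x hx, ENNReal.mul_div_cancel p1.1.1 p1.1.2]
  refine ⟨Q, hQm, hQs, hQp, hQ1, ?_, fun x => ?_⟩
  · filter_upwards [hηζ, hLgood] with ω h1 h2
    rw [h1, hζ, ae_withDensity_iff (hgsec ω)]
    filter_upwards [h2] with p hp hne
    exact hQn _ (hp.resolve_left hne)
  · filter_upwards [hdE', h.tendsto (ha x), h.finite_bound] with ω h1 h2 h3
    -- Both sides are continuous along $a(x)\to x$, the right one by dominated convergence, and they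
    -- agree on $E$.
    refine Measure.ext fun C hC => tendsto_nhds_unique (h2 C) ?_
    have := tendsto_withDensity_bilin h3 (q := fun p : ℝ≥0 × U => Q (⟨p.1, ω⟩, p.2))
      (fun x y => (hQm x y).comp (measurable_predMk_right ω)) (fun p => hQ1 _) (ha x) hC
    refine this.congr fun n => ?_
    rw [h1 _ (haE x n)]

end QuadraticDensity

end CylMVM

namespace CylMVM

open ProbabilityTheory

/-! ### Intensity measures stopped at the horizon. -/

section IntensityFamily

variable {Ω U X : Type*} {mΩ : MeasurableSpace Ω} {P : Measure Ω}
  {𝓕 : Filtration ℝ≥0 mΩ} [MeasurableSpace U] [NormedAddCommGroup X] [NormedSpace ℝ X]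
  {𝒜 : Set (Set U)} {M : ℝ≥0 → Set U → StrongDual ℝ X →ₗ[ℝ] (Ω →ₘ[P] ℝ)}
  {η : Ω → Measure (ℝ≥0 × U)}

/-- Every vector has an intensity measure, bounded by a multiple of the quadratic variation. -/
theorem IsQuadraticVariation.exists_intensity (h𝓕 : ∀ s : Set Ω, P s = 0 → MeasurableSet[𝓕 0] s)
    (hM : IsCylindricalOrthogonalMVM 𝓕 P 𝒜 M) (hη : IsQuadraticVariation 𝓕 P 𝒜 M η)
    (x : StrongDual ℝ X) :
    ∃ ν, IsIntensityMeasure 𝓕 P 𝒜 M x ν ∧ ∀ᵐ ω ∂P, ν ω ≤ (‖x‖₊ ^ 2 : ℝ≥0) • η ω := by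
  rcases eq_or_ne x 0 with rfl | hx
  · exact ⟨_, isIntensityMeasure_zero h𝓕 hM, ae_of_all _ fun ω => Measure.zero_le _⟩
  · have hx' : ‖x‖ ≠ 0 := norm_ne_zero_iff.2 hx
    obtain ⟨ν, hν, hle⟩ := hη.dominates.2 (‖x‖⁻¹ • x) (by
      rw [norm_smul, norm_inv, norm_norm, inv_mul_cancel₀ hx'])
    have h := hν.smul h𝓕 hM ‖x‖₊
    rw [coe_nnnorm, smul_smul, mul_inv_cancel₀ hx', one_smul] at h
    refine ⟨_, h, ?_⟩
    filter_upwards [hle] with ω hω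
    refine Measure.le_iff.2 fun C _ => ?_
    simp only [Measure.smul_apply]
    rw [ENNReal.smul_def, ENNReal.smul_def]
    simp only [smul_eq_mul]
    gcongr

variable {N : StrongDual ℝ X → Ω → Measure (ℝ≥0 × U)}
  (hN : ∀ x, IsIntensityMeasure 𝓕 P 𝒜 M x (N x))

/-- The intensity measures, restricted to `[0, T]`. -/
noncomputable def stoppedIntensity (T : ℝ≥0) (x : StrongDual ℝ X) : Kernel Ω (ℝ≥0 × U) :=
  finiteModification ((hN x).kernel.restrict
    (measurableSet_Iic.prod MeasurableSet.univ : MeasurableSet (Iic T ×ˢ univ)))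

/-- The quadratic variation, restricted to `[0, T]`. -/
noncomputable def stoppedVariation (hη : Measurable η) (T : ℝ≥0) : Kernel Ω (ℝ≥0 × U) :=
  Kernel.restrict ⟨η, hη⟩
    (measurableSet_Iic.prod MeasurableSet.univ : MeasurableSet (Iic T ×ˢ univ))

theorem stoppedVariation_apply (hη : Measurable η) (T : ℝ≥0) (ω : Ω) :
    stoppedVariation hη T ω = (η ω).restrict (Iic T ×ˢ univ) :=
  Kernel.restrict_apply _ _ _

variable (hle : ∀ x, ∀ᵐ ω ∂P, N x ω ≤ (‖x‖₊ ^ 2 : ℝ≥0) • η ω) {T : ℝ≥0}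
  (hfin : ∀ᵐ ω ∂P, η ω (Iic T ×ˢ univ) < ∞)

include hle hfin in
theorem ae_restrict_intensity_lt_top (x : StrongDual ℝ X) :
    ∀ᵐ ω ∂P, (hN x).kernel.restrict
      (measurableSet_Iic.prod MeasurableSet.univ : MeasurableSet (Iic T ×ˢ univ)) ω univ < ∞ := by
  filter_upwards [hle x, hfin] with ω h1 h2
  rw [Kernel.restrict_apply, Measure.restrict_apply_univ, IsIntensityMeasure.kernel_apply]
  refine (h1 _).trans_lt ?_
  rw [Measure.smul_apply, ENNReal.smul_def, smul_eq_mul]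
  exact ENNReal.mul_lt_top ENNReal.coe_lt_top h2

include hle hfin in
theorem stoppedIntensity_ae_eq (x : StrongDual ℝ X) :
    ∀ᵐ ω ∂P, stoppedIntensity hN T x ω = (N x ω).restrict (Iic T ×ˢ univ) := by
  filter_upwards [ae_restrict_intensity_lt_top hN hle hfin x] with ω h1
  rw [stoppedIntensity, finiteModification_of_lt h1, Kernel.restrict_apply,
    IsIntensityMeasure.kernel_apply]

-- Stopping preserves predictability, and the finite modification changes only a null event because
-- $\nu_x\le\|x\|^2\eta$.
include hle hfin in
theorem isQuadraticFamily_stoppedIntensity [IsFiniteMeasure P]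
    [MeasurableSpace.CountablyGenerated U]
    (h𝓕 : ∀ s : Set Ω, P s = 0 → MeasurableSet[𝓕 0] s)
    (hM : IsCylindricalOrthogonalMVM 𝓕 P 𝒜 M) {S : ℕ → Set U} (hS : ⋃ k, S k = univ)
    (hSm : ∀ k, MeasurableSet (S k)) (hS𝒜 : ∀ k B, MeasurableSet B → B ⊆ S k → B ∈ 𝒜)
    (hη : Measurable η) :
    IsQuadraticFamily 𝓕 P S (stoppedVariation hη T) (stoppedIntensity hN T) where
  finite x ω := finiteModification_lt_top _ _
  predictable x A hA := by
    refine measurable_finiteModification h𝓕 (ae_restrict_intensity_lt_top hN hle hfin x) ?_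
    have h := (((hN x).measurable_Iic hA).comp measurable_pred_toProd).comp
      (measurable_pred_stop_const (𝓕 := 𝓕) T)
    convert h using 2 with z
    rw [Kernel.restrict_apply, Measure.restrict_apply (measurableSet_Iic.prod hA),
      IsIntensityMeasure.kernel_apply, prod_inter_prod, inter_univ, Iic_inter_Iic]
    rfl
  mean x k := by
    refine ne_top_of_le_ne_top
      ((hN x).lintegral_Iic_ne_top h𝓕 hM (hS𝒜 k _ (hSm k) subset_rfl) (hSm k) T)
      (lintegral_mono fun ω => (finiteModification_le _ ω _).trans ?_)
    rw [Kernel.restrict_apply, Measure.restrict_apply (MeasurableSet.univ.prod (hSm k)),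
      IsIntensityMeasure.kernel_apply, prod_inter_prod, inter_univ, univ_inter]
  finite_bound := by
    filter_upwards [hfin] with ω hω
    rwa [stoppedVariation_apply, Measure.restrict_apply_univ]
  le x := by
    filter_upwards [stoppedIntensity_ae_eq hN hle hfin x, hle x] with ω h1 h2
    rw [h1, stoppedVariation_apply, ← Measure.restrict_smul]
    exact Measure.restrict_mono subset_rfl h2
  parallelogram x y := by
    filter_upwards [stoppedIntensity_ae_eq hN hle hfin (x + y),
      stoppedIntensity_ae_eq hN hle hfin (x - y), stoppedIntensity_ae_eq hN hle hfin x,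
      stoppedIntensity_ae_eq hN hle hfin y,
      IsIntensityMeasure.parallelogram h𝓕 hM hS hSm hS𝒜 (hN (x + y)) (hN (x - y)) (hN x) (hN y)]
      with ω h1 h2 h3 h4 h5
    rw [h1, h2, h3, h4, ← Measure.restrict_add, ← Measure.restrict_add, ← Measure.restrict_add, h5]

include hle hfin in
/-- Minimality of the quadratic variation passes to `[0, T]`. -/
theorem IsQuadraticVariation.stoppedVariation_minimal (hη : IsQuadraticVariation 𝓕 P 𝒜 M η)
    {ζ : Kernel Ω (ℝ≥0 × U)}
    (hζ : ∀ x : StrongDual ℝ X, ‖x‖ = 1 → ∀ᵐ ω ∂P, stoppedIntensity hN T x ω ≤ ζ ω)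
    (hζη : ∀ᵐ ω ∂P, ζ ω ≤ stoppedVariation hη.dominates.1 T ω) :
    ∀ᵐ ω ∂P, stoppedVariation hη.dominates.1 T ω ≤ ζ ω := by
  have hD : MeasurableSet (Iic T ×ˢ (univ : Set U)) := measurableSet_Iic.prod MeasurableSet.univ
  -- A bound on $[0,T]$ becomes a competitor on all of $[0,\infty)$ by keeping $\eta$ after $T$;
  -- minimality is then restricted back to $[0,T]$.
  let ζ' : Kernel Ω (ℝ≥0 × U) := Kernel.restrict ⟨η, hη.dominates.1⟩ hD.compl + ζ
  have hζ' : ∀ ω, ζ' ω = (η ω).restrict (Iic T ×ˢ univ)ᶜ + ζ ω := fun ω => by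
    simp only [ζ', FunLike.coe_add, Pi.add_apply, Kernel.restrict_apply]
    rfl
  have h := hη.minimal ζ' ⟨ζ'.measurable, fun x hx => ⟨N x, hN x, ?_⟩⟩ ?_
  · filter_upwards [h] with ω hω
    have h1 := Measure.restrict_mono (subset_refl (Iic T ×ˢ (univ : Set U))) hω
    rw [hζ', Measure.restrict_add, Measure.restrict_restrict hD, inter_compl_self,
      Measure.restrict_empty, zero_add] at h1
    rw [stoppedVariation_apply]
    exact h1.trans Measure.restrict_le_self
  · filter_upwards [hζ x hx, stoppedIntensity_ae_eq hN hle hfin x, hle x] with ω h1 h2 h3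
    have hx1 : ‖x‖₊ = 1 := by ext; exact hx
    rw [hx1, one_pow, one_smul] at h3
    rw [h2] at h1
    rw [hζ', ← Measure.restrict_compl_add_restrict (μ := N x ω) hD]
    exact add_le_add (Measure.restrict_mono subset_rfl h3) h1
  · filter_upwards [hζη] with ω h1
    rw [stoppedVariation_apply] at h1
    rw [hζ']
    conv_rhs => rw [← Measure.restrict_compl_add_restrict (μ := η ω) hD]
    exact add_le_add le_rfl h1

end IntensityFamily

/-! ### Transfer to $[0,T]\times U$. -/

section RestrictTime

variable {U : Type*} [MeasurableSpace U] {T : ℝ≥0}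

theorem measurableEmbedding_incl : MeasurableEmbedding (incl (U := U) T) := by
  have h1 : MeasurableEmbedding (Subtype.val : Icc (0 : ℝ≥0) T → ℝ≥0) :=
    MeasurableEmbedding.subtype_coe measurableSet_Icc
  exact h1.prodMap MeasurableEmbedding.id

omit [MeasurableSpace U] in
theorem range_incl : range (incl (U := U) T) = Iic T ×ˢ univ := by
  ext p
  constructor
  · rintro ⟨q, rfl⟩
    exact ⟨q.1.2.2, mem_univ _⟩
  · rintro ⟨h, -⟩
    exact ⟨(⟨p.1, zero_le, h⟩, p.2), rfl⟩

theorem restrictTime_apply (μ : Measure (ℝ≥0 × U)) (C : Set (Icc (0 : ℝ≥0) T × U)) :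
    restrictTime T μ C = μ (incl T '' C) :=
  measurableEmbedding_incl.comap_apply μ C

theorem map_restrictTime (μ : Measure (ℝ≥0 × U)) :
    (restrictTime T μ).map (incl T) = μ.restrict (Iic T ×ˢ univ) := by
  rw [restrictTime, measurableEmbedding_incl.map_comap, range_incl]

theorem restrictTime_univ (μ : Measure (ℝ≥0 × U)) :
    restrictTime T μ univ = μ (Iic T ×ˢ univ) := by
  rw [restrictTime_apply, image_univ, range_incl]

theorem restrictTime_preimage_Ioc (μ : Measure (ℝ≥0 × U)) {s t : ℝ≥0} (ht : t ≤ T) (A : Set U) :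
    restrictTime T μ (incl T ⁻¹' (Ioc s t ×ˢ A)) = μ (Ioc s t ×ˢ A) := by
  rw [restrictTime_apply, image_preimage_eq_of_subset]
  rw [range_incl]
  exact prod_mono (fun r hr => hr.2.trans ht) (subset_univ _)

theorem restrictTime_eq_withDensity {μ ν : Measure (ℝ≥0 × U)} {f : ℝ≥0 × U → ℝ≥0∞}
    (h : μ.restrict (Iic T ×ˢ univ) = (ν.restrict (Iic T ×ˢ univ)).withDensity f) :
    restrictTime T μ = (restrictTime T ν).withDensity fun p => f (incl T p) := by
  ext C hC
  have hC' := measurableEmbedding_incl.measurableSet_image.2 hC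
  have e : μ (incl T '' C) = μ.restrict (Iic T ×ˢ univ) (incl T '' C) := by
    rw [Measure.restrict_apply hC', inter_eq_left.2]
    rw [← range_incl]
    exact image_subset_range _ _
  rw [restrictTime_apply, e, h, withDensity_apply _ hC', withDensity_apply _ hC,
    ← map_restrictTime, measurableEmbedding_incl.restrict_map, measurableEmbedding_incl.lintegral_map,
    preimage_image_eq _ measurableEmbedding_incl.injective]

theorem ae_restrictTime {μ : Measure (ℝ≥0 × U)} {p : ℝ≥0 × U → Prop}
    (h : ∀ᵐ z ∂(μ.restrict (Iic T ×ˢ univ)), p z) :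
    ∀ᵐ z ∂(restrictTime T μ), p (incl T z) := by
  rwa [← map_restrictTime, measurableEmbedding_incl.ae_map_iff] at h

theorem measurable_restrictTime {Ω : Type*} [MeasurableSpace Ω] {ν : Ω → Measure (ℝ≥0 × U)}
    (hν : Measurable ν) {C : Set (Icc (0 : ℝ≥0) T × U)} (hC : MeasurableSet C) :
    Measurable fun ω => restrictTime T (ν ω) C := by
  simp only [restrictTime_apply]
  exact (Measure.measurable_coe (measurableEmbedding_incl.measurableSet_image.2 hC)).comp hν

end RestrictTime

/-! ### Integrating a bounded field of bilinear forms. -/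

section BilinMeasure

variable {V α : Type*} [NormedAddCommGroup V] [NormedSpace ℝ V] {mα : MeasurableSpace α}
  {ρ : Measure α} [IsFiniteMeasure ρ] {q : α → V →L[ℝ] V →L[ℝ] ℝ}

theorem integrable_bilin (hq : ∀ x y, Measurable fun p => q p x y) (hb : ∀ p, ‖q p‖ ≤ 1)
    (x y : V) : Integrable (fun p => q p x y) ρ := by
  refine Integrable.of_bound (hq x y).aestronglyMeasurable (‖x‖ * ‖y‖) (ae_of_all _ fun p => ?_)
  refine ((q p).le_opNorm₂ x y).trans ?_
  rw [mul_assoc]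
  exact mul_le_of_le_one_left (by positivity) (hb p)

/-- A bounded field of bilinear forms integrates to a measure with values in the bilinear
forms. -/
theorem exists_vectorMeasure_bilin (hq : ∀ x y, Measurable fun p => q p x y)
    (hb : ∀ p, ‖q p‖ ≤ 1) :
    ∃ Γ : VectorMeasure α (V →L[ℝ] V →L[ℝ] ℝ),
      ∀ C, MeasurableSet C → ∀ x y, Γ C x y = ∫ p in C, q p x y ∂ρ := by
  have hi := integrable_bilin (ρ := ρ) hq hb
  have key : ∀ C, ∃ B : V →L[ℝ] V →L[ℝ] ℝ, (∀ x y, B x y = ∫ p in C, q p x y ∂ρ) ∧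
      ‖B‖ ≤ (ρ C).toReal := by
    intro C
    let L : V →ₗ[ℝ] V →ₗ[ℝ] ℝ := LinearMap.mk₂ ℝ (fun x y => ∫ p in C, q p x y ∂ρ)
      (fun x x' y => by
        simp only [map_add, add_apply]
        exact integral_add (hi x y).integrableOn (hi x' y).integrableOn)
      (fun c x y => by
        simp only [map_smul, smul_apply, smul_eq_mul]
        exact integral_const_mul _ _)
      (fun x y y' => by
        simp only [map_add]
        exact integral_add (hi x y).integrableOn (hi x y').integrableOn)
      (fun c x y => by
        simp only [map_smul, smul_eq_mul]
        exact integral_const_mul _ _)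
    refine ⟨L.mkContinuous₂ (ρ C).toReal fun x y => ?_, fun x y => rfl,
      L.mkContinuous₂_norm_le ENNReal.toReal_nonneg _⟩
    have h := norm_setIntegral_le_of_norm_le_const (μ := ρ) (s := C) (f := fun p => q p x y)
      (C := ‖x‖ * ‖y‖) (measure_lt_top ρ C) fun p _ => by
        refine ((q p).le_opNorm₂ x y).trans ?_
        rw [mul_assoc]
        exact mul_le_of_le_one_left (by positivity) (hb p)
    refine h.trans (le_of_eq ?_)
    rw [Measure.real]
    ring
  choose B hB hBn using key
  classical
  refine ⟨⟨fun C => if MeasurableSet C then B C else 0, ?_, fun C hC => if_neg hC,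
    fun f hf hd => ?_⟩, fun C hC x y => ?_⟩
  · rw [if_pos MeasurableSet.empty]
    ext x y
    simp [hB]
  · simp only [hf, if_true, MeasurableSet.iUnion hf]
    -- Countable additivity holds in operator norm, since $\|B(C)\|\le\rho(C)$ and $\rho$ is finite.
    have hs : Summable fun i => B (f i) := by
      refine Summable.of_norm_bounded (g := fun i => (ρ (f i)).toReal) ?_ fun i => hBn _
      refine ENNReal.summable_toReal ?_
      rw [← measure_iUnion hd hf]
      exact measure_ne_top _ _
    convert hs.hasSum using 1
    ext x y
    have h1 : HasSum (fun i => B (f i) x y) ((∑' i, B (f i)) x y) :=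
      (((ContinuousLinearMap.apply ℝ ℝ y).comp
        (ContinuousLinearMap.apply ℝ (V →L[ℝ] ℝ) x)).hasSum hs.hasSum)
    refine HasSum.unique ?_ h1
    simp only [hB]
    exact hasSum_integral_iUnion hf hd (hi x y).integrableOn
  · change (if MeasurableSet C then B C else 0) x y = _
    rw [if_pos hC, hB]

/-- Symmetry gives $q(x+y,x+y)-q(x-y,x-y)=4q(x,y)$ pointwise; positivity makes the measures' values
ordinary integrals. -/
theorem setIntegral_bilin_eq (hq : ∀ x y, Measurable fun p => q p x y) (hb : ∀ p, ‖q p‖ ≤ 1)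
    (hs : ∀ p x y, q p x y = q p y x) (hp : ∀ p x, 0 ≤ q p x x) {x y : V} {ν₁ ν₂ : Measure α}
    (h₁ : ν₁ = ρ.withDensity fun p => ENNReal.ofReal (q p (x + y) (x + y)))
    (h₂ : ν₂ = ρ.withDensity fun p => ENNReal.ofReal (q p (x - y) (x - y)))
    {C : Set α} (hC : MeasurableSet C) :
    ν₁ C < ∞ ∧ ν₂ C < ∞ ∧ ∫ p in C, q p x y ∂ρ = ((ν₁ C).toReal - (ν₂ C).toReal) / 4 := by
  have hi := integrable_bilin (ρ := ρ) hq hb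
  have hd : ∀ z : V, ρ.withDensity (fun p => ENNReal.ofReal (q p z z)) C =
      ENNReal.ofReal (∫ p in C, q p z z ∂ρ) := fun z => by
    rw [withDensity_apply _ hC, ofReal_integral_eq_lintegral_ofReal (hi z z).integrableOn
      (ae_of_all _ fun p => hp p z)]
  have hn : ∀ z : V, 0 ≤ ∫ p in C, q p z z ∂ρ := fun z => integral_nonneg fun p => hp p z
  rw [h₁, h₂, hd, hd, ENNReal.toReal_ofReal (hn _), ENNReal.toReal_ofReal (hn _)]
  refine ⟨ENNReal.ofReal_lt_top, ENNReal.ofReal_lt_top, ?_⟩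
  rw [← integral_sub (hi _ _).integrableOn (hi _ _).integrableOn, ← integral_div]
  refine integral_congr_ae (ae_of_all _ fun p => ?_)
  simp only [map_add, map_sub, add_apply, sub_apply, hs p y x]
  ring

end BilinMeasure

end CylMVM

namespace CylMVM

open ProbabilityTheory

/-! ### The covariation operator measure and its density. -/

section CovariationDensity

variable {Ω U X : Type*} {mΩ : MeasurableSpace Ω} {P : Measure Ω}
  {𝓕 : Filtration ℝ≥0 mΩ} [MeasurableSpace U] [NormedAddCommGroup X] [NormedSpace ℝ X]
  {𝒜 : Set (Set U)} {M : ℝ≥0 → Set U → StrongDual ℝ X →ₗ[ℝ] (Ω →ₘ[P] ℝ)}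
  {η : Ω → Measure (ℝ≥0 × U)} {T : ℝ≥0}

/-- The sets $S_k$ belong to $\mathcal A$ and increase to $U$, so continuity from below carries the
uniform bound to all of $U$. -/
theorem ae_lt_top_of_iSup_lt_top {S : ℕ → Set U} (hSmono : Monotone S) (hS : ⋃ k, S k = univ)
    (hS𝒜 : ∀ k, S k ∈ 𝒜) (hbdd : ∀ᵐ ω ∂P, (⨆ A ∈ 𝒜, η ω (Icc 0 T ×ˢ A)) < ∞) :
    ∀ᵐ ω ∂P, η ω (Iic T ×ˢ univ) < ∞ := by
  filter_upwards [hbdd] with ω hω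
  refine lt_of_le_of_lt ?_ hω
  have e : (Iic T ×ˢ univ : Set (ℝ≥0 × U)) = ⋃ k, Icc 0 T ×ˢ S k := by
    rw [← prod_iUnion, hS, Icc_zero_eq_Iic]
  rw [e, (show Monotone fun k => Icc 0 T ×ˢ S k from fun i j hij =>
    prod_mono subset_rfl (hSmono hij)).measure_iUnion]
  exact iSup_le fun k => le_iSup₂_of_le (S k) (hS𝒜 k) le_rfl

/-- The density of the covariation operator measure, on `[0, T] × U`. -/
structure IsCovariationDensity (𝓕 : Filtration ℝ≥0 mΩ) (P : Measure Ω)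
    (η : Ω → Measure (ℝ≥0 × U)) (N : StrongDual ℝ X → Ω → Measure (ℝ≥0 × U)) (T : ℝ≥0)
    (Q : Ω → Icc (0 : ℝ≥0) T × U → StrongDual ℝ X →L[ℝ] StrongDual ℝ (StrongDual ℝ X)) :
    Prop where
  predictable : ∀ x y, Measurable[(predictableUpTo 𝓕 T).prod inferInstance]
    fun p : (Ω × Icc (0 : ℝ≥0) T) × U => Q p.1.1 (p.1.2, p.2) x y
  measurable : ∀ ω x y, Measurable fun p => Q ω p x y
  symm : ∀ ω p x y, Q ω p x y = Q ω p y x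
  nonneg : ∀ ω p x, 0 ≤ Q ω p x x
  norm_le : ∀ ω p, ‖Q ω p‖ ≤ 1
  norm_eq : ∀ᵐ ω ∂P, ∀ᵐ p ∂(restrictTime T (η ω)), ‖Q ω p‖ = 1
  density : ∀ x, ∀ᵐ ω ∂P, restrictTime T (N x ω) =
    (restrictTime T (η ω)).withDensity fun p => ENNReal.ofReal (Q ω p x x)

theorem IsQuadraticVariation.exists_isCovariationDensity [IsFiniteMeasure P]
    [MeasurableSpace.CountablyGenerated U]
    [TopologicalSpace.SeparableSpace (StrongDual ℝ X)]
    (h𝓕 : ∀ s : Set Ω, P s = 0 → MeasurableSet[𝓕 0] s)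
    (hM : IsCylindricalOrthogonalMVM 𝓕 P 𝒜 M) (hη : IsQuadraticVariation 𝓕 P 𝒜 M η)
    {S : ℕ → Set U} (hS : ⋃ k, S k = univ)
    (hSm : ∀ k, MeasurableSet (S k)) (hS𝒜 : ∀ k B, MeasurableSet B → B ⊆ S k → B ∈ 𝒜)
    (hfin : ∀ᵐ ω ∂P, η ω (Iic T ×ˢ univ) < ∞)
    {N : StrongDual ℝ X → Ω → Measure (ℝ≥0 × U)}
    (hN : ∀ x, IsIntensityMeasure 𝓕 P 𝒜 M x (N x))
    (hle : ∀ x, ∀ᵐ ω ∂P, N x ω ≤ (‖x‖₊ ^ 2 : ℝ≥0) • η ω) :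
    ∃ Q, IsCovariationDensity 𝓕 P η N T Q := by
  obtain ⟨Q, hQm, hQs, hQp, hQ1, hQn, hQd⟩ :=
    (isQuadraticFamily_stoppedIntensity hN hle hfin h𝓕 hM hS hSm hS𝒜
      hη.dominates.1).exists_density h𝓕 hS hSm
      fun ζ h1 h2 => hη.stoppedVariation_minimal hN hle hfin h1 h2
  refine ⟨fun ω p => Q (⟨p.1, ω⟩, p.2), ?_, ?_, fun ω p x y => hQs _ x y, fun ω p x => hQp _ x,
    fun ω p => hQ1 _, ?_, ?_⟩
  · intro x y
    have h1 : Measurable[predictableUpTo 𝓕 T]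
        fun p : Ω × Icc (0 : ℝ≥0) T => (⟨p.2, p.1⟩ : Pred 𝓕) :=
      measurable_pred_mk_predictable.comp (comap_measurable _)
    let _ : MeasurableSpace (Ω × Icc (0 : ℝ≥0) T) := predictableUpTo 𝓕 T
    exact (hQm x y).comp ((h1.comp measurable_fst).prodMk measurable_snd)
  · exact fun ω x y => ((hQm x y).comp (measurable_predMk_right ω)).comp
      measurableEmbedding_incl.measurable
  · filter_upwards [hQn] with ω hω
    rw [stoppedVariation_apply] at hω
    exact ae_restrictTime hω
  · intro x
    filter_upwards [hQd x, stoppedIntensity_ae_eq hN hle hfin x] with ω h1 h2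
    rw [h2, stoppedVariation_apply] at h1
    have h3 := restrictTime_eq_withDensity
      (f := fun p => ENNReal.ofReal (Q (⟨p.1, ω⟩, p.2) x x)) h1
    simpa only [incl] using h3

variable {N : StrongDual ℝ X → Ω → Measure (ℝ≥0 × U)}
  {Q : Ω → Icc (0 : ℝ≥0) T × U → StrongDual ℝ X →L[ℝ] StrongDual ℝ (StrongDual ℝ X)}

theorem IsCovariationDensity.setIntegral_eq (hQ : IsCovariationDensity 𝓕 P η N T Q)
    (hfin : ∀ᵐ ω ∂P, IsFiniteMeasure (restrictTime T (η ω))) (x y : StrongDual ℝ X) :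
    ∀ᵐ ω ∂P, ∀ C, MeasurableSet C →
      restrictTime T (N (x + y) ω) C < ∞ ∧ restrictTime T (N (x - y) ω) C < ∞ ∧
      ∫ p in C, Q ω p x y ∂(restrictTime T (η ω)) =
        ((restrictTime T (N (x + y) ω) C).toReal -
          (restrictTime T (N (x - y) ω) C).toReal) / 4 := by
  filter_upwards [hfin, hQ.density (x + y), hQ.density (x - y)] with ω _ h1 h2 C hC
  exact setIntegral_bilin_eq (hQ.measurable ω) (hQ.norm_le ω) (hQ.symm ω) (hQ.nonneg ω) h1 h2 hC

/-- Existence of the covariation operator measure. -/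
theorem IsCovariationDensity.exists_isCovariationOperatorMeasure [P.IsComplete]
    (hQ : IsCovariationDensity 𝓕 P η N T Q)
    (h𝓕 : ∀ s : Set Ω, P s = 0 → MeasurableSet[𝓕 0] s)
    (hM : IsCylindricalOrthogonalMVM 𝓕 P 𝒜 M) (h𝒜m : ∀ A ∈ 𝒜, MeasurableSet A)
    (hfin : ∀ᵐ ω ∂P, IsFiniteMeasure (restrictTime T (η ω)))
    (hN : ∀ x, IsIntensityMeasure 𝓕 P 𝒜 M x (N x)) :
    ∃ Γ, IsCovariationOperatorMeasure 𝓕 P 𝒜 M T Γ := by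
  have hΓ : ∀ ω, ∃ Γ : VectorMeasure (Icc (0 : ℝ≥0) T × U)
      (StrongDual ℝ X →L[ℝ] StrongDual ℝ (StrongDual ℝ X)),
      IsFiniteMeasure (restrictTime T (η ω)) → ∀ C, MeasurableSet C → ∀ x y,
        Γ C x y = ∫ p in C, Q ω p x y ∂(restrictTime T (η ω)) := fun ω => by
    by_cases h : IsFiniteMeasure (restrictTime T (η ω))
    · obtain ⟨Γ, hΓ⟩ := exists_vectorMeasure_bilin (ρ := restrictTime T (η ω))
        (hQ.measurable ω) (hQ.norm_le ω)
      exact ⟨Γ, fun _ => hΓ⟩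
    -- On the null event where $\eta$ is infinite, $\Gamma$ is set to zero.
    · exact ⟨0, fun h' => absurd h' h⟩
  choose Γ hΓ using hΓ
  have hpol : ∀ x y, ∀ᵐ ω ∂P, ∀ C, MeasurableSet C →
      restrictTime T (N (x + y) ω) C < ∞ ∧ restrictTime T (N (x - y) ω) C < ∞ ∧
      Γ ω C x y = ((restrictTime T (N (x + y) ω) C).toReal -
          (restrictTime T (N (x - y) ω) C).toReal) / 4 := fun x y => by
    filter_upwards [hfin, hQ.setIntegral_eq hfin x y] with ω h1 h2 C hC
    rw [hΓ ω h1 C hC]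
    exact h2 C hC
  refine ⟨Γ, fun C hC x y => ?_, fun x y => ⟨_, _, hN _, hN _, hpol x y⟩, fun x y A hA =>
    ⟨_, isPredictableCovariation_polarization h𝓕 hM (hN (x + y)) (hN (x - y)) hA (h𝒜m A hA),
      fun s t hst ht => ?_⟩⟩
  · have hm : Measurable fun ω => ((restrictTime T (N (x + y) ω) C).toReal -
        (restrictTime T (N (x - y) ω) C).toReal) / 4 :=
      ((measurable_restrictTime (hN _).measurable hC).ennreal_toReal.sub
        (measurable_restrictTime (hN _).measurable hC).ennreal_toReal).div_const 4
    -- The polarization formula is measurable in $\omega$ and agrees with $\Gamma$ almost surely;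
    -- completeness of $P$ transfers measurability.
    refine hm.congr_ae (μ := P) ?_
    filter_upwards [hpol x y] with ω hω
    exact (hω C hC).2.2.symm
  · have hAm := h𝒜m A hA
    filter_upwards [hpol x y, (hN (x + y)).lt_top hA, (hN (x - y)).lt_top hA] with ω h1 h2 h3
    rw [(h1 _ (measurableEmbedding_incl.measurable (measurableSet_Ioc.prod hAm))).2.2,
      restrictTime_preimage_Ioc _ ht, restrictTime_preimage_Ioc _ ht,
      measure_Ioc_prod_eq hAm h2 hst, measure_Ioc_prod_eq hAm h3 hst,
      ENNReal.toReal_ofReal (sub_nonneg.2 (monotone_toReal_measure_Iic h2 hst)),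
      ENNReal.toReal_ofReal (sub_nonneg.2 (monotone_toReal_measure_Iic h3 hst))]
    ring

/-- Every covariation operator measure has the given density. -/
theorem IsCovariationDensity.ae_eq_setIntegral [IsFiniteMeasure P]
    [MeasurableSpace.CountablyGenerated U]
    [TopologicalSpace.SeparableSpace (StrongDual ℝ X)]
    (hQ : IsCovariationDensity 𝓕 P η N T Q)
    (h𝓕 : ∀ s : Set Ω, P s = 0 → MeasurableSet[𝓕 0] s)
    (hM : IsCylindricalOrthogonalMVM 𝓕 P 𝒜 M)
    {S : ℕ → Set U} (hS : ⋃ k, S k = univ)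
    (hSm : ∀ k, MeasurableSet (S k)) (hS𝒜 : ∀ k B, MeasurableSet B → B ⊆ S k → B ∈ 𝒜)
    (hfin : ∀ᵐ ω ∂P, IsFiniteMeasure (restrictTime T (η ω)))
    (hN : ∀ x, IsIntensityMeasure 𝓕 P 𝒜 M x (N x))
    {Γ : Ω → VectorMeasure (Icc (0 : ℝ≥0) T × U)
      (StrongDual ℝ X →L[ℝ] StrongDual ℝ (StrongDual ℝ X))}
    (hΓ : IsCovariationOperatorMeasure 𝓕 P 𝒜 M T Γ) :
    ∀ᵐ ω ∂P, ∀ x y, Integrable (fun p => Q ω p x y) (restrictTime T (η ω)) ∧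
      ∀ C, MeasurableSet C → Γ ω C x y = ∫ p in C, Q ω p x y ∂(restrictTime T (η ω)) := by
  let d := TopologicalSpace.denseSeq (StrongDual ℝ X)
  -- The exceptional event in the polarization formula depends on the pair; a countable dense family
  -- of pairs leaves one null set.
  have hd : DenseRange d := TopologicalSpace.denseRange_denseSeq _
  have hij : ∀ᵐ ω ∂P, ∀ i j, ∀ C, MeasurableSet C →
      Γ ω C (d i) (d j) = ∫ p in C, Q ω p (d i) (d j) ∂(restrictTime T (η ω)) := by
    refine ae_all_iff.2 fun i => ae_all_iff.2 fun j => ?_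
    obtain ⟨ν₁, ν₂, h1, h2, h3⟩ := hΓ.polarization (d i) (d j)
    filter_upwards [h3, h1.ae_eq h𝓕 hM hS hSm hS𝒜 (hN _), h2.ae_eq h𝓕 hM hS hSm hS𝒜 (hN _),
      hQ.setIntegral_eq hfin (d i) (d j)] with ω e1 e2 e3 e4 C hC
    rw [(e1 C hC).2.2, e2, e3, (e4 C hC).2.2]
  filter_upwards [hij, hfin] with ω h1 h2 x y
  refine ⟨integrable_bilin (hQ.measurable ω) (hQ.norm_le ω) x y, fun C hC => ?_⟩
  -- The integral of $Q$ is realized as an operator measure so that both sides are jointly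
  -- continuous in the pair and equality extends by density.
  obtain ⟨Γ', hΓ'⟩ := exists_vectorMeasure_bilin (ρ := restrictTime T (η ω))
    (hQ.measurable ω) (hQ.norm_le ω)
  have hc : ∀ B : StrongDual ℝ X →L[ℝ] StrongDual ℝ (StrongDual ℝ X),
      Continuous fun z : StrongDual ℝ X × StrongDual ℝ X => B z.1 z.2 := fun B =>
    (B.continuous.comp continuous_fst).clm_apply continuous_snd
  have h := (hd.prodMap hd).equalizer (hc (Γ ω C)) (hc (Γ' C)) (by
    ext ⟨i, j⟩
    exact (h1 i j C hC).trans (hΓ' C hC _ _).symm)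
  exact (congrFun h (x, y)).trans (hΓ' C hC x y)

end CovariationDensity

end CylMVM

/-! ### The theorem. -/

theorem mainTheorem2 {Ω U X : Type*} {mΩ : MeasurableSpace Ω}
    (P : Measure Ω) [IsProbabilityMeasure P] [P.IsComplete]
    (𝓕 : Filtration ℝ≥0 mΩ) [𝓕.IsRightContinuous]
    (h𝓕 : ∀ s : Set Ω, P s = 0 → MeasurableSet[𝓕 0] s)
    [TopologicalSpace U] [T2Space U] [MeasurableSpace U] [BorelSpace U] [StandardBorelSpace U]
    [NormedAddCommGroup X] [NormedSpace ℝ X] [CompleteSpace X]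
    [TopologicalSpace.SeparableSpace (StrongDual ℝ X)]
    (𝒜 : Set (Set U)) (h𝒜 : IsSetRing 𝒜) (h𝒜m : ∀ A ∈ 𝒜, MeasurableSet A)
    (M : ℝ≥0 → Set U → StrongDual ℝ X →ₗ[ℝ] (Ω →ₘ[P] ℝ))
    (hM : CylMVM.IsCylindricalOrthogonalMVM 𝓕 P 𝒜 M)
    (η : Ω → Measure (ℝ≥0 × U)) (hη : CylMVM.IsQuadraticVariation 𝓕 P 𝒜 M η)
    (hseq : CylMVM.SequentialBoundedness 𝓕 P 𝒜 M)
    (T : ℝ≥0) (hT : 0 < T)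
    (hbdd : ∀ᵐ ω ∂P, (⨆ A ∈ 𝒜, η ω (Icc 0 T ×ˢ A)) < ∞) :
    (∃ Γ, CylMVM.IsCovariationOperatorMeasure 𝓕 P 𝒜 M T Γ) ∧
    ∃ Q : Ω → Icc (0 : ℝ≥0) T → U → (StrongDual ℝ X →L[ℝ] StrongDual ℝ (StrongDual ℝ X)),
      (∀ Γ, CylMVM.IsCovariationOperatorMeasure 𝓕 P 𝒜 M T Γ →
        ∀ᵐ ω ∂P, ∀ x y,
          Integrable (fun p : Icc (0 : ℝ≥0) T × U => Q ω p.1 p.2 x y)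
            (CylMVM.restrictTime T (η ω)) ∧
          ∀ C, MeasurableSet C →
            Γ ω C x y = ∫ p in C, Q ω p.1 p.2 x y ∂(CylMVM.restrictTime T (η ω))) ∧
      (∀ x y, Measurable[(CylMVM.predictableUpTo 𝓕 T).prod inferInstance]
        fun p : (Ω × Icc (0 : ℝ≥0) T) × U => Q p.1.1 p.1.2 p.2 x y) ∧
      (∀ᵐ ω ∂P, ∀ᵐ p ∂(CylMVM.restrictTime T (η ω)),
        (∀ x, 0 ≤ Q ω p.1 p.2 x x) ∧ ∀ x y, Q ω p.1 p.2 x y = Q ω p.1 p.2 y x) ∧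
      (∀ᵐ ω ∂P, ∀ᵐ p ∂(CylMVM.restrictTime T (η ω)), ‖Q ω p.1 p.2‖ = 1) := by
  -- Only an exhausting sequence inside $\mathcal A$ is needed, so the time $1$ and the vector $0$
  -- are arbitrary choices.
  obtain ⟨-, -, S, hSmono, hS, hSm, hS𝒜, -⟩ := hM.measure 1 one_pos 0
  have hfin := CylMVM.ae_lt_top_of_iSup_lt_top hSmono hS
    (fun k => hS𝒜 k _ (hSm k) subset_rfl) hbdd
  have hfin' : ∀ᵐ ω ∂P, IsFiniteMeasure (CylMVM.restrictTime T (η ω)) :=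
    hfin.mono fun ω hω => ⟨by rwa [CylMVM.restrictTime_univ]⟩
  choose N hN hle using fun x => hη.exists_intensity h𝓕 hM x
  obtain ⟨Q, hQ⟩ := hη.exists_isCovariationDensity (T := T) h𝓕 hM hS hSm hS𝒜 hfin hN hle
  refine ⟨hQ.exists_isCovariationOperatorMeasure h𝓕 hM h𝒜m hfin' hN,
    fun ω r u => Q ω (r, u), fun Γ hΓ => ?_, hQ.predictable,
    ae_of_all _ fun ω => ae_of_all _ fun p => ⟨hQ.nonneg ω p, hQ.symm ω p⟩, hQ.norm_eq⟩
  exact hQ.ae_eq_setIntegral h𝓕 hM hS hSm hS𝒜 hfin' hN hΓ
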